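/- Let $D\subset\mathbb{R}^2$ be a bounded open set whose boundary has Lebesgue measure zero, let $\alpha>0$ and $m>0$, and let $g\in L^2(D)$ with $g\ge 0$ a.e. in $D$ (for instance $g=\alpha\Delta f$). For an open set $\Omega\subset\mathbb{R}^2$, $h\in L^2(\Omega)$ and a closed set $K\subset\overline{\Omega}$, let $v_{K,h,\Omega}\in H^1(\Omega)$ be the weak solution of \[ v-\alpha\Delta v=h \ \text{ in } \Omega\setminus K,\qquad v=0\ \text{ in } K,\qquad \frac{\partial v}{\partial \mathbf n}=0\ \text{ on } \partial \Omega, \] that is, $v=0$ in $K$ and $\int_\Omega v\varphi\,dx+\alpha\int_\Omega\nabla v\cdot\nabla\varphi\,dx=\int_\Omega h\varphi\,dx$ for all $\varphi\in H^1(\Omega)$ with $\varphi=0$ in $K$. For $t\ge 0$ and $n\ge1$ let \[ \mathcal{A}_{t,n}(\Omega)=\Big\{\overline{\Omega}\cap\bigcup_{i=1}^n\overline{B(x_i,r)}\ \Big|\ r=t\,n^{-1/2},\ \operatorname{dist}(x_i,\Omega)<r\Big\},\] and for $K\in\mathcal{A}_{t,n}(\Omega)$ with centres $x_1,\dots,x_n$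 let $\mu_K=\frac1n\sum_{i=1}^n\delta_{x_i}$. Define $F_n:\mathcal{P}(\overline D)\to[0,+\infty]$ by \[ F_n(\mu)=\begin{cases} n\displaystyle\int_D g\,v_{K,g,D}\,dx & \text{if } \mu=\mu_K \text{ for some } K\in\mathcal{A}_{m,n}(D),\\ +\infty&\text{otherwise.}\end{cases}\] Then $F_n$ $\Gamma$-converges, as $n\to\infty$, with respect to the weak-$\star$ topology of $\mathcal{P}(\overline D)$, to \[ F(\mu)=\int_D \frac{g^2}{\mu_a}\,\theta\big(m\,\mu_a^{1/2}\big)\,dx, \] where $\mu=\mu_a\,dx+\nu$ is the Lebesgue decomposition of $\mu$ with respect to Lebesgue measure, the integrand is read as $0$ where $g=0$ and as $+\infty$ where $g>0$ and $\mu_a=0$, and, with $I^2=(0,1)^2$ the unit square, \[ \theta(t)=\inf\Big\{\liminf_{n\to\infty}\ n\int_{I^2} v_{K_n,1,I^2}\,dx\ \Big|\ K_n\in\mathcal{A}_{t,n}(I^2)\ \text{for all } n\Big\},\qquad t\ge 0 .\] Here $\Gamma$-convergence means: for every $\mu\in\mathcal{P}(\overline D)$ there are $\mu_n\to\mu$ with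 $\limsup_n F_n(\mu_n)\le F(\mu)$, and for every $\mu$ and every sequence $\mu_n\to\mu$ one has $F(\mu)\le\liminf_n F_n(\mu_n)$. -/

import Mathlib

open MeasureTheory Filter Topology
open scoped ENNReal ContDiff

noncomputable section

namespace FatPixels

/-- The Euclidean plane. -/
abbrev Plane : Type := EuclideanSpace ℝ (Fin 2)

/-- `v` belongs to `H¹(D)` and `G` is its weak gradient on the open set `D`. -/
structure IsSobolevPair (D : Set Plane) (v : Plane → ℝ) (G : Plane → Plane) : Prop where
  memLp_fun : MemLp v 2 (volume.restrict D)
  memLp_grad : MemLp G 2 (volume.restrict D)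
  weak_grad : ∀ φ : Plane → ℝ, ContDiff ℝ ∞ φ → HasCompactSupport φ → tsupport φ ⊆ D →
    ∀ e : Plane, ∫ x in D, v x * fderiv ℝ φ x e = - ∫ x in D, inner ℝ (G x) e * φ x

/-- `v = 0` in `K`, as an element of `H¹(D)`. Only finite unions of closed balls of positive radius
occur as `K` (intersected with `closure D`); for these, vanishing almost everywhere and vanishing
quasi-everywhere on `D ∩ K` are the same condition on an `H¹(D)` function. -/
def VanishesOn (D K : Set Plane) (v : Plane → ℝ) : Prop :=
  ∀ᵐ x ∂volume.restrict (D ∩ K), v x = 0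

/-- `v` is the weak solution in `H¹(D)` of
`v - α Δv = g` in `D \ K`, `v = 0` in `K`, `∂v/∂n = 0` on `∂D`. -/
def IsSolution (α : ℝ) (D K : Set Plane) (g v : Plane → ℝ) : Prop :=
  ∃ G : Plane → Plane, IsSobolevPair D v G ∧ VanishesOn D K v ∧
    ∀ (φ : Plane → ℝ) (H : Plane → Plane), IsSobolevPair D φ H → VanishesOn D K φ →
      (∫ x in D, v x * φ x) + α * (∫ x in D, inner ℝ (G x) (H x)) = ∫ x in D, g x * φ x

/-- `n ∫_D g v_K dx`, where `v_K` is the weak solution above, which exists and is unique up to null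
sets, so that the infimum is over one value. -/
def rescaledCompliance (α : ℝ) (D : Set Plane) (g : Plane → ℝ) (n : ℕ) (K : Set Plane) : ℝ≥0∞ :=
  ⨅ (v : Plane → ℝ) (_ : IsSolution α D K g v), ENNReal.ofReal (n * ∫ x in D, g x * v x)

/-- The radius `m n^{-1/2}` of the pixels. -/
def radius (m : ℝ) (n : ℕ) : ℝ := m / √(n : ℝ)

/-- `x₁, …, xₙ` are admissible centres: they lie in the `r`-neighbourhood of `D`, `r = m n^{-1/2}`. -/
def AdmissibleCentres (D : Set Plane) (m : ℝ) (n : ℕ) (x : Fin n → Plane) : Prop :=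
  ∀ i, x i ∈ Metric.thickening (radius m n) D

/-- The union of `n` fat pixels `closure D ∩ ⋃ᵢ closedBall xᵢ (m n^{-1/2})`. -/
def pixelSet (D : Set Plane) (m : ℝ) (n : ℕ) (x : Fin n → Plane) : Set Plane :=
  closure D ∩ ⋃ i, Metric.closedBall (x i) (radius m n)

/-- The empirical measure `(1/n) ∑ᵢ δ_{xᵢ}`. -/
def empirical (n : ℕ) (x : Fin n → Plane) : Measure Plane :=
  (n : ℝ≥0∞)⁻¹ • ∑ i, Measure.dirac (x i)

/-- The functional `F_n` on `P(closure D)`: it is `n ∫_D g v_K` if `μ` is the empirical measure of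
admissible centres with pixel set `K`, and `+∞` otherwise. For given `n` the measure determines the
centres up to order, hence `K`, so that the infimum is over at most one value. -/
def pixelFunctional (α : ℝ) (D : Set Plane) (g : Plane → ℝ) (m : ℝ) (n : ℕ)
    (μ : ProbabilityMeasure (closure D)) : ℝ≥0∞ :=
  ⨅ (x : Fin n → Plane) (_ : AdmissibleCentres D m n x)
    (_ : (μ : Measure (closure D)).map Subtype.val = empirical n x),
    rescaledCompliance α D g n (pixelSet D m n x)

/-- The open unit square. -/
def unitSquare : Set Plane := {x | ∀ i, x i ∈ Set.Ioo (0 : ℝ) 1}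

/-- `θ(m)`: the infimum, over all sequences of unions of `n` fat pixels in the unit square, of
`liminf n ∫ v_{K_n}`, for the right-hand side `1`. At `m = 0` there are no admissible centres and
the value is `+∞`. -/
def theta (α m : ℝ) : ℝ≥0∞ :=
  ⨅ (x : (n : ℕ) → Fin n → Plane) (_ : ∀ n, AdmissibleCentres unitSquare m n (x n)),
    liminf (fun n : ℕ =>
      rescaledCompliance α unitSquare (fun _ => 1) n (pixelSet unitSquare m n (x n))) atTop

/-- The density `μ_a` of the absolutely continuous part of `μ` with respect to Lebesgue measure. -/
def acDensity {D : Set Plane} (μ : ProbabilityMeasure (closure D)) : Plane → ℝ≥0∞ :=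
  ((μ : Measure (closure D)).map Subtype.val).rnDeriv volume

/-- `F(μ) = ∫_D (g² / μ_a) θ(m μ_a^{1/2}) dx`, with the integrand `0` where `g = 0` and
`+∞` where `g ≠ 0` and `μ_a = 0`. -/
def limitFunctional (α : ℝ) (D : Set Plane) (g : Plane → ℝ) (m : ℝ)
    (μ : ProbabilityMeasure (closure D)) : ℝ≥0∞ :=
  ∫⁻ x in D, ENNReal.ofReal (g x ^ 2) / acDensity μ x * theta α (m * √(acDensity μ x).toReal)

/-- Sequential `Γ`-convergence of functionals on a topological space. -/
def GammaConverges {V : Type*} [TopologicalSpace V] (F : ℕ → V → ℝ≥0∞) (F' : V → ℝ≥0∞) : Prop :=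
  (∀ u : V, ∃ w : ℕ → V, Tendsto w atTop (𝓝 u) ∧ limsup (fun n => F n (w n)) atTop ≤ F' u) ∧
  (∀ (u : V) (w : ℕ → V), Tendsto w atTop (𝓝 u) → F' u ≤ liminf (fun n => F n (w n)) atTop)

end FatPixels

end

open MeasureTheory Filter Topology
open scoped ENNReal ContDiff

noncomputable section

namespace FatPixels

/-! ### Elementary operations on Sobolev pairs -/

lemma IsSobolevPair.zero (D : Set Plane) : IsSobolevPair D (fun _ => 0) (fun _ => 0) where
  memLp_fun := MemLp.zero'
  memLp_grad := MemLp.zero'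
  weak_grad := by intros; simp

lemma IsSobolevPair.integrable_mul_fderiv {D : Set Plane} {v : Plane → ℝ}
    (h : MemLp v 2 (volume.restrict D)) {φ : Plane → ℝ} (hφ : ContDiff ℝ ∞ φ)
    (hc : HasCompactSupport φ) (e : Plane) :
    Integrable (fun x => v x * fderiv ℝ φ x e) (volume.restrict D) := by
  have h1 : MemLp (fun x => fderiv ℝ φ x e) 2 (volume.restrict D) := by
    refine MemLp.restrict _ (Continuous.memLp_of_hasCompactSupport ?_ ?_)
    · exact (hφ.continuous_fderiv (by simp)).clm_apply continuous_const
    · exact hc.fderiv_apply (𝕜 := ℝ) e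
  exact h.integrable_mul h1

lemma IsSobolevPair.integrable_inner_mul {D : Set Plane} {G : Plane → Plane}
    (h : MemLp G 2 (volume.restrict D)) {φ : Plane → ℝ} (hφ : Continuous φ)
    (hc : HasCompactSupport φ) (e : Plane) :
    Integrable (fun x => inner ℝ (G x) e * φ x) (volume.restrict D) := by
  have h1 : MemLp φ 2 (volume.restrict D) := (hφ.memLp_of_hasCompactSupport hc).restrict _
  exact (h.inner_const e).integrable_mul h1

lemma IsSobolevPair.smul {D : Set Plane} {v : Plane → ℝ} {G : Plane → Plane}
    (h : IsSobolevPair D v G) (c : ℝ) :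
    IsSobolevPair D (fun x => c * v x) (fun x => c • G x) where
  memLp_fun := h.memLp_fun.const_mul c
  memLp_grad := h.memLp_grad.const_smul c
  weak_grad := by
    intro φ h1 h2 h3 e
    have := h.weak_grad φ h1 h2 h3 e
    simp only [mul_assoc, inner_smul_left, integral_const_mul]
    rw [this]; simp

lemma IsSobolevPair.add {D : Set Plane} {v w : Plane → ℝ} {G H : Plane → Plane}
    (h : IsSobolevPair D v G) (h' : IsSobolevPair D w H) :
    IsSobolevPair D (fun x => v x + w x) (fun x => G x + H x) where
  memLp_fun := h.memLp_fun.add h'.memLp_fun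
  memLp_grad := h.memLp_grad.add h'.memLp_grad
  weak_grad := by
    intro φ h1 h2 h3 e
    simp only [add_mul, inner_add_left]
    rw [integral_add, integral_add, h.weak_grad φ h1 h2 h3 e, h'.weak_grad φ h1 h2 h3 e]
    · ring
    · exact IsSobolevPair.integrable_inner_mul h.memLp_grad h1.continuous h2 e
    · exact IsSobolevPair.integrable_inner_mul h'.memLp_grad h1.continuous h2 e
    · exact IsSobolevPair.integrable_mul_fderiv h.memLp_fun h1 h2 e
    · exact IsSobolevPair.integrable_mul_fderiv h'.memLp_fun h1 h2 e

lemma IsSobolevPair.sum {ι : Type*} (s : Finset ι) {D : Set Plane} {v : ι → Plane → ℝ}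
    {G : ι → Plane → Plane} (h : ∀ i ∈ s, IsSobolevPair D (v i) (G i)) :
    IsSobolevPair D (fun x => ∑ i ∈ s, v i x) (fun x => ∑ i ∈ s, G i x) := by
  classical
  induction s using Finset.induction_on with
  | empty => simpa using IsSobolevPair.zero D
  | insert a s ha ih =>
    simp only [Finset.sum_insert ha]
    exact (h a (Finset.mem_insert_self a s)).add
      (ih fun i hi => h i (Finset.mem_insert_of_mem hi))

lemma IsSobolevPair.mono {U D : Set Plane} (hD : MeasurableSet D) (hUD : U ⊆ D)
    {v : Plane → ℝ} {G : Plane → Plane} (h : IsSobolevPair D v G) : IsSobolevPair U v G where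
  memLp_fun := h.memLp_fun.mono_measure (Measure.restrict_mono hUD le_rfl)
  memLp_grad := h.memLp_grad.mono_measure (Measure.restrict_mono hUD le_rfl)
  weak_grad := by
    intro φ h1 h2 h3 e
    have := h.weak_grad φ h1 h2 (h3.trans hUD) e
    rw [setIntegral_eq_of_subset_of_forall_sdiff_eq_zero hD hUD,
      setIntegral_eq_of_subset_of_forall_sdiff_eq_zero hD hUD] at this
    · exact this
    · intro x hx
      rw [image_eq_zero_of_notMem_tsupport fun h' => hx.2 (h3 h'), mul_zero]
    · intro x hx
      rw [fderiv_of_notMem_tsupport (𝕜 := ℝ) fun h' => hx.2 (h3 h')]; simp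

lemma VanishesOn.mono {D U K K' : Set Plane} {v : Plane → ℝ} (h : VanishesOn D K v)
    (hs : U ∩ K' ⊆ D ∩ K) : VanishesOn U K' v :=
  ae_restrict_of_ae_restrict_of_subset hs h

/-- Multiplication by a cut-off function which is locally constant where `v` does not vanish,
followed by extension by zero. -/
lemma IsSobolevPair.cutoff {U D : Set Plane} (hU : IsOpen U) (hUD : U ⊆ D)
    {v : Plane → ℝ} {G : Plane → Plane} (h : IsSobolevPair U v G) {χ : Plane → ℝ}
    (hχ : ContDiff ℝ ∞ χ) (hb : ∀ x, |χ x| ≤ 1) (hs : tsupport χ ∩ D ⊆ U)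
    (hz : ∀ᵐ x ∂volume.restrict U, v x = 0 ∨ fderiv ℝ χ x = 0) :
    IsSobolevPair D (U.indicator fun x => χ x * v x) (U.indicator fun x => χ x • G x) where
  memLp_fun := by
    rw [memLp_indicator_iff_restrict hU.measurableSet, Measure.restrict_restrict hU.measurableSet,
      Set.inter_eq_left.2 hUD]
    refine h.memLp_fun.of_le (hχ.continuous.aestronglyMeasurable.mul
      h.memLp_fun.aestronglyMeasurable) (Eventually.of_forall fun x => ?_)
    rw [norm_mul]
    exact mul_le_of_le_one_left (norm_nonneg _) (hb x)
  memLp_grad := by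
    rw [memLp_indicator_iff_restrict hU.measurableSet, Measure.restrict_restrict hU.measurableSet,
      Set.inter_eq_left.2 hUD]
    refine h.memLp_grad.of_le (hχ.continuous.aestronglyMeasurable.smul
      h.memLp_grad.aestronglyMeasurable) (Eventually.of_forall fun x => ?_)
    rw [norm_smul]
    exact mul_le_of_le_one_left (norm_nonneg _) (hb x)
  weak_grad := by
    intro ψ h1 h2 h3 e
    have key := h.weak_grad (fun x => χ x * ψ x) (hχ.mul h1) (h2.mul_left) (by
      intro x hx
      exact hs ⟨tsupport_mul_subset_left hx, h3 (tsupport_mul_subset_right hx)⟩) e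
    have e1 : ∀ x, U.indicator (fun x => χ x * v x) x * fderiv ℝ ψ x e
        = U.indicator (fun x => χ x * v x * fderiv ℝ ψ x e) x := by
      intro x; by_cases hx : x ∈ U <;> simp [hx]
    have e2 : ∀ x, inner ℝ (U.indicator (fun x => χ x • G x) x) e * ψ x
        = U.indicator (fun x => inner ℝ (G x) e * (χ x * ψ x)) x := by
      intro x; by_cases hx : x ∈ U <;> simp [hx, inner_smul_left]; ring
    simp only [e1, e2, setIntegral_indicator hU.measurableSet, Set.inter_eq_right.2 hUD]
    rw [← key]
    refine integral_congr_ae ?_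
    filter_upwards [hz] with x hx
    have d1 : DifferentiableAt ℝ χ x := (hχ.differentiable (by simp)) x
    have d2 : DifferentiableAt ℝ ψ x := (h1.differentiable (by simp)) x
    rw [fderiv_fun_mul d1 d2]
    rcases hx with hx | hx
    · simp [hx]
    · simp [hx]; ring

/-! ### Homotheties -/

/-- The homothety `x ↦ p + ℓ x`. -/
def aff (p : Plane) (ℓ : ℝ) (x : Plane) : Plane := p + ℓ • x

lemma aff_inv_aff (p : Plane) {ℓ : ℝ} (hℓ : ℓ ≠ 0) (x : Plane) :
    aff (-(ℓ⁻¹ • p)) ℓ⁻¹ (aff p ℓ x) = x := by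
  simp [aff, smul_add, smul_smul, inv_mul_cancel₀ hℓ]

lemma aff_aff_inv (p : Plane) {ℓ : ℝ} (hℓ : ℓ ≠ 0) (x : Plane) :
    aff p ℓ (aff (-(ℓ⁻¹ • p)) ℓ⁻¹ x) = x := by
  simp [aff, smul_add, smul_smul, mul_inv_cancel₀ hℓ]

lemma contDiff_aff (p : Plane) (ℓ : ℝ) : ContDiff ℝ ∞ (aff p ℓ) := by
  unfold aff; fun_prop

lemma continuous_aff (p : Plane) (ℓ : ℝ) : Continuous (aff p ℓ) := (contDiff_aff p ℓ).continuous

/-- The homothety as a homeomorphism. -/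
def affHomeo (p : Plane) {ℓ : ℝ} (hℓ : ℓ ≠ 0) : Plane ≃ₜ Plane where
  toFun := aff p ℓ
  invFun := aff (-(ℓ⁻¹ • p)) ℓ⁻¹
  left_inv := aff_inv_aff p hℓ
  right_inv := aff_aff_inv p hℓ
  continuous_toFun := continuous_aff _ _
  continuous_invFun := continuous_aff _ _

lemma measurableEmbedding_aff (p : Plane) {ℓ : ℝ} (hℓ : ℓ ≠ 0) :
    MeasurableEmbedding (aff p ℓ) := (affHomeo p hℓ).measurableEmbedding

lemma map_aff_volume (p : Plane) {ℓ : ℝ} (hℓ : 0 < ℓ) :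
    (volume : Measure Plane).map (aff p ℓ) = ENNReal.ofReal ((ℓ ^ 2)⁻¹) • volume := by
  have : aff p ℓ = (fun y => p + y) ∘ (fun x => ℓ • x) := rfl
  rw [this, ← Measure.map_map (measurable_const_add p) (measurable_const_smul ℓ),
    Measure.map_addHaar_smul _ hℓ.ne', Measure.map_smul, map_add_left_eq_self]
  simp [abs_of_pos hℓ]

lemma map_aff_restrict (p : Plane) {ℓ : ℝ} (hℓ : 0 < ℓ) (A : Set Plane) :
    (volume.restrict (aff p ℓ ⁻¹' A)).map (aff p ℓ) =
      ENNReal.ofReal ((ℓ ^ 2)⁻¹) • volume.restrict A := by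
  rw [← (measurableEmbedding_aff p hℓ.ne').restrict_map, map_aff_volume p hℓ,
    Measure.restrict_smul]

lemma setIntegral_comp_aff (p : Plane) {ℓ : ℝ} (hℓ : 0 < ℓ) (A : Set Plane) (f : Plane → ℝ) :
    ∫ x in aff p ℓ ⁻¹' A, f (aff p ℓ x) = (ℓ ^ 2)⁻¹ * ∫ x in A, f x := by
  rw [← (measurableEmbedding_aff p hℓ.ne').integral_map, map_aff_restrict p hℓ,
    integral_smul_measure, ENNReal.toReal_ofReal (by positivity), smul_eq_mul]

lemma memLp_comp_aff (p : Plane) {ℓ : ℝ} (hℓ : 0 < ℓ) (A : Set Plane) {E : Type*}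
    [NormedAddCommGroup E] {f : Plane → E} (hf : MemLp f 2 (volume.restrict A)) :
    MemLp (fun x => f (aff p ℓ x)) 2 (volume.restrict (aff p ℓ ⁻¹' A)) := by
  refine ((measurableEmbedding_aff p hℓ.ne').memLp_map_measure_iff (g := f)).1 ?_
  rw [map_aff_restrict p hℓ]
  exact hf.smul_measure ENNReal.ofReal_ne_top

lemma ae_restrict_comp_aff (p : Plane) {ℓ : ℝ} (hℓ : 0 < ℓ) {A : Set Plane} {P : Plane → Prop}
    (h : ∀ᵐ x ∂volume.restrict A, P x) :
    ∀ᵐ x ∂volume.restrict (aff p ℓ ⁻¹' A), P (aff p ℓ x) := by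
  refine ae_of_ae_map (measurableEmbedding_aff p hℓ.ne').measurable.aemeasurable ?_
  rw [map_aff_restrict p hℓ]
  exact Measure.ae_smul_measure h _

lemma IsSobolevPair.comp_aff {D : Set Plane} {v : Plane → ℝ} {G : Plane → Plane}
    (h : IsSobolevPair D v G) (p : Plane) {ℓ : ℝ} (hℓ : 0 < ℓ) :
    IsSobolevPair (aff p ℓ ⁻¹' D) (fun x => v (aff p ℓ x)) (fun x => ℓ • G (aff p ℓ x)) where
  memLp_fun := memLp_comp_aff p hℓ D h.memLp_fun
  memLp_grad := (memLp_comp_aff p hℓ D h.memLp_grad).const_smul ℓ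
  weak_grad := by
    intro φ h1 h2 h3 e
    set S := aff (-(ℓ⁻¹ • p)) ℓ⁻¹ with hS
    have hST : ∀ x, S (aff p ℓ x) = x := aff_inv_aff p hℓ.ne'
    have hcs : tsupport (φ ∘ S) = S ⁻¹' tsupport φ :=
      tsupport_comp_eq_preimage φ (affHomeo p hℓ.ne').symm
    have key := h.weak_grad (φ ∘ S) (h1.comp (contDiff_aff _ _))
      (h2.comp_homeomorph (affHomeo p hℓ.ne').symm) (by
        rw [hcs]; intro x hx
        have := h3 hx
        simpa [hS, aff_aff_inv p hℓ.ne'] using this) e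
    have hder : ∀ x, fderiv ℝ (φ ∘ S) x e = ℓ⁻¹ * fderiv ℝ φ (S x) e := by
      intro x
      have hSd : HasFDerivAt S (ℓ⁻¹ • ContinuousLinearMap.id ℝ Plane) x :=
        ((hasFDerivAt_id (𝕜 := ℝ) x).const_smul ℓ⁻¹).const_add (-(ℓ⁻¹ • p))
      have hφd := ((h1.differentiable (by simp)) (S x)).hasFDerivAt
      rw [(hφd.comp x hSd).fderiv]
      simp
    have e1 := setIntegral_comp_aff p hℓ D fun y => v y * (ℓ * fderiv ℝ (φ ∘ S) y e)
    have e2 := setIntegral_comp_aff p hℓ D fun y => inner ℝ (ℓ • G y) e * (φ ∘ S) y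
    simp only [hder, hST, Function.comp, mul_inv_cancel_left₀ hℓ.ne'] at e1 e2
    rw [e1, e2]
    simp only [hder, Function.comp] at key
    have e3 : ∀ x, v x * fderiv ℝ φ (S x) e = ℓ * (v x * (ℓ⁻¹ * fderiv ℝ φ (S x) e)) := by
      intro x; field_simp
    simp only [e3, inner_smul_left, integral_const_mul, mul_assoc, key]
    simp

/-! ### Lipschitz functions -/

lemma isSobolevPair_of_lipschitz {D : Set Plane} (hfin : volume D ≠ ⊤)
    {f : Plane → ℝ} {C : NNReal} (hf : LipschitzWith C f) {B : ℝ} (hB : ∀ x, |f x| ≤ B) :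
    IsSobolevPair D f (gradient f) := by
  have : IsFiniteMeasure (volume.restrict D) := ⟨by simpa using hfin.lt_top⟩
  have hgm : Measurable (gradient f) :=
    (InnerProductSpace.toDual ℝ Plane).symm.continuous.measurable.comp (measurable_fderiv ℝ f)
  have hin : ∀ x e, inner ℝ (gradient f x) e = fderiv ℝ f x e := by
    intro x e
    simp [gradient]
  refine ⟨MemLp.of_bound hf.continuous.aestronglyMeasurable B (Eventually.of_forall hB),
    MemLp.of_bound hgm.aestronglyMeasurable C (Eventually.of_forall fun x => ?_), ?_⟩
  · simp only [gradient, LinearIsometryEquiv.norm_map]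
    exact norm_fderiv_le_of_lipschitz ℝ hf
  · intro φ h1 h2 h3 e
    obtain ⟨C', hC'⟩ := h1.lipschitzWith_of_hasCompactSupport h2 (by simp)
    have key := hf.integral_lineDeriv_mul_eq (μ := volume) hC' h2 e
    have hz : ∀ x ∉ D, φ x = 0 := fun x hx => image_eq_zero_of_notMem_tsupport fun h => hx (h3 h)
    have hz' : ∀ x ∉ D, fderiv ℝ φ x = 0 := fun x hx =>
      fderiv_of_notMem_tsupport (𝕜 := ℝ) fun h => hx (h3 h)
    rw [setIntegral_eq_integral_of_forall_compl_eq_zero (fun x hx => by simp [hz' x hx]),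
      setIntegral_eq_integral_of_forall_compl_eq_zero (fun x hx => by simp [hz x hx])]
    have e1 : ∫ x, inner ℝ (gradient f x) e * φ x = ∫ x, lineDeriv ℝ f x e * φ x := by
      refine integral_congr_ae ?_
      filter_upwards [hf.ae_differentiableAt] with x hx
      rw [hin, hx.lineDeriv_eq_fderiv]
    rw [e1, key, ← integral_neg]
    refine integral_congr_ae (Eventually.of_forall fun x => ?_)
    simp only
    rw [((h1.differentiable (by simp)) x).lineDeriv_eq_fderiv]
    simp [mul_comm]

/-! ### The compliance as a supremum -/

/-- The functional whose maximum is the compliance; `s` is the coefficient of the mass term. -/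
def energy (α s : ℝ) (D : Set Plane) (g φ : Plane → ℝ) (H : Plane → Plane) : ℝ :=
  2 * (∫ x in D, g x * φ x) - s * (∫ x in D, φ x ^ 2) - α * ∫ x in D, ‖H x‖ ^ 2

/-- The compliance `∫ g v` of the problem `s v - α Δv = g`, `v = 0` in `K`, as a supremum. -/
def cpl (α s : ℝ) (D K : Set Plane) (g : Plane → ℝ) : ℝ≥0∞ :=
  ⨆ (φ : Plane → ℝ) (H : Plane → Plane) (_ : IsSobolevPair D φ H) (_ : VanishesOn D K φ),
    ENNReal.ofReal (energy α s D g φ H)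

lemma le_cpl {α s : ℝ} {D K : Set Plane} {g φ : Plane → ℝ} {H : Plane → Plane}
    (h : IsSobolevPair D φ H) (h' : VanishesOn D K φ) :
    ENNReal.ofReal (energy α s D g φ H) ≤ cpl α s D K g :=
  le_iSup₂_of_le φ H (le_iSup₂_of_le h h' le_rfl)

lemma cpl_le {α s : ℝ} {D K : Set Plane} {g : Plane → ℝ} {X : ℝ≥0∞}
    (h : ∀ φ H, IsSobolevPair D φ H → VanishesOn D K φ →
      ENNReal.ofReal (energy α s D g φ H) ≤ X) : cpl α s D K g ≤ X :=
  iSup₂_le fun φ H => iSup₂_le fun h1 h2 => h φ H h1 h2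

lemma MemLp.integrable_norm_sq {D : Set Plane} {G : Plane → Plane}
    (h : MemLp G 2 (volume.restrict D)) : IntegrableOn (fun x => ‖G x‖ ^ 2) D :=
  h.integrable_norm_pow (by norm_num)

lemma vanishesOn_iff {D K : Set Plane} (hK : MeasurableSet K) {v : Plane → ℝ} :
    VanishesOn D K v ↔ ∀ᵐ x ∂volume.restrict D, x ∈ K → v x = 0 := by
  rw [VanishesOn, Set.inter_comm, ← Measure.restrict_restrict hK, ae_restrict_iff' hK]

lemma exists_projection_of_orthogonality {X : Type*} [NormedAddCommGroup X]
    [InnerProductSpace ℝ X] [CompleteSpace X] (W : Set X) (z₀ : X) :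
    ∃ z : X, (∀ w ∈ W, inner ℝ w z = 0) ∧
      ∀ u : X, (∀ w ∈ W, inner ℝ w u = 0) → inner ℝ z u = inner ℝ z₀ u := by
  have memV : ∀ z : X, z ∈ (Submodule.span ℝ W)ᗮ ↔ ∀ w ∈ W, inner ℝ w z = 0 := by
    intro z
    rw [Submodule.mem_orthogonal]
    refine ⟨fun h w hw => h w (Submodule.subset_span hw), fun h u hu => ?_⟩
    induction hu using Submodule.span_induction with
    | mem x hx => exact h x hx
    | zero => simp
    | add x y _ _ hx hy => rw [inner_add_left, hx, hy, add_zero]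
    | smul a x _ hx => rw [inner_smul_left, hx, mul_zero]
  refine ⟨(Submodule.span ℝ W)ᗮ.starProjection z₀,
    (memV _).1 (Submodule.starProjection_apply_mem _ z₀), fun u hu => ?_⟩
  have := Submodule.starProjection_inner_eq_zero z₀ u ((memV u).2 hu)
  rw [inner_sub_left, sub_eq_zero] at this
  exact this.symm

theorem exists_isSolution {α : ℝ} (hα : 0 < α) {D K : Set Plane}
    (hK : MeasurableSet K) {g : Plane → ℝ} (hg : MemLp g 2 (volume.restrict D)) :
    ∃ v, IsSolution α D K g v := by
  set μ := volume.restrict D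
  set β := (√α)⁻¹ with hβ
  have hβ2 : α * (β * β) = 1 := by
    rw [hβ, ← mul_inv, Real.mul_self_sqrt hα.le, mul_inv_cancel₀ hα.ne']
  let X := WithLp 2 (Lp ℝ 2 μ × Lp Plane 2 μ)
  have hm1 : ∀ (φ : Plane → ℝ), ContDiff ℝ ∞ φ → HasCompactSupport φ → ∀ e : Plane,
      MemLp (fun x => fderiv ℝ φ x e) 2 μ := fun φ h1 h2 e =>
    (((h1.continuous_fderiv (by simp)).clm_apply continuous_const).memLp_of_hasCompactSupport
      (h2.fderiv_apply (𝕜 := ℝ) e)).restrict _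
  have hm2 : ∀ (φ : Plane → ℝ), ContDiff ℝ ∞ φ → HasCompactSupport φ → ∀ e : Plane,
      MemLp (fun x => φ x • (β • e)) 2 μ := fun φ h1 h2 e =>
    ((h1.continuous.smul continuous_const).memLp_of_hasCompactSupport h2.smul_right).restrict _
  let W1 : Set X := {z | ∃ (φ : Plane → ℝ) (h1 : ContDiff ℝ ∞ φ) (h2 : HasCompactSupport φ)
    (_ : tsupport φ ⊆ D) (e : Plane),
      z = WithLp.toLp 2 ((hm1 φ h1 h2 e).toLp, (hm2 φ h1 h2 e).toLp)}
  let W2 : Set X := {z | ∃ (f : Lp ℝ 2 μ),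
      z = WithLp.toLp 2 (((Lp.memLp f).indicator hK).toLp, 0)}
  have inW1 : ∀ (φ : Plane → ℝ) (h1 : ContDiff ℝ ∞ φ) (h2 : HasCompactSupport φ) (e : Plane)
      (v : Lp ℝ 2 μ) (G : Lp Plane 2 μ),
      inner ℝ (WithLp.toLp 2 ((hm1 φ h1 h2 e).toLp, (hm2 φ h1 h2 e).toLp) : X)
        (WithLp.toLp 2 (v, G)) =
        (∫ x, v x * fderiv ℝ φ x e ∂μ) + ∫ x, inner ℝ (β • G x) e * φ x ∂μ := by
    intro φ h1 h2 e v G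
    rw [WithLp.prod_inner_apply, L2.inner_def, L2.inner_def]
    congr 1
    · refine integral_congr_ae ?_
      filter_upwards [(hm1 φ h1 h2 e).coeFn_toLp] with x hx
      simp [hx]
    · refine integral_congr_ae ?_
      filter_upwards [(hm2 φ h1 h2 e).coeFn_toLp] with x hx
      rw [hx, real_inner_comm, inner_smul_left, inner_smul_right, inner_smul_right]
      simp only [RCLike.conj_to_real]
      ring
  have inW2 : ∀ (f v : Lp ℝ 2 μ) (G : Lp Plane 2 μ),
      inner ℝ (WithLp.toLp 2 (((Lp.memLp f).indicator hK).toLp, 0) : X)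
        (WithLp.toLp 2 (v, G)) = ∫ x, K.indicator f x * v x ∂μ := by
    intro f v G
    rw [WithLp.prod_inner_apply, L2.inner_def]
    simp only [inner_zero_left, add_zero]
    refine integral_congr_ae ?_
    filter_upwards [((Lp.memLp f).indicator hK).coeFn_toLp] with x hx
    simp [hx, mul_comm]
  let z0 : X := WithLp.toLp 2 (hg.toLp, 0)
  obtain ⟨z, hzV, hproj⟩ := exists_projection_of_orthogonality (W1 ∪ W2) z0
  obtain ⟨v, G, hvG⟩ : ∃ (v : Lp ℝ 2 μ) (G : Lp Plane 2 μ), z = WithLp.toLp 2 (v, G) :=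
    ⟨z.fst, z.snd, rfl⟩
  refine ⟨v, fun x => β • G x, ⟨Lp.memLp v, (Lp.memLp G).const_smul β, ?_⟩, ?_, ?_⟩
  · intro φ h1 h2 h3 e
    have := hzV _ (Or.inl ⟨φ, h1, h2, h3, e, rfl⟩)
    rw [hvG, inW1 φ h1 h2 e] at this
    exact eq_neg_of_add_eq_zero_left this
  · have := hzV _ (Or.inr ⟨v, rfl⟩)
    rw [hvG, inW2] at this
    have hnn : 0 ≤ᵐ[μ] fun x => K.indicator v x * v x := Eventually.of_forall fun x => by
      by_cases hx : x ∈ K <;> simp [hx, mul_self_nonneg]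
    rw [integral_eq_zero_iff_of_nonneg_ae hnn
      (((Lp.memLp v).indicator hK).integrable_mul (Lp.memLp v))] at this
    rw [vanishesOn_iff hK]
    filter_upwards [this] with x hx hxK
    simpa [hxK] using hx
  · intro φ H hφ hvan
    have hH : MemLp (fun x => β⁻¹ • H x) 2 μ := hφ.memLp_grad.const_smul β⁻¹
    have hβ0 : β ≠ 0 := by positivity
    have hwV : ∀ w ∈ W1 ∪ W2,
        inner ℝ w (WithLp.toLp 2 (hφ.memLp_fun.toLp, hH.toLp) : X) = 0 := by
      rintro w (⟨ψ, h1, h2, h3, e, rfl⟩ | ⟨f, rfl⟩)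
      · rw [inW1 ψ h1 h2 e]
        have e1 : ∫ x, (hφ.memLp_fun.toLp) x * fderiv ℝ ψ x e ∂μ
            = ∫ x, φ x * fderiv ℝ ψ x e ∂μ := integral_congr_ae (by
          filter_upwards [hφ.memLp_fun.coeFn_toLp] with x hx using by rw [hx])
        have e2 : ∫ x, inner ℝ (β • (hH.toLp) x) e * ψ x ∂μ
            = ∫ x, inner ℝ (H x) e * ψ x ∂μ := integral_congr_ae (by
          filter_upwards [hH.coeFn_toLp] with x hx
          rw [hx, smul_smul, mul_inv_cancel₀ hβ0, one_smul])
        rw [e1, e2, hφ.weak_grad ψ h1 h2 h3 e]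
        simp [μ]
      · rw [inW2]
        rw [vanishesOn_iff hK] at hvan
        refine integral_eq_zero_of_ae ?_
        filter_upwards [hvan, hφ.memLp_fun.coeFn_toLp] with x hx hx'
        rw [hx']
        by_cases hxK : x ∈ K
        · simp [hx hxK]
        · simp [hxK]
    replace hproj := hproj _ hwV
    rw [hvG, WithLp.prod_inner_apply, WithLp.prod_inner_apply, L2.inner_def, L2.inner_def,
      L2.inner_def] at hproj
    simp only [z0, inner_zero_left, add_zero] at hproj
    have e1 : ∫ x, inner ℝ (v x) ((hφ.memLp_fun.toLp) x) ∂μ = ∫ x, v x * φ x ∂μ :=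
      integral_congr_ae (by
        filter_upwards [hφ.memLp_fun.coeFn_toLp] with x hx
        rw [hx]; simp [mul_comm])
    have e2 : ∫ x, inner ℝ (G x) ((hH.toLp) x) ∂μ = α * ∫ x, inner ℝ (β • G x) (H x) ∂μ := by
      rw [← integral_const_mul]
      refine integral_congr_ae ?_
      filter_upwards [hH.coeFn_toLp] with x hx
      rw [hx, inner_smul_left, inner_smul_right]
      have : β⁻¹ = α * β := by
        field_simp
        linarith [hβ2, pow_two β]
      rw [this]; simp [mul_assoc]
    have e3 : ∫ x, inner ℝ ((hg.toLp) x) ((hφ.memLp_fun.toLp) x) ∂μ = ∫ x, g x * φ x ∂μ :=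
      integral_congr_ae (by
        filter_upwards [hφ.memLp_fun.coeFn_toLp, hg.coeFn_toLp] with x hx hx'
        rw [hx, hx']; simp [mul_comm])
    rw [e1, e2, e3] at hproj
    exact hproj

/-- A solution attains the supremum. -/
lemma IsSolution.energy_le {α : ℝ} (hα : 0 ≤ α) {D K : Set Plane} {g v : Plane → ℝ}
    (hv : IsSolution α D K g v) {φ : Plane → ℝ} {H : Plane → Plane}
    (h : IsSobolevPair D φ H) (h' : VanishesOn D K φ) :
    energy α 1 D g φ H ≤ ∫ x in D, g x * v x := by
  obtain ⟨G, hG, hvan, hsol⟩ := hv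
  have e1 := hsol φ H h h'
  have e2 := hsol v G hG hvan
  have p1 : 0 ≤ ∫ x in D, (v x - φ x) ^ 2 := integral_nonneg fun x => sq_nonneg _
  have p2 : 0 ≤ ∫ x in D, ‖G x - H x‖ ^ 2 := integral_nonneg fun x => sq_nonneg _
  have q1 : ∫ x in D, (v x - φ x) ^ 2
      = (∫ x in D, v x * v x) - 2 * (∫ x in D, v x * φ x) + ∫ x in D, φ x ^ 2 := by
    rw [← integral_const_mul, ← integral_sub, ← integral_add]
    · refine integral_congr_ae (Eventually.of_forall fun x => ?_); simp only; ring
    · exact (hG.memLp_fun.integrable_mul hG.memLp_fun).sub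
        ((hG.memLp_fun.integrable_mul h.memLp_fun).const_mul 2)
    · exact h.memLp_fun.integrable_sq
    · exact hG.memLp_fun.integrable_mul hG.memLp_fun
    · exact (hG.memLp_fun.integrable_mul h.memLp_fun).const_mul 2
  have q2 : ∫ x in D, ‖G x - H x‖ ^ 2 = (∫ x in D, inner ℝ (G x) (G x))
      - 2 * (∫ x in D, inner ℝ (G x) (H x)) + ∫ x in D, ‖H x‖ ^ 2 := by
    have i1 : IntegrableOn (fun x => inner ℝ (G x) (G x)) D := by
      simpa using MemLp.integrable_norm_sq hG.memLp_grad
    have i2 : IntegrableOn (fun x => (inner ℝ (G x) (H x) : ℝ)) D := by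
      refine Integrable.mono' ((MemLp.integrable_norm_sq hG.memLp_grad).add
        (MemLp.integrable_norm_sq h.memLp_grad))
        (hG.memLp_grad.aestronglyMeasurable.inner h.memLp_grad.aestronglyMeasurable)
        (Eventually.of_forall fun x => ?_)
      have := norm_inner_le_norm (𝕜 := ℝ) (G x) (H x)
      simp only [Pi.add_apply]
      nlinarith [sq_nonneg (‖G x‖ - ‖H x‖), sq_nonneg ‖G x‖, sq_nonneg ‖H x‖]
    rw [← integral_const_mul, ← integral_sub i1 (i2.const_mul 2),
      ← integral_add (by exact i1.sub (i2.const_mul 2))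
        (MemLp.integrable_norm_sq h.memLp_grad)]
    refine integral_congr_ae (Eventually.of_forall fun x => ?_)
    simp only
    rw [norm_sub_sq_real, real_inner_self_eq_norm_sq]
  unfold energy
  nlinarith [mul_nonneg hα p2]

lemma IsSolution.cpl_eq {α : ℝ} (hα : 0 ≤ α) {D K : Set Plane} {g v : Plane → ℝ}
    (hv : IsSolution α D K g v) :
    cpl α 1 D K g = ENNReal.ofReal (∫ x in D, g x * v x) := by
  refine le_antisymm (cpl_le fun φ H h h' => ENNReal.ofReal_le_ofReal (hv.energy_le hα h h')) ?_
  obtain ⟨G, hG, hvan, hsol⟩ := hv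
  have e2 := hsol v G hG hvan
  refine le_trans (ENNReal.ofReal_le_ofReal ?_) (le_cpl hG hvan)
  unfold energy
  simp only [pow_two, ← real_inner_self_eq_norm_mul_norm]
  linarith

theorem rescaledCompliance_eq {α : ℝ} (hα : 0 < α) {D K : Set Plane}
    (hK : MeasurableSet K) {g : Plane → ℝ} (hg : MemLp g 2 (volume.restrict D)) (n : ℕ) :
    rescaledCompliance α D g n K = n * cpl α 1 D K g := by
  have key : ∀ v, IsSolution α D K g v →
      ENNReal.ofReal (n * ∫ x in D, g x * v x) = n * cpl α 1 D K g := fun v hv => by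
    rw [hv.cpl_eq hα.le, ENNReal.ofReal_mul (Nat.cast_nonneg n), ENNReal.ofReal_natCast]
  obtain ⟨v, hv⟩ := exists_isSolution hα hK hg
  refine le_antisymm (iInf₂_le_of_le v hv (key v hv).le) (le_iInf₂ fun w hw => (key w hw).ge)

/-! ### Monotonicity, homogeneity and subadditivity of the compliance -/

lemma cpl_mono_set {α s : ℝ} {D K K' : Set Plane} {g : Plane → ℝ} (h : D ∩ K ⊆ K') :
    cpl α s D K' g ≤ cpl α s D K g :=
  cpl_le fun _ _ h1 h2 => le_cpl h1 (h2.mono fun _ hx => ⟨hx.1, h hx⟩)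

lemma cpl_mono_mass {α s s' : ℝ} (hs : s ≤ s') {D K : Set Plane} {g : Plane → ℝ} :
    cpl α s' D K g ≤ cpl α s D K g := by
  refine cpl_le fun φ H h1 h2 => le_trans (ENNReal.ofReal_le_ofReal ?_) (le_cpl h1 h2)
  have : 0 ≤ ∫ x in D, φ x ^ 2 := integral_nonneg fun x => sq_nonneg _
  unfold energy
  nlinarith

lemma VanishesOn.smul {D K : Set Plane} {φ : Plane → ℝ} (h : VanishesOn D K φ) (c : ℝ) :
    VanishesOn D K (fun x => c * φ x) := by
  filter_upwards [h] with x hx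
  simp [hx]

lemma energy_smul (α s : ℝ) (D : Set Plane) (g φ : Plane → ℝ) (H : Plane → Plane) (c : ℝ) :
    energy α s D g (fun x => c * φ x) (fun x => c • H x) =
      2 * c * (∫ x in D, g x * φ x) -
        c ^ 2 * (s * (∫ x in D, φ x ^ 2) + α * ∫ x in D, ‖H x‖ ^ 2) := by
  have e1 : ∀ x, g x * (c * φ x) = c * (g x * φ x) := fun x => by ring
  have e2 : ∀ x, ‖c • H x‖ ^ 2 = c ^ 2 * ‖H x‖ ^ 2 := fun x => by
    rw [norm_smul, mul_pow, Real.norm_eq_abs, sq_abs]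
  simp only [energy, e1, e2, mul_pow, integral_const_mul]
  ring

lemma ofReal_weighted_le_cpl {α s l : ℝ} (hl : 0 < l) {D K : Set Plane} {g φ : Plane → ℝ}
    {H : Plane → Plane} (h : IsSobolevPair D φ H) (h' : VanishesOn D K φ) :
    ENNReal.ofReal (2 * (∫ x in D, g x * φ x) -
        l * (s * (∫ x in D, φ x ^ 2) + α * ∫ x in D, ‖H x‖ ^ 2)) ≤
      ENNReal.ofReal l⁻¹ * cpl α s D K g := by
  refine le_trans ?_ (mul_le_mul_right (le_cpl (h.smul l) (h'.smul l)) _)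
  rw [energy_smul, ← ENNReal.ofReal_mul (by positivity)]
  refine ENNReal.ofReal_le_ofReal (le_of_eq ?_)
  field_simp

lemma cpl_const_mul_le {α s : ℝ} (hα : 0 ≤ α) (hs : 0 ≤ s) {D K : Set Plane} (g : Plane → ℝ)
    (c : ℝ) : cpl α s D K (fun x => c * g x) ≤ ENNReal.ofReal (c ^ 2) * cpl α s D K g := by
  refine cpl_le fun φ H h1 h2 => ?_
  have e1 : ∀ x, c * g x * φ x = c * (g x * φ x) := fun x => by ring
  have p1 : 0 ≤ ∫ x in D, φ x ^ 2 := integral_nonneg fun x => sq_nonneg _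
  have p2 : 0 ≤ ∫ x in D, ‖H x‖ ^ 2 := integral_nonneg fun x => sq_nonneg _
  rcases eq_or_ne c 0 with rfl | hc
  · rw [ENNReal.ofReal_of_nonpos]
    · exact zero_le
    · simp only [energy, zero_mul, integral_zero]
      nlinarith [mul_nonneg hα p2, mul_nonneg hs p1]
  · refine le_trans ?_ (mul_le_mul_right (le_cpl (h1.smul c⁻¹) (h2.smul c⁻¹)) _)
    rw [energy_smul, ← ENNReal.ofReal_mul (by positivity)]
    refine ENNReal.ofReal_le_ofReal (le_of_eq ?_)
    simp only [energy, e1, integral_const_mul]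
    field_simp
    ring

lemma cpl_const_mul {α s : ℝ} (hα : 0 ≤ α) (hs : 0 ≤ s) {D K : Set Plane} (g : Plane → ℝ)
    (c : ℝ) : cpl α s D K (fun x => c * g x) = ENNReal.ofReal (c ^ 2) * cpl α s D K g := by
  refine le_antisymm (cpl_const_mul_le hα hs g c) ?_
  rcases eq_or_ne c 0 with rfl | hc
  · simp
  · have := cpl_const_mul_le (K := K) (D := D) hα hs (fun x => c * g x) c⁻¹
    simp only [inv_mul_cancel_left₀ hc] at this
    calc _ ≤ ENNReal.ofReal (c ^ 2) * (ENNReal.ofReal (c⁻¹ ^ 2) *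
          cpl α s D K (fun x => c * g x)) := mul_le_mul_right this _
      _ = _ := by
        rw [← mul_assoc, ← ENNReal.ofReal_mul (by positivity), ← mul_pow, mul_inv_cancel₀ hc]
        simp

lemma cpl_add_le {α s δ : ℝ} (hδ : 0 < δ) {D K : Set Plane} {g₁ g₂ : Plane → ℝ}
    (h₁ : MemLp g₁ 2 (volume.restrict D)) (h₂ : MemLp g₂ 2 (volume.restrict D)) :
    cpl α s D K (fun x => g₁ x + g₂ x) ≤
      ENNReal.ofReal (1 + δ) * cpl α s D K g₁ + ENNReal.ofReal (1 + δ⁻¹) * cpl α s D K g₂ := by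
  refine cpl_le fun φ H h h' => ?_
  have k1 := ofReal_weighted_le_cpl (α := α) (s := s) (g := g₁) (l := (1 + δ)⁻¹)
    (by positivity) h h'
  have k2 := ofReal_weighted_le_cpl (α := α) (s := s) (g := g₂) (l := (1 + δ⁻¹)⁻¹)
    (by positivity) h h'
  rw [inv_inv] at k1 k2
  refine le_trans ?_ (add_le_add k1 k2)
  refine le_trans (ENNReal.ofReal_le_ofReal (le_of_eq ?_)) ENNReal.ofReal_add_le
  have e : (1 + δ⁻¹)⁻¹ = 1 - (1 + δ)⁻¹ := by field_simp; ring
  simp only [energy, add_mul]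
  rw [integral_add (by exact h₁.integrable_mul h.memLp_fun)
    (by exact h₂.integrable_mul h.memLp_fun), e]
  ring

lemma cpl_le_of_poincare {α P : ℝ} (hα : 0 < α) (hP : 0 < P) {D K : Set Plane} {g : Plane → ℝ}
    (hg : MemLp g 2 (volume.restrict D))
    (hpoin : ∀ φ H, IsSobolevPair D φ H → VanishesOn D K φ →
      ∫ x in D, φ x ^ 2 ≤ P * ∫ x in D, ‖H x‖ ^ 2) :
    cpl α 0 D K g ≤ ENNReal.ofReal (P / α * ∫ x in D, g x ^ 2) := by
  refine cpl_le fun φ H h h' => ENNReal.ofReal_le_ofReal ?_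
  have h1 := hpoin φ H h h'
  have h2 : ∫ x in D, 2 * (g x * φ x) ≤ ∫ x in D, (P / α * g x ^ 2 + α / P * φ x ^ 2) := by
    refine integral_mono ((hg.integrable_mul h.memLp_fun).const_mul 2)
      ((hg.integrable_sq.const_mul _).add (h.memLp_fun.integrable_sq.const_mul _)) fun x => ?_
    have : 0 ≤ (P * g x - α * φ x) ^ 2 / (P * α) := by positivity
    have e : (P * g x - α * φ x) ^ 2 / (P * α)
        = P / α * g x ^ 2 + α / P * φ x ^ 2 - 2 * (g x * φ x) := by
      field_simp; ring
    simp only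
    linarith
  rw [integral_add (hg.integrable_sq.const_mul _) (h.memLp_fun.integrable_sq.const_mul _),
    integral_const_mul, integral_const_mul, integral_const_mul] at h2
  have h3 : α / P * ∫ x in D, φ x ^ 2 ≤ α * ∫ x in D, ‖H x‖ ^ 2 := by
    calc _ ≤ α / P * (P * ∫ x in D, ‖H x‖ ^ 2) := by gcongr
      _ = _ := by field_simp
  simp only [energy]
  linarith

/-- The mass term is negligible if the Poincaré constant is small. -/
lemma cpl_zero_le_of_poincare {α P : ℝ} (hP : 0 ≤ P) (hPα : P < α) {D K : Set Plane}
    {g : Plane → ℝ}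
    (hpoin : ∀ φ H, IsSobolevPair D φ H → VanishesOn D K φ →
      ∫ x in D, φ x ^ 2 ≤ P * ∫ x in D, ‖H x‖ ^ 2) :
    cpl α 0 D K g ≤ ENNReal.ofReal (1 - P / α)⁻¹ * cpl α 1 D K g := by
  have hα : 0 < α := hP.trans_lt hPα
  have hl : 0 < 1 - P / α := by rw [sub_pos, div_lt_one hα]; exact hPα
  refine cpl_le fun φ H h h' => le_trans (ENNReal.ofReal_le_ofReal ?_)
    (ofReal_weighted_le_cpl (l := 1 - P / α) hl h h')
  have h1 := hpoin φ H h h'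
  have p1 : 0 ≤ ∫ x in D, φ x ^ 2 := integral_nonneg fun x => sq_nonneg _
  have h2 : (1 - P / α) * ∫ x in D, φ x ^ 2 ≤ ∫ x in D, φ x ^ 2 :=
    mul_le_of_le_one_left p1 (by have := div_nonneg hP hα.le; linarith)
  have e : (1 - P / α) * (α * ∫ x in D, ‖H x‖ ^ 2)
      = α * (∫ x in D, ‖H x‖ ^ 2) - P * ∫ x in D, ‖H x‖ ^ 2 := by
    field_simp
  simp only [energy]
  linarith

/-! ### Decomposition of the domain -/

lemma setIntegral_eq_sum {ι : Type*} {s : Finset ι} {U : ι → Set Plane} {D : Set Plane}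
    (hD : MeasurableSet D) (hU : ∀ i ∈ s, MeasurableSet (U i)) (hUD : ∀ i ∈ s, U i ⊆ D)
    (hd : (s : Set ι).PairwiseDisjoint U) {f : Plane → ℝ} (hf : IntegrableOn f D)
    (hz : ∀ᵐ x ∂volume.restrict D, x ∉ ⋃ i ∈ s, U i → f x = 0) :
    ∫ x in D, f x = ∑ i ∈ s, ∫ x in U i, f x := by
  rw [← integral_biUnion_finset s hU (fun i hi j hj hij => hd hi hj hij)
    (fun i hi => hf.mono_set (hUD i hi))]
  refine setIntegral_eq_of_subset_of_ae_sdiff_eq_zero hD.nullMeasurableSet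
    (Set.iUnion₂_subset hUD) ?_
  rw [ae_restrict_iff' hD] at hz
  filter_upwards [hz] with x hx hx' using hx hx'.1 hx'.2

lemma sum_setIntegral_le {ι : Type*} {s : Finset ι} {U : ι → Set Plane} {D : Set Plane}
    (hU : ∀ i ∈ s, MeasurableSet (U i)) (hUD : ∀ i ∈ s, U i ⊆ D)
    (hd : (s : Set ι).PairwiseDisjoint U) {f : Plane → ℝ} (hf : IntegrableOn f D)
    (hz : ∀ x, 0 ≤ f x) :
    ∑ i ∈ s, ∫ x in U i, f x ≤ ∫ x in D, f x := by
  rw [← integral_biUnion_finset s hU (fun i hi j hj hij => hd hi hj hij)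
    (fun i hi => hf.mono_set (hUD i hi))]
  exact setIntegral_mono_set hf (Eventually.of_forall hz) (Set.iUnion₂_subset hUD).eventuallyLE

/-- Natural boundary conditions on the interfaces increase the compliance. -/
lemma cpl_le_sum {ι : Type*} {s : Finset ι} {U : ι → Set Plane} {D K : Set Plane}
    (hD : MeasurableSet D) (hK : MeasurableSet K) (hU : ∀ i ∈ s, MeasurableSet (U i))
    (hUD : ∀ i ∈ s, U i ⊆ D) (hd : (s : Set ι).PairwiseDisjoint U) {α m : ℝ} (hα : 0 ≤ α)
    {g : Plane → ℝ} (hg : MemLp g 2 (volume.restrict D))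
    (hcov : ∀ᵐ x ∂volume.restrict D, x ∉ ⋃ i ∈ s, U i → x ∈ K) :
    cpl α m D K g ≤ ∑ i ∈ s, cpl α m (U i) K g := by
  refine cpl_le fun φ H h h' => ?_
  have hz : ∀ᵐ x ∂volume.restrict D, x ∉ ⋃ i ∈ s, U i → φ x = 0 := by
    filter_upwards [(vanishesOn_iff hK).1 h', hcov] with x h1 h2 h3 using h1 (h2 h3)
  have e1 : ∫ x in D, g x * φ x = ∑ i ∈ s, ∫ x in U i, g x * φ x :=
    setIntegral_eq_sum hD hU hUD hd (hg.integrable_mul h.memLp_fun) (by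
      filter_upwards [hz] with x hx hx' using by rw [hx hx', mul_zero])
  have e2 : ∫ x in D, φ x ^ 2 = ∑ i ∈ s, ∫ x in U i, φ x ^ 2 :=
    setIntegral_eq_sum hD hU hUD hd h.memLp_fun.integrable_sq (by
      filter_upwards [hz] with x hx hx' using by rw [hx hx']; norm_num)
  have e3 : ∑ i ∈ s, ∫ x in U i, ‖H x‖ ^ 2 ≤ ∫ x in D, ‖H x‖ ^ 2 :=
    sum_setIntegral_le hU hUD hd (MemLp.integrable_norm_sq h.memLp_grad) fun x => sq_nonneg _
  have key : energy α m D g φ H ≤ ∑ i ∈ s, energy α m (U i) g φ H := by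
    simp only [energy, Finset.sum_sub_distrib, ← Finset.mul_sum, e1, e2]
    linarith [mul_le_mul_of_nonneg_left e3 hα]
  calc _ ≤ ENNReal.ofReal (∑ i ∈ s, energy α m (U i) g φ H) := ENNReal.ofReal_le_ofReal key
    _ ≤ ∑ i ∈ s, ENNReal.ofReal (energy α m (U i) g φ H) :=
      Finset.le_sum_of_subadditive _ ENNReal.ofReal_zero.le
        (fun _ _ => ENNReal.ofReal_add_le) s _
    _ ≤ _ := Finset.sum_le_sum fun i hi => le_cpl (h.mono hD (hUD i hi))
      (h'.mono (Set.inter_subset_inter_left _ (hUD i hi)))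

/-- Vanishing near the interfaces decreases the compliance. -/
lemma sum_cpl_le {ι : Type*} {s : Finset ι} {U L : ι → Set Plane} {D K : Set Plane}
    (hD : MeasurableSet D) (hK : MeasurableSet K) (hL : ∀ i ∈ s, MeasurableSet (L i))
    (hU : ∀ i ∈ s, IsOpen (U i))
    (hUD : ∀ i ∈ s, U i ⊆ D) (hd : (s : Set ι).PairwiseDisjoint U) {α : ℝ} (hα : 0 < α)
    {g : Plane → ℝ} (hg : MemLp g 2 (volume.restrict D))
    (hKL : ∀ i ∈ s, U i ∩ K ⊆ L i)
    (hχ : ∀ i ∈ s, ∃ χ : Plane → ℝ, ContDiff ℝ ∞ χ ∧ (∀ x, |χ x| ≤ 1) ∧ tsupport χ ⊆ U i ∧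
      ∀ x ∈ U i, x ∉ L i → χ x = 1 ∧ fderiv ℝ χ x = 0) :
    ∑ i ∈ s, cpl α 1 (U i) (L i) g ≤ cpl α 1 D K g := by
  classical
  have hgU : ∀ i ∈ s, MemLp g 2 (volume.restrict (U i)) := fun i hi =>
    hg.mono_measure (Measure.restrict_mono (hUD i hi) le_rfl)
  have hex : ∀ i, ∃ (v : Plane → ℝ) (G : Plane → Plane) (χ : Plane → ℝ), i ∈ s →
      IsSobolevPair (U i) v G ∧ VanishesOn (U i) (L i) v ∧
      cpl α 1 (U i) (L i) g = ENNReal.ofReal (energy α 1 (U i) g v G) ∧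
      0 ≤ energy α 1 (U i) g v G ∧ ContDiff ℝ ∞ χ ∧ (∀ x, |χ x| ≤ 1) ∧
      tsupport χ ⊆ U i ∧ ∀ x ∈ U i, x ∉ L i → χ x = 1 ∧ fderiv ℝ χ x = 0 := by
    intro i
    by_cases hi : i ∈ s
    · obtain ⟨v, hv⟩ := exists_isSolution hα (hL i hi) (hgU i hi)
      obtain ⟨χ, hχ'⟩ := hχ i hi
      have h1 := hv.cpl_eq hα.le
      have h0 := hv.energy_le hα.le (IsSobolevPair.zero (U i))
        (Eventually.of_forall fun _ => rfl)
      obtain ⟨G, hG, hvan, hsol⟩ := hv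
      have e2 := hsol v G hG hvan
      have e3 : energy α 1 (U i) g v G = ∫ x in U i, g x * v x := by
        unfold energy
        simp only [pow_two, ← real_inner_self_eq_norm_mul_norm]
        linarith
      refine ⟨v, G, χ, fun _ => ⟨hG, hvan, by rw [h1, e3], ?_, hχ'⟩⟩
      rw [e3]
      simpa [energy] using h0
    · exact ⟨0, 0, 0, fun h => absurd h hi⟩
  choose v G χ hall using hex
  set w : ι → Plane → ℝ := fun i => (U i).indicator fun x => χ i x * v i x with hw
  set W : ι → Plane → Plane := fun i => (U i).indicator fun x => χ i x • G i x with hW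
  have hpair : IsSobolevPair D (fun x => ∑ i ∈ s, w i x) (fun x => ∑ i ∈ s, W i x) := by
    refine IsSobolevPair.sum s fun i hi => ?_
    obtain ⟨h1, h2, -, -, h5, h6, h7, h8⟩ := hall i hi
    refine h1.cutoff (hU i hi) (hUD i hi) h5 h6 (Set.inter_subset_left.trans h7) ?_
    filter_upwards [(vanishesOn_iff (hL i hi)).1 h2, ae_restrict_mem (hU i hi).measurableSet]
      with x hx hxU
    by_cases hxL : x ∈ L i
    · exact Or.inl (hx hxL)
    · exact Or.inr (h8 x hxU hxL).2
  have hon : ∀ i ∈ s, ∀ x ∈ U i, ∑ j ∈ s, w j x = χ i x * v i x ∧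
      ∑ j ∈ s, W j x = χ i x • G i x := by
    intro i hi x hx
    have hnot : ∀ j ∈ s, j ≠ i → x ∉ U j := fun j hj hji hxj =>
      Set.disjoint_left.1 (hd hj hi hji) hxj hx
    constructor
    · rw [Finset.sum_eq_single_of_mem i hi (fun j hj hji => by simp [hw, hnot j hj hji])]
      simp [hw, hx]
    · rw [Finset.sum_eq_single_of_mem i hi (fun j hj hji => by simp [hW, hnot j hj hji])]
      simp [hW, hx]
  have hoff : ∀ x, x ∉ ⋃ i ∈ s, U i → ∑ j ∈ s, w j x = 0 ∧ ∑ j ∈ s, W j x = 0 := by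
    intro x hx
    simp only [Set.mem_iUnion, not_exists] at hx
    exact ⟨Finset.sum_eq_zero fun j hj => by simp [hw, hx j hj],
      Finset.sum_eq_zero fun j hj => by simp [hW, hx j hj]⟩
  have hχv : ∀ i ∈ s, ∀ᵐ x ∂volume.restrict (U i), ∑ j ∈ s, w j x = v i x := by
    intro i hi
    obtain ⟨-, h2, -, -, -, -, -, h8⟩ := hall i hi
    filter_upwards [(vanishesOn_iff (hL i hi)).1 h2, ae_restrict_mem (hU i hi).measurableSet]
      with x hx hxU
    rw [(hon i hi x hxU).1]
    by_cases hxL : x ∈ L i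
    · simp [hx hxL]
    · simp [(h8 x hxU hxL).1]
  have hvan : VanishesOn D K (fun x => ∑ i ∈ s, w i x) := by
    have hae : ∀ᵐ x ∂(volume : Measure Plane), ∀ i ∈ s, x ∈ U i → x ∈ L i →
        ∑ j ∈ s, w j x = 0 := by
      rw [Filter.eventually_all_finset]
      intro i hi
      have h2 := (vanishesOn_iff (hL i hi)).1 (hall i hi).2.1
      have h3 := hχv i hi
      rw [ae_restrict_iff' (hU i hi).measurableSet] at h2 h3
      filter_upwards [h2, h3] with x hx hx' hxU hxL
      rw [hx' hxU, hx hxU hxL]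
    rw [vanishesOn_iff hK]
    filter_upwards [ae_restrict_of_ae hae] with x hx hxK
    by_cases hxU : x ∈ ⋃ i ∈ s, U i
    · obtain ⟨i, hi, hxi⟩ := Set.mem_iUnion₂.1 hxU
      exact hx i hi hxi (hKL i hi ⟨hxi, hxK⟩)
    · exact (hoff x hxU).1
  refine le_trans ?_ (le_cpl hpair hvan)
  have hUm : ∀ i ∈ s, MeasurableSet (U i) := fun i hi => (hU i hi).measurableSet
  have e1 := setIntegral_eq_sum hD hUm hUD hd (hg.integrable_mul hpair.memLp_fun)
    (Eventually.of_forall fun x hx => by simp [(hoff x hx).1])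
  have e2 := setIntegral_eq_sum hD hUm hUD hd hpair.memLp_fun.integrable_sq
    (Eventually.of_forall fun x hx => by simp [(hoff x hx).1])
  have e3 := setIntegral_eq_sum hD hUm hUD hd (MemLp.integrable_norm_sq hpair.memLp_grad)
    (Eventually.of_forall fun x hx => by simp [(hoff x hx).2])
  have key : ∑ i ∈ s, energy α 1 (U i) g (v i) (G i)
      ≤ energy α 1 D g (fun x => ∑ i ∈ s, w i x) (fun x => ∑ i ∈ s, W i x) := by
    have e4 : energy α 1 D g (fun x => ∑ i ∈ s, w i x) (fun x => ∑ i ∈ s, W i x)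
        = ∑ i ∈ s, energy α 1 (U i) g (fun x => ∑ i ∈ s, w i x) (fun x => ∑ i ∈ s, W i x) := by
      simp only [energy, Finset.sum_sub_distrib, ← Finset.mul_sum]
      simp only [Pi.mul_apply] at e1
      rw [e1, e2, e3]
    rw [e4]
    refine Finset.sum_le_sum fun i hi => ?_
    obtain ⟨h1, h2, -, -, h5, h6, -, -⟩ := hall i hi
    have i1 : ∫ x in U i, g x * ∑ j ∈ s, w j x = ∫ x in U i, g x * v i x :=
      integral_congr_ae (by filter_upwards [hχv i hi] with x hx using by rw [hx])
    have i2 : ∫ x in U i, (∑ j ∈ s, w j x) ^ 2 = ∫ x in U i, v i x ^ 2 :=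
      integral_congr_ae (by filter_upwards [hχv i hi] with x hx using by rw [hx])
    have i3 : ∫ x in U i, ‖∑ j ∈ s, W j x‖ ^ 2 ≤ ∫ x in U i, ‖G i x‖ ^ 2 := by
      refine integral_mono_ae ?_ (MemLp.integrable_norm_sq h1.memLp_grad) ?_
      · exact IntegrableOn.mono_set (MemLp.integrable_norm_sq hpair.memLp_grad) (hUD i hi)
      · filter_upwards [ae_restrict_mem (hUm i hi)] with x hx
        rw [(hon i hi x hx).2, norm_smul, mul_pow]
        refine mul_le_of_le_one_left (sq_nonneg _) ?_
        rw [Real.norm_eq_abs]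
        exact pow_le_one₀ (abs_nonneg _) (h6 x)
    simp only [energy, i1, i2]
    linarith [mul_le_mul_of_nonneg_left i3 hα.le]
  calc ∑ i ∈ s, cpl α 1 (U i) (L i) g
      = ∑ i ∈ s, ENNReal.ofReal (energy α 1 (U i) g (v i) (G i)) :=
        Finset.sum_congr rfl fun i hi => (hall i hi).2.2.1
    _ = ENNReal.ofReal (∑ i ∈ s, energy α 1 (U i) g (v i) (G i)) :=
        (ENNReal.ofReal_sum_of_nonneg fun i hi => (hall i hi).2.2.2.1).symm
    _ ≤ _ := ENNReal.ofReal_le_ofReal key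

/-! ### Scaling -/

lemma energy_comp_aff (α s : ℝ) (D : Set Plane) (g φ : Plane → ℝ) (H : Plane → Plane)
    (p : Plane) {ℓ : ℝ} (hℓ : 0 < ℓ) :
    energy α s D g φ H = ℓ ^ 4 * energy α (s * ℓ ^ 2) (aff p ℓ ⁻¹' D) (fun x => g (aff p ℓ x))
      (fun x => (ℓ ^ 2)⁻¹ * φ (aff p ℓ x)) (fun x => (ℓ ^ 2)⁻¹ • (ℓ • H (aff p ℓ x))) := by
  have e1 := setIntegral_comp_aff p hℓ D fun x => g x * φ x
  have e2 := setIntegral_comp_aff p hℓ D fun x => φ x ^ 2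
  have e3 := setIntegral_comp_aff p hℓ D fun x => ‖ℓ • H x‖ ^ 2
  rw [energy_smul, e1, e2, e3]
  have e4 : ∀ x, ‖ℓ • H x‖ ^ 2 = ℓ ^ 2 * ‖H x‖ ^ 2 := fun x => by
    rw [norm_smul, mul_pow, Real.norm_eq_abs, sq_abs]
  simp only [energy, e4, integral_const_mul]
  field_simp
  ring

lemma cpl_le_comp_aff (α s : ℝ) (D K : Set Plane) (g : Plane → ℝ) (p : Plane) {ℓ : ℝ}
    (hℓ : 0 < ℓ) :
    cpl α s D K g ≤ ENNReal.ofReal (ℓ ^ 4) *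
      cpl α (s * ℓ ^ 2) (aff p ℓ ⁻¹' D) (aff p ℓ ⁻¹' K) (fun x => g (aff p ℓ x)) := by
  refine cpl_le fun φ H h h' => ?_
  rw [energy_comp_aff α s D g φ H p hℓ, ENNReal.ofReal_mul (by positivity)]
  refine mul_le_mul_right (le_cpl ((h.comp_aff p hℓ).smul _) (VanishesOn.smul ?_ _)) _
  exact ae_restrict_comp_aff p hℓ h'

lemma cpl_comp_aff (α s : ℝ) (D K : Set Plane) (g : Plane → ℝ) (p : Plane) {ℓ : ℝ}
    (hℓ : 0 < ℓ) :
    cpl α s D K g = ENNReal.ofReal (ℓ ^ 4) *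
      cpl α (s * ℓ ^ 2) (aff p ℓ ⁻¹' D) (aff p ℓ ⁻¹' K) (fun x => g (aff p ℓ x)) := by
  refine le_antisymm (cpl_le_comp_aff α s D K g p hℓ) ?_
  have := cpl_le_comp_aff α (s * ℓ ^ 2) (aff p ℓ ⁻¹' D) (aff p ℓ ⁻¹' K)
    (fun x => g (aff p ℓ x)) (-(ℓ⁻¹ • p)) (inv_pos.2 hℓ)
  have e : ∀ A : Set Plane, aff (-(ℓ⁻¹ • p)) ℓ⁻¹ ⁻¹' (aff p ℓ ⁻¹' A) = A := fun A => by
    ext x; simp [aff_aff_inv p hℓ.ne']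
  simp only [e, aff_aff_inv p hℓ.ne'] at this
  have e2 : s * ℓ ^ 2 * ℓ⁻¹ ^ 2 = s := by field_simp
  rw [e2] at this
  calc _ ≤ ENNReal.ofReal (ℓ ^ 4) * (ENNReal.ofReal (ℓ⁻¹ ^ 4) * cpl α s D K g) :=
        mul_le_mul_right this _
    _ = _ := by
      rw [← mul_assoc, ← ENNReal.ofReal_mul (by positivity), ← mul_pow, mul_inv_cancel₀ hℓ.ne']
      simp

/-! ### A Poincaré inequality -/

/-- The first vector of the canonical basis. -/
def e₀ : Plane := EuclideanSpace.single 0 1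

lemma norm_e₀ : ‖e₀‖ = 1 := by simp [e₀]

lemma add_smul_e₀_zero (x : Plane) (t : ℝ) : (x + t • e₀) 0 = x 0 + t := by simp [e₀]

/-- Partial primitive of a test function. -/
def primitive (B : ℝ) (ψ : Plane → ℝ) (x : Plane) : ℝ := ∫ t in (0 : ℝ)..B, ψ (x + t • e₀)

lemma contDiff_primitive {B : ℝ} (hB : 0 ≤ B) {ψ : Plane → ℝ} (hψ : ContDiff ℝ ∞ ψ)
    (hc : HasCompactSupport ψ) : ContDiff ℝ ∞ (primitive B ψ) := by
  have hm : Measurable fun t : ℝ => -(t • e₀) := by fun_prop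
  set ν : Measure Plane := (volume.restrict (Set.Ioc 0 B)).map fun t : ℝ => -(t • e₀) with hν
  have : IsFiniteMeasure ν := by rw [hν]; infer_instance
  have h := hc.contDiff_convolution_right (n := ⊤) (μ := ν) (f := fun _ : Plane => (1 : ℝ))
    (ContinuousLinearMap.lsmul ℝ ℝ) (integrable_const 1).locallyIntegrable hψ
  convert h using 1
  ext x
  rw [convolution_def, hν, integral_map hm.aemeasurable, primitive,
    intervalIntegral.integral_of_le hB]
  · simp
  · have : Continuous fun t : Plane =>
        (ContinuousLinearMap.lsmul ℝ ℝ (1 : ℝ)) (ψ (x - t)) := by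
      have := hψ.continuous
      simp only [ContinuousLinearMap.lsmul_apply, one_smul]
      fun_prop
    exact this.aestronglyMeasurable

lemma fderiv_primitive {B : ℝ} (hB : 0 ≤ B) {ψ : Plane → ℝ} (hψ : ContDiff ℝ ∞ ψ)
    (hc : HasCompactSupport ψ) (x : Plane) :
    fderiv ℝ (primitive B ψ) x e₀ = ψ (x + B • e₀) - ψ x := by
  have hd : DifferentiableAt ℝ (primitive B ψ) x :=
    ((contDiff_primitive hB hψ hc).differentiable (by simp)) x
  rw [← hd.lineDeriv_eq_fderiv]
  refine HasLineDerivAt.lineDeriv ?_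
  have hcont : Continuous fun t : ℝ => ψ (x + t • e₀) := by
    have := hψ.continuous
    fun_prop
  have e : (fun t : ℝ => primitive B ψ (x + t • e₀)) = fun t : ℝ =>
      (∫ s in (0 : ℝ)..(t + B), ψ (x + s • e₀)) - ∫ s in (0 : ℝ)..t, ψ (x + s • e₀) := by
    ext t
    rw [intervalIntegral.integral_interval_sub_left (hcont.intervalIntegrable _ _)
      (hcont.intervalIntegrable _ _), primitive]
    have := intervalIntegral.integral_comp_add_left (a := 0) (b := B)
      (fun s : ℝ => ψ (x + s • e₀)) t
    rw [add_zero] at this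
    rw [← this]
    simp only [add_smul, add_assoc]
  rw [HasLineDerivAt, e]
  have h1 : HasDerivAt (fun u : ℝ => ∫ s in (0 : ℝ)..u, ψ (x + s • e₀)) (ψ (x + B • e₀))
      ((0 : ℝ) + B) := by
    simpa using intervalIntegral.integral_hasDerivAt_right (hcont.intervalIntegrable 0 (0 + B))
      (hcont.stronglyMeasurableAtFilter _ _) hcont.continuousAt
  have h2 : HasDerivAt (fun u : ℝ => ∫ s in (0 : ℝ)..u, ψ (x + s • e₀)) (ψ x) 0 := by
    simpa using intervalIntegral.integral_hasDerivAt_right (hcont.intervalIntegrable 0 0)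
      (hcont.stronglyMeasurableAtFilter _ _) hcont.continuousAt
  exact (h1.comp_add_const 0 B).sub h2

lemma sq_integral_le {B : ℝ} (hB : 0 < B) {u : ℝ → ℝ} (hu : Continuous u) :
    (∫ t in (0 : ℝ)..B, u t) ^ 2 ≤ B * ∫ t in (0 : ℝ)..B, u t ^ 2 := by
  set c := (∫ t in (0 : ℝ)..B, u t) / B with hc
  have h0 : 0 ≤ ∫ t in (0 : ℝ)..B, (u t - c) ^ 2 :=
    intervalIntegral.integral_nonneg hB.le fun t _ => sq_nonneg _
  have e : ∫ t in (0 : ℝ)..B, (u t - c) ^ 2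
      = (∫ t in (0 : ℝ)..B, u t ^ 2) - 2 * c * (∫ t in (0 : ℝ)..B, u t) + B * c ^ 2 := by
    have : ∀ t, (u t - c) ^ 2 = u t ^ 2 - 2 * c * u t + c ^ 2 := fun t => by ring
    simp only [this]
    rw [intervalIntegral.integral_add, intervalIntegral.integral_sub,
      intervalIntegral.integral_const_mul, intervalIntegral.integral_const]
    · simp
    all_goals exact Continuous.intervalIntegrable (by fun_prop) _ _
  have e2 : (∫ t in (0 : ℝ)..B, u t) = B * c := by rw [hc]; field_simp
  rw [e2] at e ⊢
  nlinarith

lemma lintegral_primitive_sq_le {B : ℝ} (hB : 0 < B) {ψ : Plane → ℝ} (hψ : Continuous ψ) :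
    ∫⁻ x, ENNReal.ofReal (primitive B ψ x ^ 2) ≤
      ENNReal.ofReal (B ^ 2) * ∫⁻ x, ENNReal.ofReal (ψ x ^ 2) := by
  have h1 : ∀ x, ENNReal.ofReal (primitive B ψ x ^ 2) ≤
      ENNReal.ofReal B * ∫⁻ t in Set.Ioc 0 B, ENNReal.ofReal (ψ (x + t • e₀) ^ 2) := by
    intro x
    have hcont : Continuous fun t : ℝ => ψ (x + t • e₀) := by fun_prop
    rw [← ofReal_integral_eq_lintegral_ofReal, ← intervalIntegral.integral_of_le hB.le,
      ← ENNReal.ofReal_mul hB.le]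
    · exact ENNReal.ofReal_le_ofReal (sq_integral_le hB hcont)
    · exact ((hcont.pow 2).integrableOn_Icc).mono_set Set.Ioc_subset_Icc_self
    · exact Eventually.of_forall fun t => sq_nonneg _
  calc _ ≤ ∫⁻ x, ENNReal.ofReal B *
        ∫⁻ t in Set.Ioc 0 B, ENNReal.ofReal (ψ (x + t • e₀) ^ 2) := lintegral_mono h1
    _ = ENNReal.ofReal B * ∫⁻ x, ∫⁻ t in Set.Ioc 0 B, ENNReal.ofReal (ψ (x + t • e₀) ^ 2) :=
        lintegral_const_mul' _ _ ENNReal.ofReal_ne_top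
    _ = ENNReal.ofReal B * ∫⁻ t in Set.Ioc 0 B, ∫⁻ x, ENNReal.ofReal (ψ (x + t • e₀) ^ 2) := by
        rw [lintegral_lintegral_swap]
        refine Continuous.aemeasurable ?_
        simp only [Function.uncurry_def]
        exact ENNReal.continuous_ofReal.comp (by fun_prop)
    _ = ENNReal.ofReal B * ∫⁻ t in Set.Ioc 0 B, ∫⁻ x, ENNReal.ofReal (ψ x ^ 2) := by
        congr 1
        refine lintegral_congr fun t => ?_
        exact lintegral_add_right_eq_self (fun x => ENNReal.ofReal (ψ x ^ 2)) (t • e₀)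
    _ = _ := by
        rw [setLIntegral_const, Real.volume_Ioc, sub_zero, pow_two, ENNReal.ofReal_mul hB.le]
        ring

/-- Open rectangles. -/
def rect (a b c d : ℝ) : Set Plane := {x | x 0 ∈ Set.Ioo a b ∧ x 1 ∈ Set.Ioo c d}

lemma isOpen_rect (a b c d : ℝ) : IsOpen (rect a b c d) := by
  have h0 : Continuous fun x : Plane => x 0 := by fun_prop
  have h1 : Continuous fun x : Plane => x 1 := by fun_prop
  exact (isOpen_Ioo.preimage h0).inter (isOpen_Ioo.preimage h1)

lemma isBounded_rect (a b c d : ℝ) : Bornology.IsBounded (rect a b c d) := by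
  rw [isBounded_iff_forall_norm_le]
  refine ⟨√((|a| + |b|) ^ 2 + (|c| + |d|) ^ 2), fun x hx => ?_⟩
  rw [EuclideanSpace.norm_eq, Fin.sum_univ_two]
  refine Real.sqrt_le_sqrt (add_le_add ?_ ?_)
  · refine pow_le_pow_left₀ (norm_nonneg _) ?_ 2
    rw [Real.norm_eq_abs, abs_le]
    constructor
    · linarith [hx.1.1, neg_abs_le a, abs_nonneg b]
    · linarith [hx.1.2, le_abs_self b, abs_nonneg a]
  · refine pow_le_pow_left₀ (norm_nonneg _) ?_ 2
    rw [Real.norm_eq_abs, abs_le]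
    constructor
    · linarith [hx.2.1, neg_abs_le c, abs_nonneg d]
    · linarith [hx.2.2, le_abs_self d, abs_nonneg c]

/-- A smooth step in the first coordinate. -/
def step (a δ : ℝ) (x : Plane) : ℝ := Real.smoothTransition ((x 0 - a - δ / 3) / (δ / 3))

lemma contDiff_step (a δ : ℝ) : ContDiff ℝ ∞ (step a δ) := by
  unfold step
  refine Real.smoothTransition.contDiff.comp ?_
  fun_prop

lemma step_eq_zero {a δ : ℝ} (hδ : 0 < δ) {x : Plane} (hx : x 0 ≤ a + δ / 3) :
    step a δ x = 0 :=
  Real.smoothTransition.zero_of_nonpos (div_nonpos_of_nonpos_of_nonneg (by linarith)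
    (by positivity))

lemma step_eq_one {a δ : ℝ} (hδ : 0 < δ) {x : Plane} (hx : a + 2 * δ / 3 ≤ x 0) :
    step a δ x = 1 := by
  refine Real.smoothTransition.one_of_one_le ?_
  rw [le_div_iff₀ (by positivity)]; linarith

lemma fderiv_step_eq_zero {a δ : ℝ} (hδ : 0 < δ) {x : Plane} (hx : a + δ ≤ x 0) :
    fderiv ℝ (step a δ) x = 0 := by
  have h0 : Continuous fun x : Plane => x 0 := by fun_prop
  have : step a δ =ᶠ[𝓝 x] fun _ => 1 := by
    have : ∀ᶠ y : Plane in 𝓝 x, a + 2 * δ / 3 < y 0 :=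
      h0.continuousAt.eventually (lt_mem_nhds (by linarith : a + 2 * δ / 3 < x 0))
    filter_upwards [this] with y hy using step_eq_one hδ hy.le
  rw [this.fderiv_eq]
  simp

section Poincare

variable {a b c d δ : ℝ} {φ : Plane → ℝ} {G : Plane → Plane}

lemma sq_integral_mul_le_of_tsupport_subset (hab : a < b) (hδ : 0 < δ)
    (h : IsSobolevPair (rect a b c d) φ G)
    (hz : ∀ᵐ x ∂volume.restrict (rect a b c d), x 0 < a + δ → φ x = 0)
    {ψ : Plane → ℝ} (hψ : ContDiff ℝ ∞ ψ) (hc : HasCompactSupport ψ)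
    (hs : tsupport ψ ⊆ rect a b c d) :
    |∫ x in rect a b c d, φ x * ψ x| ≤
      (b - a) * √(∫ x in rect a b c d, ‖G x‖ ^ 2) * √(∫ x, ψ x ^ 2) := by
  set R := rect a b c d with hR
  set B := b - a with hB
  have hB0 : 0 < B := sub_pos.2 hab
  have hRm : MeasurableSet R := (isOpen_rect a b c d).measurableSet
  set A := primitive B ψ with hA
  have hAs : ContDiff ℝ ∞ A := contDiff_primitive hB0.le hψ hc
  set Ψ : Plane → ℝ := fun x => step a δ x * A x with hΨ
  have hΨs : ContDiff ℝ ∞ Ψ := (contDiff_step a δ).mul hAs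
  have hzero : ∀ x ∉ tsupport ψ, ψ x = 0 := fun x hx => image_eq_zero_of_notMem_tsupport hx
  -- the support of `Ψ`
  set C : Set Plane := (fun q : Plane × ℝ => q.1 - q.2 • e₀) '' (tsupport ψ ×ˢ Set.Icc 0 B) with hC
  have hCc : IsCompact C := (hc.isCompact.prod isCompact_Icc).image (by fun_prop)
  have h0 : Continuous fun x : Plane => x 0 := by fun_prop
  have hcl : IsClosed {x : Plane | a + δ / 3 ≤ x 0} := isClosed_le continuous_const h0
  have hsub : Function.support Ψ ⊆ C ∩ {x : Plane | a + δ / 3 ≤ x 0} := by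
    intro x hx
    constructor
    · by_contra hxC
      refine hx ?_
      have : A x = 0 := by
        rw [hA, primitive]
        refine intervalIntegral.integral_zero_ae (Eventually.of_forall fun t ht => ?_)
        rw [Set.uIoc_of_le hB0.le] at ht
        refine hzero _ fun hmem => hxC ⟨(x + t • e₀, t), ⟨hmem, ht.1.le, ht.2⟩, ?_⟩
        simp
      simp [hΨ, this]
    · by_contra hxC
      exact hx (by simp [hΨ, step_eq_zero hδ (not_le.1 hxC).le])
  have htsub : tsupport Ψ ⊆ C ∩ {x : Plane | a + δ / 3 ≤ x 0} :=
    closure_minimal hsub (hCc.isClosed.inter hcl)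
  have hΨc : HasCompactSupport Ψ :=
    HasCompactSupport.intro (hCc.inter_right hcl) fun x hx => by
      by_contra hne; exact hx (hsub hne)
  have hΨR : tsupport Ψ ⊆ R := by
    intro x hx
    obtain ⟨⟨⟨z, t⟩, ⟨hz1, hz2⟩, rfl⟩, hx2⟩ := htsub hx
    have hzR := hs hz1
    simp only [Set.mem_ofPred_eq] at hx2
    have c0 : (z - t • e₀) 0 = z 0 - t := by simp [e₀]
    have c1 : (z - t • e₀) 1 = z 1 := by simp [e₀]
    refine ⟨⟨by linarith, ?_⟩, ?_⟩
    · simp only [c0]; linarith [hzR.1.2, hz2.1]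
    · simp only [c1]; exact hzR.2
  have key := h.weak_grad Ψ hΨs hΨc hΨR e₀
  have e1 : ∫ x in R, φ x * fderiv ℝ Ψ x e₀ = - ∫ x in R, φ x * ψ x := by
    rw [← integral_neg]
    refine integral_congr_ae ?_
    filter_upwards [hz, ae_restrict_mem hRm] with x hx hxR
    have hout : ψ (x + B • e₀) = 0 := by
      refine hzero _ fun hmem => ?_
      have := (hs hmem).1.2
      rw [add_smul_e₀_zero] at this
      linarith [hxR.1.1]
    have d1 := ((contDiff_step a δ).differentiable (by simp)) x
    have d2 := (hAs.differentiable (by simp)) x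
    rw [hΨ, fderiv_fun_mul d1 d2]
    simp only [add_apply, smul_apply, smul_eq_mul,
      fderiv_primitive hB0.le hψ hc, hA, hout]
    rcases lt_or_ge (x 0) (a + δ) with hlt | hge
    · simp [hx hlt]
    · rw [fderiv_step_eq_zero hδ hge, step_eq_one hδ (by linarith)]
      simp
  rw [e1, neg_inj] at key
  rw [key]
  -- estimate of the right-hand side
  have hlin : ∫⁻ x, ENNReal.ofReal (Ψ x ^ 2) ≤
      ENNReal.ofReal (B ^ 2) * ∫⁻ x, ENNReal.ofReal (ψ x ^ 2) := by
    refine le_trans (lintegral_mono fun x => ENNReal.ofReal_le_ofReal ?_)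
      (lintegral_primitive_sq_le hB0 hψ.continuous)
    rw [hΨ, mul_pow]
    refine mul_le_of_le_one_left (sq_nonneg _) ?_
    exact pow_le_one₀ (Real.smoothTransition.nonneg _) (Real.smoothTransition.le_one _)
  have hψ2 : Integrable fun x => ψ x ^ 2 :=
    (hψ.continuous.memLp_of_hasCompactSupport hc).integrable_sq
  have hΨL : MemLp Ψ 2 volume := hΨs.continuous.memLp_of_hasCompactSupport hΨc
  have hΨ2 : ∫ x, Ψ x ^ 2 ≤ B ^ 2 * ∫ x, ψ x ^ 2 := by
    rw [← ofReal_integral_eq_lintegral_ofReal hΨL.integrable_sq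
      (Eventually.of_forall fun x => sq_nonneg _), ← ofReal_integral_eq_lintegral_ofReal hψ2
      (Eventually.of_forall fun x => sq_nonneg _), ← ENNReal.ofReal_mul (by positivity)] at hlin
    exact (ENNReal.ofReal_le_ofReal_iff (mul_nonneg (sq_nonneg _)
      (integral_nonneg fun x => sq_nonneg _))).1 hlin
  have hCS : |∫ x in R, inner ℝ (G x) e₀ * Ψ x| ≤
      √(∫ x in R, ‖G x‖ ^ 2) * √(∫ x in R, Ψ x ^ 2) := by
    have h1 := integral_mul_le_Lp_mul_Lq_of_nonneg (μ := volume.restrict R)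
      (Real.HolderConjugate.two_two) (f := fun x => ‖G x‖) (g := fun x => |Ψ x|)
      (Eventually.of_forall fun x => norm_nonneg _) (Eventually.of_forall fun x => abs_nonneg _)
      (by simpa using h.memLp_grad.norm) (by simpa using (hΨL.restrict R).norm)
    simp only [Real.rpow_two, sq_abs, ← Real.sqrt_eq_rpow] at h1
    refine le_trans (abs_integral_le_integral_abs) (le_trans (integral_mono_of_nonneg
      (Eventually.of_forall fun x => abs_nonneg _) ?_ (Eventually.of_forall fun x => ?_)) h1)
    · exact h.memLp_grad.norm.integrable_mul (hΨL.restrict R).norm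
    · simp only
      rw [abs_mul]
      refine mul_le_mul_of_nonneg_right ?_ (abs_nonneg _)
      have := abs_real_inner_le_norm (G x) e₀
      rwa [norm_e₀, mul_one] at this
  refine hCS.trans ?_
  have : √(∫ x in R, Ψ x ^ 2) ≤ B * √(∫ x, ψ x ^ 2) := by
    rw [← Real.sqrt_sq hB0.le, ← Real.sqrt_mul (sq_nonneg _)]
    exact Real.sqrt_le_sqrt ((setIntegral_le_integral hΨL.integrable_sq
      (Eventually.of_forall fun x => sq_nonneg _)).trans hΨ2)
  calc _ ≤ √(∫ x in R, ‖G x‖ ^ 2) * (B * √(∫ x, ψ x ^ 2)) := by gcongr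
    _ = _ := by ring

lemma sq_integral_mul_le (hab : a < b) (hδ : 0 < δ)
    (h : IsSobolevPair (rect a b c d) φ G)
    (hz : ∀ᵐ x ∂volume.restrict (rect a b c d), x 0 < a + δ → φ x = 0)
    {ψ : Plane → ℝ} (hψ : ContDiff ℝ ∞ ψ) (hc : HasCompactSupport ψ) :
    |∫ x in rect a b c d, φ x * ψ x| ≤
      (b - a) * √(∫ x in rect a b c d, ‖G x‖ ^ 2) * √(∫ x in rect a b c d, ψ x ^ 2) := by
  set R := rect a b c d with hR
  have hRo : IsOpen R := isOpen_rect a b c d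
  obtain ⟨f, hfs, hf, hfr⟩ := hRo.exists_contDiff_support_eq (n := ⊤)
  have hf01 : ∀ x, 0 ≤ f x := fun x => (hfr (Set.mem_range_self x)).1
  let χ : ℕ → Plane → ℝ := fun k x => Real.smoothTransition (k * f x - 1)
  have hχ : ∀ k, ContDiff ℝ ∞ (χ k) := fun k =>
    Real.smoothTransition.contDiff.comp ((contDiff_const.mul hf).sub contDiff_const)
  have hχs : ∀ k, tsupport (χ k) ⊆ R := by
    intro k
    have hcl : IsClosed {x | 1 ≤ k * f x} :=
      isClosed_le continuous_const (continuous_const.mul hf.continuous)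
    refine (closure_minimal ?_ hcl).trans ?_
    · intro x hx
      by_contra hlt
      exact hx (Real.smoothTransition.zero_of_nonpos (by
        simp only [Set.mem_ofPred_eq, not_le] at hlt; linarith))
    · intro x hx
      rw [← hfs]
      intro h0
      simp only [Set.mem_ofPred_eq, h0, mul_zero] at hx
      linarith
  have hχ1 : ∀ x ∈ R, Tendsto (fun k => χ k x) atTop (𝓝 1) := by
    intro x hx
    have hpos : 0 < f x := lt_of_le_of_ne (hf01 x) fun h0 => by
      have : x ∈ Function.support f := hfs ▸ hx
      exact this h0.symm
    refine tendsto_const_nhds.congr' ?_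
    filter_upwards [(tendsto_natCast_atTop_atTop (R := ℝ)).eventually_ge_atTop (2 / f x)]
      with k hk
    refine (Real.smoothTransition.one_of_one_le ?_).symm
    rw [div_le_iff₀ hpos] at hk
    linarith
  have hχb : ∀ k x, |χ k x| ≤ 1 := fun k x => by
    rw [abs_of_nonneg (Real.smoothTransition.nonneg _)]
    exact Real.smoothTransition.le_one _
  have hψL : MemLp ψ 2 (volume.restrict R) :=
    (hψ.continuous.memLp_of_hasCompactSupport hc).restrict R
  have main : ∀ k, |∫ x in R, φ x * (χ k x * ψ x)| ≤
      (b - a) * √(∫ x in R, ‖G x‖ ^ 2) * √(∫ x in R, (χ k x * ψ x) ^ 2) := by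
    intro k
    have := sq_integral_mul_le_of_tsupport_subset hab hδ h hz (ψ := fun x => χ k x * ψ x)
      ((hχ k).mul hψ) hc.mul_left ((tsupport_mul_subset_left).trans (hχs k))
    have e : ∫ x in R, (χ k x * ψ x) ^ 2 = ∫ x, (χ k x * ψ x) ^ 2 :=
      setIntegral_eq_integral_of_forall_compl_eq_zero fun x hx => by
        rw [image_eq_zero_of_notMem_tsupport fun h => hx (hχs k h)]; simp
    rwa [e]
  have lim1 : Tendsto (fun k => ∫ x in R, φ x * (χ k x * ψ x)) atTop
      (𝓝 (∫ x in R, φ x * ψ x)) := by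
    refine tendsto_integral_of_dominated_convergence (fun x => |φ x * ψ x|) (fun k => ?_)
      (h.memLp_fun.integrable_mul hψL).norm (fun k => Eventually.of_forall fun x => ?_) ?_
    · exact h.memLp_fun.aestronglyMeasurable.mul
        ((hχ k).continuous.mul hψ.continuous).aestronglyMeasurable
    · rw [Real.norm_eq_abs, show φ x * (χ k x * ψ x) = χ k x * (φ x * ψ x) by ring, abs_mul]
      exact mul_le_of_le_one_left (abs_nonneg _) (hχb k x)
    · filter_upwards [ae_restrict_mem hRo.measurableSet] with x hx
      simpa using ((hχ1 x hx).mul_const (ψ x)).const_mul (φ x)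
  have lim2 : Tendsto (fun k => ∫ x in R, (χ k x * ψ x) ^ 2) atTop
      (𝓝 (∫ x in R, ψ x ^ 2)) := by
    refine tendsto_integral_of_dominated_convergence (fun x => ψ x ^ 2) (fun k => ?_)
      hψL.integrable_sq (fun k => Eventually.of_forall fun x => ?_) ?_
    · exact (((hχ k).continuous.mul hψ.continuous).pow 2).aestronglyMeasurable
    · rw [Real.norm_eq_abs, abs_of_nonneg (sq_nonneg _), mul_pow]
      refine mul_le_of_le_one_left (sq_nonneg _) ?_
      rw [← sq_abs]
      exact pow_le_one₀ (abs_nonneg _) (hχb k x)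
    · filter_upwards [ae_restrict_mem hRo.measurableSet] with x hx
      simpa using ((hχ1 x hx).mul_const (ψ x)).pow 2
  exact le_of_tendsto_of_tendsto' lim1.abs
    (((Real.continuous_sqrt.tendsto _).comp lim2).const_mul _) main

/-- Poincaré's inequality on a rectangle for functions vanishing near the left side. -/
theorem poincare_rect (hab : a < b) (hδ : 0 < δ)
    (h : IsSobolevPair (rect a b c d) φ G)
    (hz : ∀ᵐ x ∂volume.restrict (rect a b c d), x 0 < a + δ → φ x = 0) :
    ∫ x in rect a b c d, φ x ^ 2 ≤ (b - a) ^ 2 * ∫ x in rect a b c d, ‖G x‖ ^ 2 := by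
  set μ := volume.restrict (rect a b c d) with hμ
  set C := (b - a) * √(∫ x, ‖G x‖ ^ 2 ∂μ) with hC
  have hC0 : 0 ≤ C := mul_nonneg (sub_pos.2 hab).le (Real.sqrt_nonneg _)
  set F := h.memLp_fun.toLp with hF
  have nsq : ∀ f : Lp ℝ 2 μ, ‖f‖ ^ 2 = ∫ x, f x ^ 2 ∂μ := fun f => by
    rw [← real_inner_self_eq_norm_sq, L2.inner_def]
    simp [pow_two]
  have hdense := Lp.dense_hasCompactSupport_contDiff (E := Plane) (F := ℝ) (μ := μ)
    (p := 2) (by simp)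
  have key : ∀ f : Lp ℝ 2 μ, inner ℝ F f ≤ C * ‖f‖ := by
    intro f
    refine hdense.induction (P := fun f => inner ℝ F f ≤ C * ‖f‖) ?_ ?_ f
    · rintro f ⟨ψ, hfψ, hψc, hψ⟩
      have h1 : inner ℝ F f = ∫ x, φ x * ψ x ∂μ := by
        rw [L2.inner_def]
        refine integral_congr_ae ?_
        filter_upwards [h.memLp_fun.coeFn_toLp, hfψ] with x hx hx'
        rw [hx, hx']
        simp [mul_comm]
      have h2 : ‖f‖ = √(∫ x, ψ x ^ 2 ∂μ) := by
        rw [← Real.sqrt_sq (norm_nonneg f), nsq]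
        congr 1
        exact integral_congr_ae (by filter_upwards [hfψ] with x hx using by rw [hx])
      rw [h1, h2]
      exact (le_abs_self _).trans (sq_integral_mul_le hab hδ h hz hψ hψc)
    · exact isClosed_le (by fun_prop) (by fun_prop)
  have hFF := key F
  rw [real_inner_self_eq_norm_sq] at hFF
  have hle : ‖F‖ ≤ C := by
    rcases (norm_nonneg F).eq_or_lt with h0 | h0
    · rw [← h0]; exact hC0
    · nlinarith
  have hfin : ‖F‖ ^ 2 = ∫ x, φ x ^ 2 ∂μ := by
    rw [nsq]
    exact integral_congr_ae (by
      filter_upwards [h.memLp_fun.coeFn_toLp] with x hx using by rw [hx])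
  rw [← hfin]
  calc ‖F‖ ^ 2 ≤ C ^ 2 := pow_le_pow_left₀ (norm_nonneg _) hle 2
    _ = _ := by
      rw [hC, mul_pow, Real.sq_sqrt (integral_nonneg fun x => sq_nonneg _)]

end Poincare

/-! ### Unions of balls in the unit square -/

lemma unitSquare_eq_rect : unitSquare = rect 0 1 0 1 := by
  ext x
  simp [unitSquare, rect, Fin.forall_fin_two]

lemma isOpen_unitSquare : IsOpen unitSquare := unitSquare_eq_rect ▸ isOpen_rect 0 1 0 1

/-- The union of the closed balls of radius `r` centred in `S`. -/
def balls (S : Finset Plane) (r : ℝ) : Set Plane := ⋃ x ∈ S, Metric.closedBall x r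

lemma mem_balls {S : Finset Plane} {r : ℝ} {z : Plane} :
    z ∈ balls S r ↔ ∃ x ∈ S, dist z x ≤ r := by
  simp [balls]

lemma measurableSet_balls (S : Finset Plane) (r : ℝ) : MeasurableSet (balls S r) :=
  S.measurableSet_biUnion fun _ _ => Metric.isClosed_closedBall.measurableSet

lemma balls_mono {S S' : Finset Plane} (h : S ⊆ S') {r r' : ℝ} (hr : r ≤ r') :
    balls S r ⊆ balls S' r' := by
  intro z hz
  obtain ⟨x, hx, hd⟩ := mem_balls.1 hz
  exact mem_balls.2 ⟨x, h hx, hd.trans hr⟩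

lemma dist_le_of_coord {x y u v : Plane} (h0 : |x 0 - y 0| ≤ |u 0 - v 0|)
    (h1 : |x 1 - y 1| ≤ |u 1 - v 1|) : dist x y ≤ dist u v := by
  rw [EuclideanSpace.dist_eq, EuclideanSpace.dist_eq, Fin.sum_univ_two, Fin.sum_univ_two]
  simp only [Real.dist_eq]
  gcongr

lemma dist_le_of_half {x y : Plane} {r : ℝ} (hr : 0 ≤ r) (h0 : |x 0 - y 0| ≤ r / 2)
    (h1 : |x 1 - y 1| ≤ r / 2) : dist x y ≤ r := by
  rw [EuclideanSpace.dist_eq, Fin.sum_univ_two]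
  simp only [Real.dist_eq]
  refine Real.sqrt_le_iff.2 ⟨hr, ?_⟩
  have := pow_le_pow_left₀ (abs_nonneg _) h0 2
  have := pow_le_pow_left₀ (abs_nonneg _) h1 2
  nlinarith [sq_nonneg r]

/-- Centres of balls covering the vertical segment of abscissa `a`. -/
def column (a r : ℝ) : Finset Plane :=
  (Finset.range (⌈1 / r⌉₊ + 1)).image fun j : ℕ => !₂[a, j * r]

/-- Centres of balls covering the horizontal segment of ordinate `b`. -/
def row (b r : ℝ) : Finset Plane :=
  (Finset.range (⌈1 / r⌉₊ + 1)).image fun j : ℕ => !₂[j * r, b]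

lemma card_column_le (a r : ℝ) : (column a r).card ≤ ⌈1 / r⌉₊ + 1 :=
  Finset.card_image_le.trans (by simp)

lemma card_row_le (b r : ℝ) : (row b r).card ≤ ⌈1 / r⌉₊ + 1 :=
  Finset.card_image_le.trans (by simp)

lemma exists_nat_near {r t : ℝ} (hr : 0 < r) (h0 : 0 ≤ t) (h1 : t ≤ 1) :
    ∃ j ∈ Finset.range (⌈1 / r⌉₊ + 1), |t - j * r| ≤ r / 2 := by
  refine ⟨⌊t / r + 1 / 2⌋₊, ?_, ?_⟩
  · rw [Finset.mem_range, Nat.floor_lt (by positivity)]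
    have h2 : t / r ≤ 1 / r := by gcongr
    have h3 := Nat.le_ceil (1 / r)
    push_cast
    linarith
  · have h2 := Nat.floor_le (a := t / r + 1 / 2) (by positivity)
    have h3 := Nat.lt_floor_add_one (t / r + 1 / 2)
    set j : ℝ := (⌊t / r + 1 / 2⌋₊ : ℝ)
    have e : t = t / r * r := by field_simp
    rw [abs_le]
    constructor <;> nlinarith

lemma mem_balls_column {a r : ℝ} (hr : 0 < r) {x : Plane} (hx : |x 0 - a| ≤ r / 2)
    (h0 : 0 ≤ x 1) (h1 : x 1 ≤ 1) : x ∈ balls (column a r) r := by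
  obtain ⟨j, hj, hjr⟩ := exists_nat_near hr h0 h1
  refine mem_balls.2 ⟨!₂[a, j * r], Finset.mem_image_of_mem _ hj, ?_⟩
  exact dist_le_of_half hr.le (by simpa using hx) (by simpa using hjr)

lemma mem_balls_row {b r : ℝ} (hr : 0 < r) {x : Plane} (hx : |x 1 - b| ≤ r / 2)
    (h0 : 0 ≤ x 0) (h1 : x 0 ≤ 1) : x ∈ balls (row b r) r := by
  obtain ⟨j, hj, hjr⟩ := exists_nat_near hr h0 h1
  refine mem_balls.2 ⟨!₂[j * r, b], Finset.mem_image_of_mem _ hj, ?_⟩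
  exact dist_le_of_half hr.le (by simpa using hjr) (by simpa using hx)

/-- Centres of balls covering `M` equidistant vertical segments. -/
def lines (M : ℕ) (r : ℝ) : Finset Plane :=
  (Finset.range M).biUnion fun i => column (i / M) r

lemma card_lines_le (M : ℕ) (r : ℝ) : (lines M r).card ≤ M * (⌈1 / r⌉₊ + 1) := by
  refine (Finset.card_biUnion_le_card_mul _ _ _ fun i _ => card_column_le _ _).trans ?_
  simp

lemma poincare_lines {M : ℕ} (hM : 0 < M) {r : ℝ} (hr : 0 < r) {φ : Plane → ℝ}
    {G : Plane → Plane} (h : IsSobolevPair unitSquare φ G)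
    (hv : VanishesOn unitSquare (balls (lines M r) r) φ) :
    ∫ x in unitSquare, φ x ^ 2 ≤ ((M : ℝ) ^ 2)⁻¹ * ∫ x in unitSquare, ‖G x‖ ^ 2 := by
  have hM' : (0 : ℝ) < M := by exact_mod_cast hM
  set U : ℕ → Set Plane := fun i => rect (i / M) ((i + 1) / M) 0 1 with hU
  have hUm : ∀ i ∈ Finset.range M, MeasurableSet (U i) := fun i _ =>
    (isOpen_rect _ _ _ _).measurableSet
  have hUD : ∀ i ∈ Finset.range M, U i ⊆ unitSquare := by
    intro i hi x hx
    rw [unitSquare_eq_rect]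
    have hi' : ((i : ℝ) + 1) / M ≤ 1 := by
      rw [div_le_one hM']
      exact_mod_cast Finset.mem_range.1 hi
    have hi0 : 0 ≤ (i : ℝ) / M := by positivity
    exact ⟨⟨hi0.trans_lt hx.1.1, hx.1.2.trans_le hi'⟩, hx.2⟩
  have hd : ((Finset.range M : Finset ℕ) : Set ℕ).PairwiseDisjoint U := by
    intro i _ j _ hij
    refine Set.disjoint_left.2 fun x hx hx' => ?_
    have h1 := hx.1.1
    have h2 := hx.1.2
    have h3 := hx'.1.1
    have h4 := hx'.1.2
    have h5 : (i : ℝ) / M < (j + 1) / M := h1.trans h4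
    have h6 : (j : ℝ) / M < (i + 1) / M := h3.trans h2
    rw [div_lt_div_iff_of_pos_right hM'] at h5 h6
    have h7 : i < j + 1 := by exact_mod_cast h5
    have h8 : j < i + 1 := by exact_mod_cast h6
    omega
  have hcol : ∀ x ∈ unitSquare, ∀ i ∈ Finset.range M, |x 0 - i / M| ≤ r / 2 →
      x ∈ balls (lines M r) r := by
    intro x hx i hi hxi
    refine balls_mono (Finset.subset_biUnion_of_mem (fun i : ℕ => column (i / M) r) hi) le_rfl ?_
    exact mem_balls_column hr hxi (hx 1).1.le (hx 1).2.le
  have hvan := (vanishesOn_iff (measurableSet_balls _ _)).1 hv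
  have hz : ∀ᵐ x ∂volume.restrict unitSquare, x ∉ ⋃ i ∈ Finset.range M, U i →
      φ x ^ 2 = 0 := by
    filter_upwards [hvan, ae_restrict_mem isOpen_unitSquare.measurableSet] with x hx hxQ hnot
    have hx0 : 0 < x 0 := (hxQ 0).1
    have hx1 : x 0 < 1 := (hxQ 0).2
    have hi : ⌊x 0 * M⌋₊ ∈ Finset.range M := by
      rw [Finset.mem_range, Nat.floor_lt (by positivity)]
      nlinarith
    have h1 := Nat.floor_le (a := x 0 * M) (by positivity)
    have h2 := Nat.lt_floor_add_one (x 0 * M)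
    set i := ⌊x 0 * M⌋₊
    have h3 : x 0 = i / M := by
      by_contra hne
      refine hnot (Set.mem_iUnion₂.2 ⟨i, hi, ⟨lt_of_le_of_ne ?_ (Ne.symm hne), ?_⟩, hxQ 1⟩)
      · rw [div_le_iff₀ hM']; exact h1
      · rw [lt_div_iff₀ hM']; exact h2
    rw [hx (hcol x hxQ i hi (by rw [h3]; simp; positivity))]
    norm_num
  rw [setIntegral_eq_sum isOpen_unitSquare.measurableSet hUm hUD hd h.memLp_fun.integrable_sq hz]
  calc ∑ i ∈ Finset.range M, ∫ x in U i, φ x ^ 2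
      ≤ ∑ i ∈ Finset.range M, ((M : ℝ) ^ 2)⁻¹ * ∫ x in U i, ‖G x‖ ^ 2 := by
        refine Finset.sum_le_sum fun i hi => ?_
        have := poincare_rect (a := i / M) (b := (i + 1) / M) (c := 0) (d := 1) (δ := r / 2)
          (by gcongr; linarith) (by positivity)
          (h.mono isOpen_unitSquare.measurableSet (hUD i hi)) (by
            have h1 := ae_restrict_of_ae_restrict_of_subset (hUD i hi) hvan
            filter_upwards [h1, ae_restrict_mem (hUm i hi)] with x hx hxU hlt
            refine hx (hcol x (hUD i hi hxU) i hi ?_)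
            have := hxU.1.1
            rw [abs_of_nonneg (by linarith)]
            linarith)
        have e : ((i : ℝ) + 1) / M - i / M = (M : ℝ)⁻¹ := by field_simp; ring
        rw [e, inv_pow] at this
        exact this
    _ = ((M : ℝ) ^ 2)⁻¹ * ∑ i ∈ Finset.range M, ∫ x in U i, ‖G x‖ ^ 2 := by
        rw [Finset.mul_sum]
    _ ≤ _ := by
        gcongr
        exact sum_setIntegral_le hUm hUD hd (MemLp.integrable_norm_sq h.memLp_grad)
          fun x => sq_nonneg _

lemma ceil_inv_le {r : ℝ} (hr : 0 < r) (hr2 : r ≤ 1 / 2) :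
    ((⌈1 / r⌉₊ + 1 : ℕ) : ℝ) ≤ 2 / r := by
  have h1 := Nat.ceil_lt_add_one (a := 1 / r) (by positivity)
  have h2 : 2 ≤ 1 / r := by rw [le_div_iff₀ hr]; linarith
  have h3 : 2 / r = 1 / r + 1 / r := by ring
  push_cast
  linarith

lemma tendsto_div_sqrt (m : ℝ) : Tendsto (fun y : ℝ => m / √y) atTop (𝓝 0) :=
  tendsto_const_nhds.div_atTop Real.tendsto_sqrt_atTop

/-- A small proportion of the balls ensures a Poincaré inequality at the right scale. -/
lemma exists_lines_budget {ε m : ℝ} (hε : 0 < ε) (hm : 0 < m) :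
    ∃ C > 0, ∀ᶠ y : ℝ in atTop, ∃ S : Finset Plane, (S.card : ℝ) ≤ ε * y ∧
      ∀ φ G, IsSobolevPair unitSquare φ G → VanishesOn unitSquare (balls S (m / √y)) φ →
        ∫ x in unitSquare, φ x ^ 2 ≤ C / y * ∫ x in unitSquare, ‖G x‖ ^ 2 := by
  refine ⟨16 / (ε * m) ^ 2, by positivity, ?_⟩
  have h1 : ∀ᶠ y : ℝ in atTop, m / √y ≤ 1 / 2 :=
    (tendsto_div_sqrt m).eventually_le_const (by norm_num)
  have h2 : ∀ᶠ y : ℝ in atTop, 4 / (ε * m) ≤ √y :=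
    Real.tendsto_sqrt_atTop.eventually_ge_atTop _
  filter_upwards [h1, h2, eventually_gt_atTop 0] with y h1 h2 hy
  have hsy : 0 < √y := Real.sqrt_pos.2 hy
  have hr : 0 < m / √y := by positivity
  rw [div_le_iff₀ (by positivity)] at h2
  set M := ⌊ε * m * √y / 2⌋₊ with hMdef
  have hMle : (M : ℝ) ≤ ε * m * √y / 2 := Nat.floor_le (by positivity)
  have hMlt : ε * m * √y / 2 < M + 1 := Nat.lt_floor_add_one _
  have hMge : ε * m * √y / 4 ≤ M := by nlinarith
  have hM0 : (0 : ℝ) < M := lt_of_lt_of_le (by positivity) hMge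
  have hM : 0 < M := by exact_mod_cast hM0
  have hyy : √y * √y = y := Real.mul_self_sqrt hy.le
  refine ⟨lines M (m / √y), ?_, fun φ G h hv => ?_⟩
  · have c1 : ((lines M (m / √y)).card : ℝ) ≤ M * ((⌈1 / (m / √y)⌉₊ + 1 : ℕ) : ℝ) := by
      exact_mod_cast card_lines_le M (m / √y)
    calc _ ≤ _ := c1
      _ ≤ (ε * m * √y / 2) * (2 / (m / √y)) := by
        gcongr
        exact ceil_inv_le hr h1
      _ = ε * (√y * √y) := by field_simp
      _ = ε * y := by rw [hyy]
  · refine (poincare_lines hM hr h hv).trans ?_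
    refine mul_le_mul_of_nonneg_right ?_ (integral_nonneg fun x => sq_nonneg _)
    rw [div_div, ← one_div, div_le_div_iff₀ (by positivity) (by positivity)]
    have := pow_le_pow_left₀ (by positivity) hMge 2
    calc 1 * ((ε * m) ^ 2 * y) = (ε * m) ^ 2 * (√y * √y) := by rw [hyy]; ring
      _ = 16 * (ε * m * √y / 4) ^ 2 := by ring
      _ ≤ 16 * (M : ℝ) ^ 2 := by gcongr

/-- A small proportion of the balls covers a boundary layer. -/
lemma exists_boundary_budget {ε m : ℝ} (hε : 0 < ε) (hm : 0 < m) :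
    ∀ᶠ y : ℝ in atTop, ∃ S : Finset Plane, (S.card : ℝ) ≤ ε * y ∧
      ∀ x ∈ unitSquare, x ∉ balls S (m / √y) → ∀ i, m / √y < x i ∧ x i < 1 - m / √y := by
  classical
  have h1 : ∀ᶠ y : ℝ in atTop, m / √y ≤ 1 / 2 :=
    (tendsto_div_sqrt m).eventually_le_const (by norm_num)
  have h2 : ∀ᶠ y : ℝ in atTop, 8 / (ε * m) ≤ √y :=
    Real.tendsto_sqrt_atTop.eventually_ge_atTop _
  filter_upwards [h1, h2, eventually_gt_atTop 0] with y h1 h2 hy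
  have hsy : 0 < √y := Real.sqrt_pos.2 hy
  have hr : 0 < m / √y := by positivity
  rw [div_le_iff₀ (by positivity)] at h2
  have hyy : √y * √y = y := Real.mul_self_sqrt hy.le
  set r := m / √y with hrdef
  refine ⟨(column (r / 2) r ∪ column (1 - r / 2) r) ∪ (row (r / 2) r ∪ row (1 - r / 2) r),
    ?_, ?_⟩
  · have c : ((column (r / 2) r ∪ column (1 - r / 2) r) ∪
        (row (r / 2) r ∪ row (1 - r / 2) r)).card ≤ 4 * (⌈1 / r⌉₊ + 1) := by
      have u1 := Finset.card_union_le (column (r / 2) r ∪ column (1 - r / 2) r)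
        (row (r / 2) r ∪ row (1 - r / 2) r)
      have u2 := Finset.card_union_le (column (r / 2) r) (column (1 - r / 2) r)
      have u3 := Finset.card_union_le (row (r / 2) r) (row (1 - r / 2) r)
      have u4 := card_column_le (r / 2) r
      have u5 := card_column_le (1 - r / 2) r
      have u6 := card_row_le (r / 2) r
      have u7 := card_row_le (1 - r / 2) r
      omega
    have c' : (((column (r / 2) r ∪ column (1 - r / 2) r) ∪
        (row (r / 2) r ∪ row (1 - r / 2) r)).card : ℝ) ≤ 4 * ((⌈1 / r⌉₊ + 1 : ℕ) : ℝ) := by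
      exact_mod_cast c
    refine c'.trans ?_
    calc 4 * ((⌈1 / r⌉₊ + 1 : ℕ) : ℝ) ≤ 4 * (2 / r) := by
          gcongr; exact ceil_inv_le hr h1
      _ = 8 * √y / m := by rw [hrdef]; field_simp; ring
      _ ≤ ε * (√y * √y) := by
          rw [div_le_iff₀ hm]; nlinarith
      _ = ε * y := by rw [hyy]
  · intro x hx hnot
    have n1 : x ∉ balls (column (r / 2) r) r := fun hh => hnot
      (balls_mono (Finset.subset_union_left.trans Finset.subset_union_left) le_rfl hh)
    have n2 : x ∉ balls (column (1 - r / 2) r) r := fun hh => hnot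
      (balls_mono (Finset.subset_union_right.trans Finset.subset_union_left) le_rfl hh)
    have n3 : x ∉ balls (row (r / 2) r) r := fun hh => hnot
      (balls_mono (Finset.subset_union_left.trans Finset.subset_union_right) le_rfl hh)
    have n4 : x ∉ balls (row (1 - r / 2) r) r := fun hh => hnot
      (balls_mono (Finset.subset_union_right.trans Finset.subset_union_right) le_rfl hh)
    have hx0 := hx 0
    have hx1 := hx 1
    rw [Fin.forall_fin_two]
    refine ⟨⟨?_, ?_⟩, ?_, ?_⟩ <;> by_contra hc <;> rw [not_lt] at hc
    · exact n1 (mem_balls_column hr (abs_le.2 ⟨by linarith [hx0.1], by linarith⟩) hx1.1.le hx1.2.le)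
    · exact n2 (mem_balls_column hr (abs_le.2 ⟨by linarith, by linarith [hx0.2]⟩) hx1.1.le hx1.2.le)
    · exact n3 (mem_balls_row hr (abs_le.2 ⟨by linarith [hx1.1], by linarith⟩) hx0.1.le hx0.2.le)
    · exact n4 (mem_balls_row hr (abs_le.2 ⟨by linarith, by linarith [hx1.2]⟩) hx0.1.le hx0.2.le)

/-! ### The optimal compliance in the unit square -/

/-- The closed unit square. -/
def closedSquare : Set Plane := {x | ∀ i, x i ∈ Set.Icc (0 : ℝ) 1}

/-- The projection onto the closed unit square. -/
def clampSquare (x : Plane) : Plane := !₂[max 0 (min 1 (x 0)), max 0 (min 1 (x 1))]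

lemma clampSquare_mem (x : Plane) : clampSquare x ∈ closedSquare := by
  intro i
  fin_cases i <;> simp [clampSquare]

lemma abs_sub_clamp_le {z t : ℝ} (h0 : 0 ≤ z) (h1 : z ≤ 1) :
    |z - max 0 (min 1 t)| ≤ |z - t| := by
  rcases le_total t 0 with h | h
  · rw [min_eq_right (h.trans zero_le_one), max_eq_left h, sub_zero, abs_of_nonneg h0,
      abs_of_nonneg (by linarith)]
    linarith
  · rcases le_total t 1 with h' | h'
    · rw [min_eq_right h', max_eq_right h]
    · rw [min_eq_left h', max_eq_right zero_le_one, abs_of_nonpos (by linarith),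
        abs_of_nonpos (by linarith)]
      linarith

lemma dist_clampSquare_le {z : Plane} (hz : z ∈ unitSquare) (x : Plane) :
    dist z (clampSquare x) ≤ dist z x :=
  dist_le_of_coord (by simpa [clampSquare] using abs_sub_clamp_le (hz 0).1.le (hz 0).2.le)
    (by simpa [clampSquare] using abs_sub_clamp_le (hz 1).1.le (hz 1).2.le)

lemma closedSquare_subset_closure : closedSquare ⊆ closure unitSquare := by
  intro x hx
  have hlim : Tendsto (fun n : ℕ => (1 - 1 / ((n : ℝ) + 1)) • x +
      (1 / ((n : ℝ) + 1)) • (!₂[1 / 2, 1 / 2] : Plane)) atTop (𝓝 x) := by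
    have h1 := tendsto_one_div_add_atTop_nhds_zero_nat (𝕜 := ℝ)
    have h2 := ((tendsto_const_nhds (x := (1 : ℝ))).sub h1).smul_const x
    have h3 := h1.smul_const (!₂[1 / 2, 1 / 2] : Plane)
    simpa using h2.add h3
  refine mem_closure_of_tendsto hlim (Eventually.of_forall fun n i => ?_)
  have hn : 0 < 1 / ((n : ℝ) + 1) := by positivity
  have hn1 : 1 / ((n : ℝ) + 1) ≤ 1 := by
    rw [div_le_one (by positivity)]
    have : (0 : ℝ) ≤ n := Nat.cast_nonneg n
    linarith
  have hxi := hx i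
  have e : ((1 - 1 / ((n : ℝ) + 1)) • x +
      (1 / ((n : ℝ) + 1)) • (!₂[1 / 2, 1 / 2] : Plane)) i
      = (1 - 1 / ((n : ℝ) + 1)) * x i + 1 / ((n : ℝ) + 1) * (1 / 2) := by
    fin_cases i <;> simp
  rw [e]
  constructor
  · nlinarith [mul_nonneg (sub_nonneg.2 hn1) hxi.1]
  · nlinarith [mul_le_mul_of_nonneg_left hxi.2 (sub_nonneg.2 hn1)]

lemma exists_clamped (S : Finset Plane) : ∃ S' : Finset Plane, S'.card ≤ S.card ∧
    (∀ x ∈ S', x ∈ closedSquare) ∧ ∀ r, unitSquare ∩ balls S r ⊆ balls S' r := by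
  classical
  refine ⟨S.image clampSquare, Finset.card_image_le, ?_, ?_⟩
  · intro x hx
    obtain ⟨y, -, rfl⟩ := Finset.mem_image.1 hx
    exact clampSquare_mem y
  · rintro r z ⟨hz, hzb⟩
    obtain ⟨x, hx, hd⟩ := mem_balls.1 hzb
    exact mem_balls.2 ⟨_, Finset.mem_image_of_mem _ hx, (dist_clampSquare_le hz x).trans hd⟩

lemma exists_enumeration (S : Finset Plane) {n : ℕ} (h : S.card ≤ n) (p : Plane) :
    ∃ x : Fin n → Plane, (∀ z ∈ S, ∃ i, x i = z) ∧ ∀ i, x i ∈ S ∨ x i = p := by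
  refine ⟨fun i => S.toList.getD i p, fun z hz => ?_, fun i => ?_⟩
  · obtain ⟨k, hk, rfl⟩ := List.getElem_of_mem (Finset.mem_toList.2 hz)
    have hk' : k < n := by
      rw [Finset.length_toList] at hk
      exact hk.trans_le h
    exact ⟨⟨k, hk'⟩, List.getD_eq_getElem _ _ hk⟩
  · rcases lt_or_ge (i : ℕ) S.toList.length with hi | hi
    · left
      change S.toList.getD i p ∈ S
      rw [List.getD_eq_getElem _ _ hi]
      exact Finset.mem_toList.1 (List.getElem_mem hi)
    · right
      exact List.getD_eq_default _ _ hi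

/-- The least compliance of at most `N` balls of radius `r` in the unit square. -/
def cost (α s : ℝ) (N : ℕ) (r : ℝ) : ℝ≥0∞ :=
  ⨅ (S : Finset Plane) (_ : S.card ≤ N), cpl α s unitSquare (balls S r) fun _ => 1

lemma cost_le {α s : ℝ} {N : ℕ} {r : ℝ} {S : Finset Plane} (h : S.card ≤ N) :
    cost α s N r ≤ cpl α s unitSquare (balls S r) fun _ => 1 :=
  iInf₂_le S h

lemma exists_of_cost_lt {α s : ℝ} {N : ℕ} {r : ℝ} {c : ℝ≥0∞} (h : cost α s N r < c) :
    ∃ S : Finset Plane, S.card ≤ N ∧ (cpl α s unitSquare (balls S r) fun _ => 1) < c := by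
  simpa [cost, iInf_lt_iff] using h

lemma cost_mono {α s s' : ℝ} (hs : s ≤ s') {N N' : ℕ} (hN : N ≤ N') {r r' : ℝ} (hr : r ≤ r') :
    cost α s' N' r' ≤ cost α s N r := by
  refine le_iInf₂ fun S hS => (cost_le (hS.trans hN)).trans ((cpl_mono_mass hs).trans ?_)
  exact cpl_mono_set (Set.inter_subset_right.trans (balls_mono subset_rfl hr))

lemma volume_unitSquare_ne_top : volume unitSquare ≠ ⊤ :=
  (unitSquare_eq_rect ▸ isBounded_rect 0 1 0 1).measure_lt_top.ne

lemma memLp_const_unitSquare (c : ℝ) :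
    MemLp (fun _ : Plane => c) 2 (volume.restrict unitSquare) := by
  have : IsFiniteMeasure (volume.restrict unitSquare) :=
    ⟨by simpa using volume_unitSquare_ne_top.lt_top⟩
  exact memLp_const c

lemma rescaledCompliance_pixelSet {α : ℝ} (hα : 0 < α) {D : Set Plane} {g : Plane → ℝ}
    (hg : MemLp g 2 (volume.restrict D)) (m : ℝ) (n : ℕ) (x : Fin n → Plane) :
    rescaledCompliance α D g n (pixelSet D m n x) =
      n * cpl α 1 D (balls (Finset.univ.image x) (radius m n)) g := by
  have hmem : ∀ z, z ∈ balls (Finset.univ.image x) (radius m n) ↔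
      z ∈ ⋃ i, Metric.closedBall (x i) (radius m n) := fun z => by simp [mem_balls]
  have hK : MeasurableSet (pixelSet D m n x) :=
    isClosed_closure.measurableSet.inter
      (MeasurableSet.iUnion fun i => Metric.isClosed_closedBall.measurableSet)
  rw [rescaledCompliance_eq hα hK hg]
  congr 1
  refine le_antisymm (cpl_mono_set fun z hz => ?_) (cpl_mono_set fun z hz => ?_)
  · exact ⟨subset_closure hz.1, (hmem z).1 hz.2⟩
  · exact (hmem z).2 hz.2.2

lemma frequently_cost_lt_of_theta_lt {α : ℝ} (hα : 0 < α) {t : ℝ} {c : ℝ≥0∞}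
    (h : theta α t < c) : ∃ᶠ N : ℕ in atTop, N * cost α 1 N (t / √N) < c := by
  simp only [theta, iInf_lt_iff] at h
  obtain ⟨x, -, hx⟩ := h
  refine (frequently_lt_of_liminf_lt (by isBoundedDefault) hx).mono fun N hN => ?_
  rw [rescaledCompliance_pixelSet hα (memLp_const_unitSquare 1)] at hN
  refine lt_of_le_of_lt (mul_le_mul_right (cost_le ?_) _) hN
  exact Finset.card_image_le.trans (by simp)

lemma eventually_le_cost_of_lt_theta {α : ℝ} (hα : 0 < α) {t : ℝ} (ht : 0 < t) {c : ℝ≥0∞}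
    (h : c < theta α t) : ∀ᶠ N : ℕ in atTop, c ≤ N * cost α 1 N (t / √N) := by
  by_contra hcon
  rw [not_eventually] at hcon
  have hex : ∀ N : ℕ, ∃ x : Fin N → Plane, AdmissibleCentres unitSquare t N x ∧
      (0 < N → ¬ c ≤ N * cost α 1 N (t / √N) →
        rescaledCompliance α unitSquare (fun _ => 1) N (pixelSet unitSquare t N x) ≤ c) := by
    intro N
    rcases Nat.eq_zero_or_pos N with rfl | hN
    · exact ⟨fun i => i.elim0, fun i => i.elim0, fun h => absurd h (lt_irrefl 0)⟩
    have hNR : (0 : ℝ) < N := by exact_mod_cast hN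
    have hr : 0 < radius t N := div_pos ht (Real.sqrt_pos.2 hNR)
    have hadm : ∀ p ∈ closedSquare, p ∈ Metric.thickening (radius t N) unitSquare := fun p hp =>
      Metric.closure_subset_thickening hr _ (closedSquare_subset_closure hp)
    have h0 : clampSquare 0 ∈ closedSquare := clampSquare_mem 0
    by_cases hc : c ≤ N * cost α 1 N (t / √N)
    · exact ⟨fun _ => clampSquare 0, fun _ => hadm _ h0, fun _ h => absurd hc h⟩
    · have hlt : cost α 1 N (t / √N) < c / N := by
        rw [ENNReal.lt_div_iff_mul_lt (Or.inl (by exact_mod_cast hN.ne')) (Or.inl (by simp)),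
          mul_comm]
        exact not_le.1 hc
      obtain ⟨S, hS, hSc⟩ := exists_of_cost_lt hlt
      obtain ⟨S', hS'c, hS'm, hS'b⟩ := exists_clamped S
      obtain ⟨x, hx1, hx2⟩ := exists_enumeration S' (hS'c.trans hS) (clampSquare 0)
      refine ⟨x, fun i => ?_, fun _ _ => ?_⟩
      · rcases hx2 i with h | h
        · exact hadm _ (hS'm _ h)
        · rw [h]; exact hadm _ h0
      · rw [rescaledCompliance_pixelSet hα (memLp_const_unitSquare 1)]
        have h1 : cpl α 1 unitSquare (balls (Finset.univ.image x) (radius t N)) (fun _ => 1) ≤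
            cpl α 1 unitSquare (balls S (t / √N)) fun _ => 1 := by
          refine cpl_mono_set fun z hz => ?_
          refine balls_mono (fun p hp => ?_) le_rfl (hS'b _ hz)
          obtain ⟨i, hi⟩ := hx1 p hp
          exact Finset.mem_image.2 ⟨i, Finset.mem_univ _, hi⟩
        calc _ ≤ (N : ℝ≥0∞) * (c / N) := mul_le_mul_right (h1.trans hSc.le) _
          _ ≤ c := ENNReal.mul_div_le
  choose x hx using hex
  have hle : theta α t ≤ liminf (fun n : ℕ => rescaledCompliance α unitSquare (fun _ => 1) n
      (pixelSet unitSquare t n (x n))) atTop :=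
    iInf₂_le x fun n => (hx n).1
  have hle2 : liminf (fun n : ℕ => rescaledCompliance α unitSquare (fun _ => 1) n
      (pixelSet unitSquare t n (x n))) atTop ≤ c := by
    refine liminf_le_of_frequently_le' ?_
    exact (hcon.and_eventually (eventually_gt_atTop 0)).mono fun N hN => (hx N).2 hN.2 hN.1
  exact absurd (h.trans_le (hle.trans hle2)) (lt_irrefl c)

/-! ### Grids of squares -/

/-- Open squares. -/
def openSq (p : Plane) (ℓ : ℝ) : Set Plane := {x | ∀ i, x i ∈ Set.Ioo (p i) (p i + ℓ)}

lemma openSq_eq_rect (p : Plane) (ℓ : ℝ) : openSq p ℓ = rect (p 0) (p 0 + ℓ) (p 1) (p 1 + ℓ) := by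
  ext x
  simp [openSq, rect, Fin.forall_fin_two]

lemma isOpen_openSq (p : Plane) (ℓ : ℝ) : IsOpen (openSq p ℓ) :=
  openSq_eq_rect p ℓ ▸ isOpen_rect _ _ _ _

lemma aff_apply (p : Plane) (ℓ : ℝ) (x : Plane) (i : Fin 2) : aff p ℓ x i = p i + ℓ * x i := by
  simp [aff]

lemma preimage_aff_openSq (p : Plane) {ℓ : ℝ} (hℓ : 0 < ℓ) :
    aff p ℓ ⁻¹' openSq p ℓ = unitSquare := by
  ext x
  simp only [openSq, unitSquare, Set.mem_preimage, Set.mem_ofPred_eq, aff_apply, Set.mem_Ioo]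
  refine forall_congr' fun i => ?_
  constructor
  · rintro ⟨h1, h2⟩
    constructor <;> nlinarith
  · rintro ⟨h1, h2⟩
    constructor <;> nlinarith

lemma dist_aff (p : Plane) {ℓ : ℝ} (hℓ : 0 ≤ ℓ) (x y : Plane) :
    dist (aff p ℓ x) (aff p ℓ y) = ℓ * dist x y := by
  simp [aff, dist_smul₀, abs_of_nonneg hℓ]

lemma preimage_aff_balls (p : Plane) {ℓ : ℝ} (hℓ : 0 < ℓ) (S : Finset Plane) (r : ℝ) :
    aff p ℓ ⁻¹' balls (S.image (aff p ℓ)) r = balls S (r / ℓ) := by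
  ext x
  simp only [Set.mem_preimage, mem_balls, Finset.exists_mem_image, dist_aff p hℓ.le,
    le_div_iff₀ hℓ, mul_comm ℓ]

lemma cpl_openSq (α s : ℝ) (p : Plane) {ℓ : ℝ} (hℓ : 0 < ℓ) (S : Finset Plane) (r : ℝ)
    (g : Plane → ℝ) :
    cpl α s (openSq p ℓ) (balls (S.image (aff p ℓ)) r) g =
      ENNReal.ofReal (ℓ ^ 4) * cpl α (s * ℓ ^ 2) unitSquare (balls S (r / ℓ))
        fun x => g (aff p ℓ x) := by
  rw [cpl_comp_aff α s _ _ g p hℓ, preimage_aff_openSq p hℓ, preimage_aff_balls p hℓ]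

/-- The lower left corner of a square of the grid. -/
def corner (ℓ : ℝ) (z : ℤ × ℤ) : Plane := !₂[ℓ * z.1, ℓ * z.2]

/-- The open squares of the grid. -/
def cell (ℓ : ℝ) (z : ℤ × ℤ) : Set Plane := openSq (corner ℓ z) ℓ

/-- The half-open square of the grid containing a given point. -/
def index (ℓ : ℝ) (x : Plane) : ℤ × ℤ := (⌊x 0 / ℓ⌋, ⌊x 1 / ℓ⌋)

lemma floor_div_eq_iff {ℓ : ℝ} (hℓ : 0 < ℓ) {t : ℝ} {n : ℤ} :
    ⌊t / ℓ⌋ = n ↔ ℓ * n ≤ t ∧ t < ℓ * n + ℓ := by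
  rw [Int.floor_eq_iff, le_div_iff₀ hℓ, div_lt_iff₀ hℓ]
  constructor <;> rintro ⟨h1, h2⟩ <;> constructor <;> nlinarith

lemma index_eq_iff {ℓ : ℝ} (hℓ : 0 < ℓ) {x : Plane} {z : ℤ × ℤ} :
    index ℓ x = z ↔ ∀ i, corner ℓ z i ≤ x i ∧ x i < corner ℓ z i + ℓ := by
  rw [index, Prod.ext_iff, Fin.forall_fin_two]
  simp only [floor_div_eq_iff hℓ, corner]
  rfl

lemma index_of_mem_cell {ℓ : ℝ} (hℓ : 0 < ℓ) {x : Plane} {z : ℤ × ℤ} (h : x ∈ cell ℓ z) :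
    index ℓ x = z :=
  (index_eq_iff hℓ).2 fun i => ⟨(h i).1.le, (h i).2⟩

lemma pairwiseDisjoint_cell {ℓ : ℝ} (hℓ : 0 < ℓ) (s : Set (ℤ × ℤ)) :
    s.PairwiseDisjoint (cell ℓ) := fun _ _ _ _ hne =>
  Set.disjoint_left.2 fun _ hx hx' =>
    hne ((index_of_mem_cell hℓ hx).symm.trans (index_of_mem_cell hℓ hx'))

lemma ae_coord_ne (i : Fin 2) (c : ℝ) : ∀ᵐ x : Plane, x i ≠ c := by
  have h : ∀ᵐ f : Fin 2 → ℝ, f i ≠ c := by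
    rw [ae_iff, volume_pi]
    simpa using Measure.pi_hyperplane (fun _ : Fin 2 => (volume : Measure ℝ)) i c
  exact (PiLp.volume_preserving_ofLp (Fin 2)).quasiMeasurePreserving.ae h

lemma ae_mem_cell_index {ℓ : ℝ} (hℓ : 0 < ℓ) : ∀ᵐ x : Plane, x ∈ cell ℓ (index ℓ x) := by
  have h : ∀ᵐ x : Plane, ∀ i : Fin 2, ∀ n : ℤ, x i ≠ ℓ * n := by
    rw [ae_all_iff]; intro i
    rw [ae_all_iff]; intro n
    exact ae_coord_ne i _
  filter_upwards [h] with x hx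
  have h1 := (index_eq_iff hℓ).1 (rfl : index ℓ x = index ℓ x)
  intro i
  refine ⟨lt_of_le_of_ne (h1 i).1 ?_, (h1 i).2⟩
  fin_cases i
  · exact (hx 0 _).symm
  · exact (hx 1 _).symm

/-- The indices of the squares of side `1 / k` in the unit square. -/
def tiles (k : ℕ) : Finset (ℤ × ℤ) := Finset.Ico (0 : ℤ) k ×ˢ Finset.Ico (0 : ℤ) k

lemma card_tiles (k : ℕ) : (tiles k).card = k ^ 2 := by
  simp [tiles, pow_two]

lemma mem_tiles {k : ℕ} {z : ℤ × ℤ} :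
    z ∈ tiles k ↔ (0 ≤ z.1 ∧ z.1 < k) ∧ (0 ≤ z.2 ∧ z.2 < k) := by
  simp [tiles]

lemma cell_subset_unitSquare {k : ℕ} (hk : 0 < k) {z : ℤ × ℤ} (hz : z ∈ tiles k) :
    cell (k : ℝ)⁻¹ z ⊆ unitSquare := by
  have hk' : (0 : ℝ) < k := by exact_mod_cast hk
  obtain ⟨⟨a1, a2⟩, b1, b2⟩ := mem_tiles.1 hz
  have a1' : (0 : ℝ) ≤ z.1 := by exact_mod_cast a1
  have b1' : (0 : ℝ) ≤ z.2 := by exact_mod_cast b1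
  have a2' : (z.1 : ℝ) + 1 ≤ k := by exact_mod_cast a2
  have b2' : (z.2 : ℝ) + 1 ≤ k := by exact_mod_cast b2
  have hi : (k : ℝ)⁻¹ * k = 1 := inv_mul_cancel₀ hk'.ne'
  have hp : 0 < (k : ℝ)⁻¹ := by positivity
  intro x hx
  rw [unitSquare, Set.mem_ofPred_eq, Fin.forall_fin_two]
  have hx0 := hx 0
  have hx1 := hx 1
  simp only [corner, Set.mem_Ioo] at hx0 hx1
  simp at hx0 hx1
  refine ⟨⟨?_, ?_⟩, ?_, ?_⟩
  · exact lt_of_le_of_lt (mul_nonneg hp.le a1') hx0.1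
  · nlinarith [hx0.2]
  · exact lt_of_le_of_lt (mul_nonneg hp.le b1') hx1.1
  · nlinarith [hx1.2]

lemma index_mem_tiles {k : ℕ} (hk : 0 < k) {x : Plane} (hx : x ∈ unitSquare) :
    index (k : ℝ)⁻¹ x ∈ tiles k := by
  have hk' : (0 : ℝ) < k := by exact_mod_cast hk
  rw [mem_tiles]
  simp only [index, div_inv_eq_mul]
  have h0 := hx 0
  have h1 := hx 1
  refine ⟨⟨Int.floor_nonneg.2 (mul_nonneg h0.1.le hk'.le), Int.floor_lt.2 ?_⟩,
    Int.floor_nonneg.2 (mul_nonneg h1.1.le hk'.le), Int.floor_lt.2 ?_⟩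
  · push_cast; nlinarith [h0.2]
  · push_cast; nlinarith [h1.2]

lemma exists_cpl_le_cost_add {α s : ℝ} (N : ℕ) (r : ℝ) {ε : ℝ≥0∞} (hε : ε ≠ 0) :
    ∃ S : Finset Plane, S.card ≤ N ∧
      (cpl α s unitSquare (balls S r) fun _ => 1) ≤ cost α s N r + ε := by
  rcases eq_or_ne (cost α s N r) ⊤ with h | h
  · exact ⟨∅, by simp, by simp [h]⟩
  · obtain ⟨S, h1, h2⟩ := exists_of_cost_lt (ENNReal.lt_add_right h hε)
    exact ⟨S, h1, h2.le⟩

lemma cost_tile_le {α : ℝ} (hα : 0 ≤ α) {k : ℕ} (hk : 0 < k) (N : ℤ × ℤ → ℕ) (r : ℝ) :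
    cost α 0 (∑ z ∈ tiles k, N z) r ≤
      ∑ z ∈ tiles k, ENNReal.ofReal ((k : ℝ)⁻¹ ^ 4) * cost α 0 (N z) (k * r) := by
  classical
  have hk' : (0 : ℝ) < k := by exact_mod_cast hk
  set ℓ : ℝ := (k : ℝ)⁻¹ with hℓ
  have hℓ0 : 0 < ℓ := by positivity
  have key : ∀ ε : ℝ≥0∞, ε ≠ 0 → cost α 0 (∑ z ∈ tiles k, N z) r ≤
      ∑ z ∈ tiles k, ENNReal.ofReal (ℓ ^ 4) * (cost α 0 (N z) (k * r) + ε) := by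
    intro ε hε
    choose S hS1 hS2 using fun z => exists_cpl_le_cost_add (α := α) (s := 0) (N z) (k * r) hε
    set T : Finset Plane := (tiles k).biUnion fun z => (S z).image (aff (corner ℓ z) ℓ) with hT
    have hcard : T.card ≤ ∑ z ∈ tiles k, N z :=
      Finset.card_biUnion_le.trans (Finset.sum_le_sum fun z _ =>
        Finset.card_image_le.trans (hS1 z))
    refine (cost_le hcard).trans ?_
    have hcov : ∀ᵐ x ∂volume.restrict unitSquare, x ∉ ⋃ z ∈ tiles k, cell ℓ z → x ∈ balls T r := by
      filter_upwards [ae_restrict_of_ae (ae_mem_cell_index hℓ0),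
        ae_restrict_mem isOpen_unitSquare.measurableSet] with x hx hxQ hnot
      exact absurd (Set.mem_iUnion₂.2 ⟨_, index_mem_tiles hk hxQ, hx⟩) hnot
    refine (cpl_le_sum isOpen_unitSquare.measurableSet (measurableSet_balls _ _)
      (fun z _ => (isOpen_openSq _ _).measurableSet)
      (fun z hz => cell_subset_unitSquare hk hz) (pairwiseDisjoint_cell hℓ0 _) hα
      (memLp_const_unitSquare 1) hcov).trans ?_
    refine Finset.sum_le_sum fun z hz => ?_
    have h1 : cpl α 0 (cell ℓ z) (balls T r) (fun _ => 1) ≤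
        cpl α 0 (cell ℓ z) (balls ((S z).image (aff (corner ℓ z) ℓ)) r) fun _ => 1 :=
      cpl_mono_set (Set.inter_subset_right.trans (balls_mono
        (Finset.subset_biUnion_of_mem (fun z => (S z).image (aff (corner ℓ z) ℓ)) hz) le_rfl))
    refine h1.trans ?_
    rw [cell, cpl_openSq α 0 _ hℓ0, zero_mul]
    refine mul_le_mul_right ?_ _
    have e : r / ℓ = k * r := by rw [hℓ, div_inv_eq_mul, mul_comm]
    rw [e]
    exact hS2 z
  simp only [mul_add, Finset.sum_add_distrib] at key
  refine ENNReal.le_of_forall_pos_le_add fun δ hδ _ => ?_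
  set A : ℝ≥0∞ := (k ^ 2 : ℕ) * ENNReal.ofReal (ℓ ^ 4) with hA
  have hA0 : A ≠ 0 := by
    rw [hA]
    refine mul_ne_zero (by positivity) ?_
    rw [Ne, ENNReal.ofReal_eq_zero, not_le]
    positivity
  have hAt : A ≠ ⊤ := ENNReal.mul_ne_top (by simp) ENNReal.ofReal_ne_top
  have := key (δ / A) (ENNReal.div_ne_zero.2 ⟨by exact_mod_cast hδ.ne', hAt⟩)
  rw [Finset.sum_const, card_tiles, nsmul_eq_mul, ← mul_assoc] at this
  refine this.trans (add_le_add le_rfl ?_)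
  exact ENNReal.mul_div_le

/-! ### The energy density -/

/-- The limit energy density `θ(m a^{1/2}) / a` of a density `a` of balls. -/
def density (α m a : ℝ) : ℝ≥0∞ := theta α (m * √a) / ENNReal.ofReal a

section Density

variable {α m : ℝ}

lemma tendsto_floor_mul {a : ℝ} (ha : 0 < a) : Tendsto (fun y : ℝ => ⌊a * y⌋₊) atTop atTop :=
  tendsto_nat_floor_atTop.comp (tendsto_id.const_mul_atTop ha)

lemma eventually_le_of_lt_density (hα : 0 < α) (hm : 0 < m) {a : ℝ} (ha : 0 < a) {c : ℝ≥0∞}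
    (hc : c < density α m a) :
    ∀ᶠ y : ℝ in atTop, c ≤ ENNReal.ofReal y * cost α 1 ⌊a * y⌋₊ (m / √y) := by
  have ha' : ENNReal.ofReal a ≠ 0 := by simpa using ha
  have h1 : c * ENNReal.ofReal a < theta α (m * √a) := by
    rwa [density, ENNReal.lt_div_iff_mul_lt (Or.inl ha') (Or.inl ENNReal.ofReal_ne_top)] at hc
  have h2 := (tendsto_floor_mul ha).eventually (eventually_le_cost_of_lt_theta hα
    (mul_pos hm (Real.sqrt_pos.2 ha)) h1)
  filter_upwards [h2, (tendsto_floor_mul ha).eventually_gt_atTop 0, eventually_gt_atTop 0]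
    with y hy hN hy0
  set N := ⌊a * y⌋₊ with hNdef
  have hNR : (0 : ℝ) < N := by exact_mod_cast hN
  have hNle : (N : ℝ) ≤ a * y := Nat.floor_le (by positivity)
  have hr : m / √y ≤ m * √a / √N := by
    rw [div_le_div_iff₀ (Real.sqrt_pos.2 hy0) (Real.sqrt_pos.2 hNR), mul_assoc,
      ← Real.sqrt_mul ha.le]
    gcongr
  have h3 : c * ENNReal.ofReal a ≤
      (ENNReal.ofReal y * cost α 1 N (m / √y)) * ENNReal.ofReal a := by
    calc c * ENNReal.ofReal a ≤ N * cost α 1 N (m * √a / √N) := hy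
      _ ≤ ENNReal.ofReal (a * y) * cost α 1 N (m / √y) := by
        refine mul_le_mul' ?_ (cost_mono le_rfl le_rfl hr)
        rw [← ENNReal.ofReal_natCast]
        exact ENNReal.ofReal_le_ofReal hNle
      _ = _ := by rw [ENNReal.ofReal_mul ha.le]; ring
  exact (ENNReal.mul_le_mul_iff_left ha' ENNReal.ofReal_ne_top).1 h3

lemma density_le_of_eventually (hα : 0 < α) (hm : 0 < m) {a : ℝ} (ha : 0 < a) {C : ℝ≥0∞}
    (h : ∃ᶠ y : ℝ in atTop, ENNReal.ofReal y * cost α 1 ⌊a * y⌋₊ (m / √y) ≤ C) :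
    density α m a ≤ C := by
  refine le_of_forall_lt fun c hc => ?_
  obtain ⟨c', h1, h2⟩ := exists_between hc
  obtain ⟨y, hy, hy'⟩ := (h.and_eventually (eventually_le_of_lt_density hα hm ha h2)).exists
  exact h1.trans_le (hy'.trans hy)

lemma eventually_le_of_density_lt (hα : 0 < α) (hm : 0 < m) {a a' : ℝ} (ha' : 0 < a')
    (haa : a' < a) {c : ℝ≥0∞} (hc : density α m a' < c) :
    ∀ᶠ y : ℝ in atTop, ENNReal.ofReal y * cost α 0 ⌊a * y⌋₊ (m / √y) ≤ c := by
  classical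
  obtain ⟨c', hc1, hc2⟩ := exists_between hc
  have hc't : c' ≠ ⊤ := (hc2.trans_le le_top).ne
  have hA0 : ENNReal.ofReal a' ≠ 0 := by simpa using ha'
  have hθ : theta α (m * √a') < c' * ENNReal.ofReal a' := by
    rwa [density, ENNReal.div_lt_iff (Or.inl hA0) (Or.inl ENNReal.ofReal_ne_top)] at hc1
  -- the choice of the relative number of additional balls
  obtain ⟨δ, hδ0, hδ⟩ : ∃ δ : ℝ, 0 < δ ∧ (1 + δ) ^ 3 * a' ≤ a := by
    have hlim : Tendsto (fun δ : ℝ => (1 + δ) ^ 3 * a') (𝓝[>] 0) (𝓝 ((1 + 0) ^ 3 * a')) :=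
      ((by fun_prop : Continuous fun δ : ℝ => (1 + δ) ^ 3 * a').tendsto 0).mono_left
        nhdsWithin_le_nhds
    have := (hlim.eventually_le_const (by simpa using haa)).and self_mem_nhdsWithin
    obtain ⟨δ, h1, h2⟩ := this.exists
    exact ⟨δ, h2, h1⟩
  set t := m * √a' with ht
  have ht0 : 0 < t := mul_pos hm (Real.sqrt_pos.2 ha')
  obtain ⟨C, hC0, hC⟩ := exists_lines_budget (ε := δ) (m := t) hδ0 ht0
  have hcast := tendsto_natCast_atTop_atTop (R := ℝ)
  have hfac : ∀ᶠ N : ℕ in atTop, C / N < α ∧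
      ENNReal.ofReal (1 - C / N / α)⁻¹ * c' ≤ c := by
    have l1 : Tendsto (fun N : ℕ => C / (N : ℝ)) atTop (𝓝 0) :=
      tendsto_const_nhds.div_atTop hcast
    have l2 : Tendsto (fun N : ℕ => (1 - C / (N : ℝ) / α)⁻¹) atTop (𝓝 1) := by
      have : Tendsto (fun N : ℕ => (1 - C / (N : ℝ) / α)⁻¹) atTop (𝓝 (1 - 0 / α)⁻¹) :=
        ((tendsto_const_nhds).sub (l1.div_const α)).inv₀ (by simp)
      simpa using this
    have l3 : Tendsto (fun N : ℕ => ENNReal.ofReal (1 - C / (N : ℝ) / α)⁻¹ * c') atTop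
        (𝓝 (1 * c')) := by
      refine ENNReal.Tendsto.mul_const ?_ (Or.inl one_ne_zero)
      simpa using ENNReal.tendsto_ofReal l2
    rw [one_mul] at l3
    exact (l1.eventually_lt_const hα).and (l3.eventually_le_const hc2)
  obtain ⟨N₀, hN₀, ⟨S₁, hS₁c, hS₁p⟩, ⟨hf1, hf2⟩, hN₀pos⟩ :=
    ((frequently_cost_lt_of_theta_lt hα hθ).and_eventually ((hcast.eventually hC).and
      (hfac.and (eventually_gt_atTop 0)))).exists
  have hN₀R : (0 : ℝ) < N₀ := by exact_mod_cast hN₀pos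
  have hN₀E : (N₀ : ℝ≥0∞) ≠ 0 := by exact_mod_cast hN₀pos.ne'
  have hlt : cost α 1 N₀ (t / √N₀) < c' * ENNReal.ofReal a' / N₀ := by
    rw [ENNReal.lt_div_iff_mul_lt (Or.inl hN₀E) (Or.inl (by simp)), mul_comm]
    exact hN₀
  obtain ⟨S₀, hS₀c, hS₀⟩ := exists_of_cost_lt hlt
  set S := S₀ ∪ S₁ with hS
  set N₁ := S.card with hN₁
  have hN₁le : (N₁ : ℝ) ≤ (1 + δ) * N₀ := by
    have h1 : N₁ ≤ S₀.card + S₁.card := Finset.card_union_le _ _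
    have h2 : (N₁ : ℝ) ≤ S₀.card + S₁.card := by exact_mod_cast h1
    have h3 : (S₀.card : ℝ) ≤ N₀ := by exact_mod_cast hS₀c
    linarith
  have hcell : cost α 0 N₁ (t / √N₀) ≤ c * ENNReal.ofReal a' / N₀ := by
    calc cost α 0 N₁ (t / √N₀) ≤ cpl α 0 unitSquare (balls S (t / √N₀)) fun _ => 1 :=
          cost_le le_rfl
      _ ≤ ENNReal.ofReal (1 - C / N₀ / α)⁻¹ *
            cpl α 1 unitSquare (balls S (t / √N₀)) fun _ => 1 := by
          refine cpl_zero_le_of_poincare (by positivity) hf1 fun φ H h h' => hS₁p φ H h ?_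
          exact h'.mono (Set.inter_subset_inter_right _
            (balls_mono Finset.subset_union_right le_rfl))
      _ ≤ ENNReal.ofReal (1 - C / N₀ / α)⁻¹ * (c' * ENNReal.ofReal a' / N₀) := by
          refine mul_le_mul_right (le_trans (cpl_mono_set ?_) hS₀.le) _
          exact Set.inter_subset_right.trans (balls_mono Finset.subset_union_left le_rfl)
      _ = ENNReal.ofReal (1 - C / N₀ / α)⁻¹ * c' * ENNReal.ofReal a' / N₀ := by
          simp only [div_eq_mul_inv]; ring
      _ ≤ _ := by gcongr
  -- tiling
  set q := a' / N₀ with hq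
  have hq0 : 0 < q := by positivity
  have hbig : ∀ᶠ y : ℝ in atTop, 1 ≤ δ * √(y * q) := by
    have : Tendsto (fun y : ℝ => δ * √(y * q)) atTop atTop :=
      (Real.tendsto_sqrt_atTop.comp (tendsto_id.atTop_mul_const hq0)).const_mul_atTop hδ0
    exact this.eventually_ge_atTop 1
  filter_upwards [hbig, eventually_gt_atTop 0] with y hy1 hy0
  set k := ⌈√(y * q)⌉₊ with hk
  have hyq : 0 < y * q := by positivity
  have hsq : 0 < √(y * q) := Real.sqrt_pos.2 hyq
  have hkpos : 0 < k := Nat.ceil_pos.2 hsq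
  have hkR : (0 : ℝ) < k := by exact_mod_cast hkpos
  have hk1 : √(y * q) ≤ k := Nat.le_ceil _
  have hk2 : (k : ℝ) ≤ (1 + δ) * √(y * q) := by
    have := Nat.ceil_lt_add_one hsq.le
    linarith
  have hk3 : y * q ≤ (k : ℝ) ^ 2 := by
    rw [← Real.sq_sqrt hyq.le]; gcongr
  have hk4 : (k : ℝ) ^ 2 ≤ (1 + δ) ^ 2 * (y * q) := by
    calc (k : ℝ) ^ 2 ≤ ((1 + δ) * √(y * q)) ^ 2 := by gcongr
      _ = _ := by rw [mul_pow, Real.sq_sqrt hyq.le]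
  have hcount : ∑ _z ∈ tiles k, N₁ ≤ ⌊a * y⌋₊ := by
    rw [Finset.sum_const, card_tiles, smul_eq_mul]
    refine Nat.le_floor ?_
    push_cast
    calc (k : ℝ) ^ 2 * N₁ ≤ ((1 + δ) ^ 2 * (y * q)) * ((1 + δ) * N₀) := by gcongr
      _ = ((1 + δ) ^ 3 * a') * y := by rw [hq]; field_simp
      _ ≤ a * y := by gcongr
  have hrad : t / √N₀ ≤ k * (m / √y) := by
    have e : t / √N₀ = m * √q := by
      rw [ht, hq, Real.sqrt_div ha'.le, mul_div_assoc]
    have e2 : √(y * q) = √y * √q := Real.sqrt_mul hy0.le q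
    have hsy : 0 < √y := Real.sqrt_pos.2 hy0
    rw [e, mul_div_assoc', le_div_iff₀ hsy]
    nlinarith
  calc ENNReal.ofReal y * cost α 0 ⌊a * y⌋₊ (m / √y)
      ≤ ENNReal.ofReal y * cost α 0 (∑ _z ∈ tiles k, N₁) (m / √y) :=
        mul_le_mul_right (cost_mono le_rfl hcount le_rfl) _
    _ ≤ ENNReal.ofReal y * ∑ _z ∈ tiles k, ENNReal.ofReal ((k : ℝ)⁻¹ ^ 4) *
          cost α 0 N₁ (k * (m / √y)) := mul_le_mul_right (cost_tile_le hα.le hkpos _ _) _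
    _ ≤ ENNReal.ofReal y * ∑ _z ∈ tiles k, ENNReal.ofReal ((k : ℝ)⁻¹ ^ 4) *
          (c * ENNReal.ofReal a' / N₀) := by
        gcongr
        exact (cost_mono le_rfl le_rfl hrad).trans hcell
    _ = ENNReal.ofReal (y * q / k ^ 2) * c := by
        rw [Finset.sum_const, card_tiles, nsmul_eq_mul, ← ENNReal.ofReal_natCast,
          ← ENNReal.ofReal_natCast N₀, div_eq_mul_inv, ← ENNReal.ofReal_inv_of_pos hN₀R]
        have e : y * q / (k : ℝ) ^ 2 = y * (((k ^ 2 : ℕ) : ℝ) * ((k : ℝ)⁻¹ ^ 4 * (a' * (N₀ : ℝ)⁻¹)))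
            := by
          rw [hq]; push_cast; field_simp
        rw [e, ENNReal.ofReal_mul hy0.le, ENNReal.ofReal_mul (by positivity),
          ENNReal.ofReal_mul (by positivity), ENNReal.ofReal_mul ha'.le]
        ring
    _ ≤ 1 * c := by
        gcongr
        rw [ENNReal.ofReal_le_one, div_le_one (by positivity)]
        exact hk3
    _ = c := one_mul c

lemma density_anti (hα : 0 < α) (hm : 0 < m) {a a' : ℝ} (ha' : 0 < a') (haa : a' ≤ a) :
    density α m a ≤ density α m a' := by
  rcases haa.eq_or_lt with rfl | hlt
  · exact le_rfl
  refine le_of_forall_gt fun c hc => ?_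
  obtain ⟨c', h1, h2⟩ := exists_between hc
  refine lt_of_le_of_lt (density_le_of_eventually hα hm (ha'.trans hlt) ?_) h2
  refine Eventually.frequently ?_
  filter_upwards [eventually_le_of_density_lt hα hm ha' hlt h1] with y hy
  exact (mul_le_mul_right (cost_mono zero_le_one le_rfl le_rfl) _).trans hy

lemma density_ne_top (hα : 0 < α) (hm : 0 < m) {a : ℝ} (ha : 0 < a) : density α m a ≠ ⊤ := by
  obtain ⟨C, hC0, hC⟩ := exists_lines_budget (ε := a) (m := m) ha hm
  refine ne_top_of_le_ne_top (b := ENNReal.ofReal (C / α * ∫ _x in unitSquare, (1 : ℝ) ^ 2))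
    ENNReal.ofReal_ne_top (density_le_of_eventually hα hm ha (Eventually.frequently ?_))
  filter_upwards [hC, eventually_gt_atTop 0] with y ⟨S, hS1, hS2⟩ hy
  calc ENNReal.ofReal y * cost α 1 ⌊a * y⌋₊ (m / √y)
      ≤ ENNReal.ofReal y * ENNReal.ofReal (C / y / α * ∫ _x in unitSquare, (1 : ℝ) ^ 2) := by
        refine mul_le_mul_right ((cost_mono zero_le_one le_rfl le_rfl).trans
          ((cost_le (Nat.le_floor hS1)).trans ?_)) _
        exact cpl_le_of_poincare hα (by positivity) (memLp_const_unitSquare 1) hS2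
    _ = _ := by
        rw [← ENNReal.ofReal_mul hy.le]
        congr 1
        field_simp

/-- Mixing two densities. -/
lemma density_le_add (hα : 0 < α) (hm : 0 < m) {a b : ℝ} (ha : 0 < a) (hb : 0 < b) {k : ℕ}
    (hk : 2 ≤ k) (hab : b * ((k : ℝ) ^ 2 - 1) < a * ((k : ℝ) ^ 2 - 1 / 2)) :
    density α m a ≤ density α m b + density α m (a / 4) / (k ^ 2 : ℕ) := by
  have hkR : (2 : ℝ) ≤ k := by exact_mod_cast hk
  have hk0 : (0 : ℝ) < k := by linarith
  have hk1 : 0 < (k : ℝ) ^ 2 - 1 := by nlinarith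
  have hkE : ((k ^ 2 : ℕ) : ℝ≥0∞) ≠ 0 := by exact_mod_cast (pow_pos (by omega : 0 < k) 2).ne'
  obtain ⟨b', hb1, hb2⟩ := exists_between ((lt_div_iff₀ hk1).2 hab)
  rw [lt_div_iff₀ hk1] at hb2
  have hb'0 : 0 < b' := hb.trans hb1
  have key : ∀ c₁ c₂ : ℝ≥0∞, density α m b < c₁ → density α m (a / 4) < c₂ →
      density α m a ≤ c₁ + c₂ / (k ^ 2 : ℕ) := by
    intro c₁ c₂ h1 h2
    have E1 := eventually_le_of_density_lt hα hm hb hb1 h1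
    have E2 := eventually_le_of_density_lt hα hm (a := a / 2) (by positivity) (by linarith) h2
    refine density_le_of_eventually hα hm ha (Eventually.frequently ?_)
    have hlim : Tendsto (fun y : ℝ => y / (k : ℝ) ^ 2) atTop atTop :=
      tendsto_id.atTop_div_const (by positivity)
    filter_upwards [hlim.eventually E1, hlim.eventually E2, eventually_gt_atTop 0]
      with y h1 h2 hy
    set y' := y / (k : ℝ) ^ 2 with hy'
    have hy'0 : 0 < y' := by positivity
    set N : ℤ × ℤ → ℕ := fun z => if z = (0, 0) then ⌊a / 2 * y'⌋₊ else ⌊b' * y'⌋₊ with hN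
    have h0 : ((0, 0) : ℤ × ℤ) ∈ tiles k := mem_tiles.2 (by simp; omega)
    have hcard : ((tiles k).erase (0, 0)).card = k ^ 2 - 1 := by
      rw [Finset.card_erase_of_mem h0, card_tiles]
    have hk2 : 1 ≤ k ^ 2 := Nat.one_le_pow _ _ (by omega)
    have hcount : ∑ z ∈ tiles k, N z ≤ ⌊a * y⌋₊ := by
      refine Nat.le_floor ?_
      have e : ∑ z ∈ tiles k, N z = ⌊a / 2 * y'⌋₊ + (k ^ 2 - 1) * ⌊b' * y'⌋₊ := by
        rw [← Finset.add_sum_erase _ _ h0, Finset.sum_congr rfl (g := fun _ => ⌊b' * y'⌋₊),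
          Finset.sum_const, hcard, smul_eq_mul]
        · simp [hN]
        · intro z hz
          simp [hN, (Finset.mem_erase.1 hz).1]
      rw [e]
      push_cast [Nat.cast_sub hk2]
      have f1 := Nat.floor_le (a := a / 2 * y') (by positivity)
      have f2 := Nat.floor_le (a := b' * y') (by positivity)
      have f3 : ((k : ℝ) ^ 2 - 1) * ⌊b' * y'⌋₊ ≤ ((k : ℝ) ^ 2 - 1) * (b' * y') :=
        mul_le_mul_of_nonneg_left f2 hk1.le
      have f4 : y = y' * (k : ℝ) ^ 2 := by rw [hy']; field_simp
      rw [f4]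
      nlinarith [mul_le_mul_of_nonneg_right hb2.le hy'0.le]
    have hrad : (k : ℝ) * (m / √y) = m / √y' := by
      rw [hy', Real.sqrt_div hy.le, Real.sqrt_sq hk0.le]
      field_simp
    have hyk : ENNReal.ofReal y * ENNReal.ofReal ((k : ℝ)⁻¹ ^ 4)
        = ENNReal.ofReal y' * ((k ^ 2 : ℕ) : ℝ≥0∞)⁻¹ := by
      rw [← ENNReal.ofReal_natCast, ← ENNReal.ofReal_inv_of_pos (by positivity),
        ← ENNReal.ofReal_mul hy.le, ← ENNReal.ofReal_mul hy'0.le]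
      congr 1
      rw [hy']
      push_cast
      field_simp
    calc ENNReal.ofReal y * cost α 1 ⌊a * y⌋₊ (m / √y)
        ≤ ENNReal.ofReal y * cost α 0 (∑ z ∈ tiles k, N z) (m / √y) :=
          mul_le_mul_right (cost_mono zero_le_one hcount le_rfl) _
      _ ≤ ENNReal.ofReal y * ∑ z ∈ tiles k, ENNReal.ofReal ((k : ℝ)⁻¹ ^ 4) *
            cost α 0 (N z) (k * (m / √y)) :=
          mul_le_mul_right (cost_tile_le hα.le (by omega) _ _) _
      _ = ∑ z ∈ tiles k, ((k ^ 2 : ℕ) : ℝ≥0∞)⁻¹ *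
            (ENNReal.ofReal y' * cost α 0 (N z) (m / √y')) := by
          rw [Finset.mul_sum, hrad]
          refine Finset.sum_congr rfl fun z _ => ?_
          rw [← mul_assoc, hyk]; ring
      _ ≤ ((k ^ 2 : ℕ) : ℝ≥0∞)⁻¹ * c₂ +
            ∑ z ∈ (tiles k).erase (0, 0), ((k ^ 2 : ℕ) : ℝ≥0∞)⁻¹ * c₁ := by
          rw [← Finset.add_sum_erase _ _ h0]
          refine add_le_add (mul_le_mul_right (by simpa [hN] using h2) _)
            (Finset.sum_le_sum fun z hz => mul_le_mul_right ?_ _)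
          simpa [hN, (Finset.mem_erase.1 hz).1] using h1
      _ ≤ ((k ^ 2 : ℕ) : ℝ≥0∞)⁻¹ * c₂ + ∑ z ∈ tiles k, ((k ^ 2 : ℕ) : ℝ≥0∞)⁻¹ * c₁ := by
          refine add_le_add le_rfl (Finset.sum_le_sum_of_subset (Finset.erase_subset _ _))
      _ = c₁ + c₂ / (k ^ 2 : ℕ) := by
          rw [Finset.sum_const, card_tiles, nsmul_eq_mul, ← mul_assoc,
            ENNReal.mul_inv_cancel hkE (by simp), one_mul, add_comm, div_eq_mul_inv, mul_comm c₂]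
  have hb_t := density_ne_top hα hm hb
  have ha_t := density_ne_top hα hm (a := a / 4) (by positivity)
  refine ENNReal.le_of_forall_pos_le_add fun ε hε _ => ?_
  have hε2 : (ε : ℝ≥0∞) / 2 ≠ 0 := by
    simpa [ENNReal.div_eq_zero_iff] using hε.ne'
  have := key _ _ (ENNReal.lt_add_right hb_t hε2) (ENNReal.lt_add_right ha_t hε2)
  refine this.trans ?_
  rw [ENNReal.add_div]
  have h5 : (ε : ℝ≥0∞) / 2 / (k ^ 2 : ℕ) ≤ ε / 2 :=
    ENNReal.div_le_of_le_mul (le_mul_of_one_le_right' (by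
      exact_mod_cast Nat.one_le_pow _ _ (by omega : 0 < k)))
  calc _ ≤ density α m b + ε / 2 + (density α m (a / 4) / (k ^ 2 : ℕ) + ε / 2) := by gcongr
    _ = density α m b + density α m (a / 4) / (k ^ 2 : ℕ) + (ε / 2 + ε / 2) := by ring
    _ = _ := by rw [ENNReal.add_halves]

lemma continuousAt_density (hα : 0 < α) (hm : 0 < m) {a : ℝ} (ha : 0 < a) :
    ContinuousAt (density α m) a := by
  have hat := density_ne_top hα hm ha
  have hB := density_ne_top hα hm (a := a / 8) (by positivity)
  have hlim : Tendsto (fun k : ℕ => density α m (a / 8) / (k ^ 2 : ℕ)) atTop (𝓝 0) := by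
    have h1 : Tendsto (fun k : ℕ => ((k ^ 2 : ℕ) : ℝ≥0∞)) atTop (𝓝 ⊤) :=
      ENNReal.tendsto_nat_nhds_top.comp (tendsto_pow_atTop (by norm_num))
    have := ENNReal.Tendsto.const_div (a := density α m (a / 8)) h1 (Or.inr hB)
    simpa using this
  rw [ContinuousAt, tendsto_order]
  constructor
  · intro c hc
    have h0 : 0 < density α m a - c := tsub_pos_of_lt hc
    obtain ⟨k, hk1, hk2⟩ := ((hlim.eventually_lt_const h0).and (eventually_ge_atTop 2)).exists
    have hkR : (2 : ℝ) ≤ k := by exact_mod_cast hk2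
    have hk3 : 0 < (k : ℝ) ^ 2 - 1 := by nlinarith
    have hev : ∀ᶠ x : ℝ in 𝓝 a, x * ((k : ℝ) ^ 2 - 1) < a * ((k : ℝ) ^ 2 - 1 / 2) := by
      refine (by fun_prop : Continuous fun x : ℝ =>
        x * ((k : ℝ) ^ 2 - 1)).continuousAt.eventually_lt_const ?_
      nlinarith
    filter_upwards [hev, lt_mem_nhds ha] with x hx hx0
    have h1 := density_le_add hα hm ha hx0 hk2 hx
    have h2 : density α m (a / 4) / (k ^ 2 : ℕ) ≤ density α m (a / 8) / (k ^ 2 : ℕ) := by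
      gcongr
      exact density_anti hα hm (by positivity) (by linarith)
    by_contra hcon
    have h3 : density α m a ≤ c + density α m (a / 8) / (k ^ 2 : ℕ) :=
      h1.trans (add_le_add (not_lt.1 hcon) h2)
    have h4 : density α m a - c ≤ density α m (a / 8) / (k ^ 2 : ℕ) :=
      tsub_le_iff_left.2 h3
    exact absurd hk1 (not_lt.2 h4)
  · intro c hc
    have h0 : 0 < c - density α m a := tsub_pos_of_lt hc
    obtain ⟨k, hk1, hk2⟩ := ((hlim.eventually_lt_const h0).and (eventually_ge_atTop 2)).exists
    have hkR : (2 : ℝ) ≤ k := by exact_mod_cast hk2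
    have hk3 : 0 < (k : ℝ) ^ 2 - 1 := by nlinarith
    have hev : ∀ᶠ x : ℝ in 𝓝 a, a * ((k : ℝ) ^ 2 - 1) < x * ((k : ℝ) ^ 2 - 1 / 2) := by
      refine (by fun_prop : Continuous fun x : ℝ =>
        x * ((k : ℝ) ^ 2 - 1 / 2)).continuousAt.eventually_const_lt ?_
      nlinarith
    filter_upwards [hev, lt_mem_nhds (by linarith : a / 2 < a)] with x hx hx0
    have hx0' : 0 < x := by linarith
    have h1 := density_le_add hα hm hx0' ha hk2 hx
    have h2 : density α m (x / 4) / (k ^ 2 : ℕ) ≤ density α m (a / 8) / (k ^ 2 : ℕ) := by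
      gcongr
      exact density_anti hα hm (by positivity) (by linarith)
    calc density α m x ≤ density α m a + density α m (a / 8) / (k ^ 2 : ℕ) :=
          h1.trans (add_le_add le_rfl h2)
      _ < density α m a + (c - density α m a) := ENNReal.add_lt_add_left hat hk1
      _ = c := add_tsub_cancel_of_le hc.le

lemma eventually_cost_zero_le (hα : 0 < α) (hm : 0 < m) {a : ℝ} (ha : 0 < a) {c : ℝ≥0∞}
    (hc : density α m a < c) :
    ∀ᶠ y : ℝ in atTop, ENNReal.ofReal y * cost α 0 ⌊a * y⌋₊ (m / √y) ≤ c := by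
  have h1 : ∀ᶠ x : ℝ in 𝓝[<] a, density α m x < c :=
    ((continuousAt_density hα hm ha).eventually_lt_const hc).filter_mono nhdsWithin_le_nhds
  have h2 : ∀ᶠ x : ℝ in 𝓝[<] a, 0 < x := (lt_mem_nhds ha).filter_mono nhdsWithin_le_nhds
  obtain ⟨x, hx1, hx2, hx3⟩ := (h1.and (h2.and self_mem_nhdsWithin)).exists
  exact eventually_le_of_density_lt hα hm hx2 hx3 hx1

end Density

/-! ### Lower bound of the energy density -/

lemma volume_openSq (p : Plane) {ℓ : ℝ} (hℓ : 0 ≤ ℓ) :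
    volume (openSq p ℓ) = ENNReal.ofReal (ℓ ^ 2) := by
  have e : openSq p ℓ = (@WithLp.ofLp 2 (Fin 2 → ℝ)) ⁻¹'
      (Set.univ.pi fun i => Set.Ioo (p i) (p i + ℓ)) := by
    ext x; simp [openSq]
  rw [e, (PiLp.volume_preserving_ofLp (Fin 2)).measure_preimage
    (MeasurableSet.univ_pi fun i => measurableSet_Ioo).nullMeasurableSet, Real.volume_pi_Ioo]
  simp [ENNReal.ofReal_pow hℓ]

lemma unitSquare_eq_openSq : unitSquare = openSq 0 1 := by
  ext x; simp [unitSquare, openSq]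

lemma volume_unitSquare : volume unitSquare = 1 := by
  rw [unitSquare_eq_openSq, volume_openSq 0 zero_le_one]; simp

lemma volume_balls_le (S : Finset Plane) {r : ℝ} (hr : 0 ≤ r) :
    volume (balls S r) ≤ ENNReal.ofReal (S.card * (Real.pi * r ^ 2)) := by
  refine (measure_biUnion_finset_le S _).trans ?_
  have : ∀ x : Plane, volume (Metric.closedBall x r) = ENNReal.ofReal (Real.pi * r ^ 2) := by
    intro x
    rw [EuclideanSpace.volume_closedBall_fin_two, ← ENNReal.ofReal_pow hr, mul_comm,
      ENNReal.ofReal_mul Real.pi_nonneg]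
  simp only [this, Finset.sum_const, nsmul_eq_mul]
  rw [ENNReal.ofReal_mul (Nat.cast_nonneg _), ENNReal.ofReal_natCast]

/-- The constant in the lower bound of `theta`. -/
def lowerConst (α : ℝ) : ℝ := (1 - Real.pi / 4) ^ 2 / (1 + 16 * α)

lemma lowerConst_pos {α : ℝ} (hα : 0 < α) : 0 < lowerConst α := by
  have := Real.pi_lt_four
  unfold lowerConst
  have : 0 < 1 - Real.pi / 4 := by linarith
  positivity

lemma lowerConst_le_of_nonempty {α : ℝ} (hα : 0 < α) {N : ℕ} (hN : 0 < N) {t : ℝ} (ht0 : 0 < t)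
    (ht : t ≤ 1 / 4) {S : Finset Plane} (hS : S.card ≤ N) (hne : S.Nonempty) :
    ENNReal.ofReal (lowerConst α) ≤
      N * cpl α 1 unitSquare (balls S (t / √N)) fun _ => 1 := by
  have hNR : (0 : ℝ) < N := by exact_mod_cast hN
  have hN1 : (1 : ℝ) ≤ N := by exact_mod_cast hN
  have hsN : 0 < √(N : ℝ) := Real.sqrt_pos.2 hNR
  have hNN : √(N : ℝ) * √(N : ℝ) = N := Real.mul_self_sqrt hNR.le
  set r := t / √(N : ℝ) with hr
  have hr0 : 0 < r := by positivity
  set L : ℝ := 4 * √(N : ℝ) with hL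
  set d : Plane → ℝ := fun x => Metric.infDist x (S : Set Plane) with hd
  set f : Plane → ℝ := fun x => max 0 (min 1 (L * (d x - r))) with hf
  have hdl : LipschitzWith 1 d := Metric.lipschitz_infDist_pt _
  have hfl : LipschitzWith (Real.toNNReal L) f := by
    have h1 : LipschitzWith (Real.toNNReal L) fun x => L * (d x - r) := by
      refine LipschitzWith.of_dist_le_mul fun x y => ?_
      rw [Real.coe_toNNReal _ (by positivity), Real.dist_eq, ← mul_sub, abs_mul,
        abs_of_pos (by positivity : 0 < L)]
      have := hdl.dist_le_mul x y
      rw [Real.dist_eq] at this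
      have e : d x - r - (d y - r) = d x - d y := by ring
      rw [e]
      gcongr
      simpa using this
    exact (h1.const_min 1).const_max 0
  have hf0 : ∀ x, 0 ≤ f x := fun x => le_max_left _ _
  have hf1 : ∀ x, f x ≤ 1 := fun x => max_le zero_le_one (min_le_left _ _)
  have hfb : ∀ x, |f x| ≤ 1 := fun x => by rw [abs_of_nonneg (hf0 x)]; exact hf1 x
  have hpair := isSobolevPair_of_lipschitz volume_unitSquare_ne_top hfl hfb
  have hvan : VanishesOn unitSquare (balls S r) f := by
    rw [vanishesOn_iff (measurableSet_balls _ _)]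
    refine Eventually.of_forall fun x hx => ?_
    obtain ⟨z, hz, hxz⟩ := mem_balls.1 hx
    have h1 : d x ≤ r := (Metric.infDist_le_dist_of_mem (by exact_mod_cast hz)).trans hxz
    have h2 : L * (d x - r) ≤ 0 := mul_nonpos_of_nonneg_of_nonpos (by positivity) (by linarith)
    exact max_eq_left ((min_le_right _ _).trans h2)
  have hvol : volume.real unitSquare = 1 := by simp [Measure.real, volume_unitSquare]
  have hfin : IsFiniteMeasure (volume.restrict unitSquare) :=
    ⟨by simpa using volume_unitSquare_ne_top.lt_top⟩
  have hfi : IntegrableOn f unitSquare :=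
    hpair.memLp_fun.integrable (by norm_num)
  -- lower bound of the integral
  set ρ := 1 / 2 / √(N : ℝ) with hρ
  have hfi : 1 - Real.pi / 4 ≤ ∫ x in unitSquare, f x := by
    have hB : volume.real (balls S ρ) ≤ Real.pi / 4 := by
      refine ENNReal.toReal_le_of_le_ofReal (by positivity)
        ((volume_balls_le S (by positivity)).trans (ENNReal.ofReal_le_ofReal ?_))
      have hSR : (S.card : ℝ) ≤ N := by exact_mod_cast hS
      calc (S.card : ℝ) * (Real.pi * ρ ^ 2) ≤ N * (Real.pi * ρ ^ 2) := by gcongr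
        _ = Real.pi / 4 := by
          rw [hρ, div_pow, Real.sq_sqrt hNR.le]; field_simp; norm_num
    have hind : ∀ x, 1 - (balls S ρ).indicator (fun _ => (1 : ℝ)) x ≤ f x := by
      intro x
      by_cases hx : x ∈ balls S ρ
      · simp [hx, hf0 x]
      · simp only [Set.indicator_of_notMem hx, sub_zero]
        have h1 : ρ ≤ d x := by
          refine (Metric.le_infDist (by exact_mod_cast hne)).2 fun {z} hz => ?_
          by_contra hlt
          exact hx (mem_balls.2 ⟨z, by exact_mod_cast hz, (not_le.1 hlt).le⟩)
        have h2 : 1 ≤ L * (d x - r) := by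
          have h3 : 1 / 4 / √(N : ℝ) ≤ ρ - r := by
            rw [hρ, hr, ← sub_div]
            gcongr
            linarith
          have h4 : L * (1 / 4 / √(N : ℝ)) = 1 := by rw [hL]; field_simp
          calc 1 = L * (1 / 4 / √(N : ℝ)) := h4.symm
            _ ≤ L * (d x - r) := by gcongr; linarith
        rw [hf]
        simp [min_eq_left h2]
    have hmb := measurableSet_balls S ρ
    calc 1 - Real.pi / 4 ≤ 1 - volume.real (balls S ρ ∩ unitSquare) := by
          have : volume.real (balls S ρ ∩ unitSquare) ≤ volume.real (balls S ρ) :=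
            measureReal_mono Set.inter_subset_left (by
              refine ((volume_balls_le S (by positivity)).trans_lt ENNReal.ofReal_lt_top).ne)
          linarith
      _ = ∫ x in unitSquare, (1 - (balls S ρ).indicator (fun _ => (1 : ℝ)) x) := by
          rw [integral_sub (integrable_const _) ((integrable_const _).indicator hmb),
            integral_indicator_const _ hmb]
          simp [hvol, measureReal_restrict_apply hmb]
      _ ≤ _ := integral_mono ((integrable_const _).sub ((integrable_const _).indicator hmb)) hfi
          hind
  have hsq : ∫ x in unitSquare, f x ^ 2 ≤ 1 := by
    have : ∫ x in unitSquare, f x ^ 2 ≤ ∫ _x in unitSquare, (1 : ℝ) :=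
      integral_mono hpair.memLp_fun.integrable_sq (integrable_const _)
        fun x => pow_le_one₀ (hf0 x) (hf1 x)
    simpa [hvol] using this
  have hgr : ∫ x in unitSquare, ‖gradient f x‖ ^ 2 ≤ 16 * N := by
    have hL2 : L ^ 2 = 16 * N := by rw [hL, mul_pow, Real.sq_sqrt hNR.le]; norm_num
    have : ∫ x in unitSquare, ‖gradient f x‖ ^ 2 ≤ ∫ _x in unitSquare, L ^ 2 := by
      refine integral_mono (MemLp.integrable_norm_sq hpair.memLp_grad) (integrable_const _)
        fun x => pow_le_pow_left₀ (norm_nonneg _) ?_ 2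
      have := norm_fderiv_le_of_lipschitz ℝ hfl (x₀ := x)
      rw [Real.coe_toNNReal _ (by positivity)] at this
      simpa [gradient] using this
    simpa [hvol, hL2] using this
  set A := 1 - Real.pi / 4 with hA
  have hA0 : 0 < A := by have := Real.pi_lt_four; rw [hA]; linarith
  set c := A / (1 + 16 * α) / N with hc
  have hc0 : 0 < c := by positivity
  refine le_trans ?_ (mul_le_mul_right (le_cpl (hpair.smul c) (hvan.smul c)) _)
  rw [energy_smul, ← ENNReal.ofReal_natCast, ← ENNReal.ofReal_mul hNR.le]
  refine ENNReal.ofReal_le_ofReal ?_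
  simp only [one_mul]
  have hq : (∫ x in unitSquare, f x ^ 2) + α * ∫ x in unitSquare, ‖gradient f x‖ ^ 2
      ≤ N * (1 + 16 * α) := by
    have := mul_le_mul_of_nonneg_left hgr hα.le
    nlinarith
  have e1 : lowerConst α = N * (2 * c * A - c ^ 2 * (N * (1 + 16 * α))) := by
    rw [lowerConst, hc, ← hA]
    field_simp
    ring
  rw [e1]
  gcongr

lemma lowerConst_le {α : ℝ} (hα : 0 < α) {N : ℕ} (hN : 0 < N) {t : ℝ} (ht0 : 0 < t)
    (ht : t ≤ 1 / 4) {S : Finset Plane} (hS : S.card ≤ N) :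
    ENNReal.ofReal (lowerConst α) ≤
      N * cpl α 1 unitSquare (balls S (t / √N)) fun _ => 1 := by
  rcases S.eq_empty_or_nonempty with rfl | hne
  · refine (lowerConst_le_of_nonempty hα hN ht0 ht (S := {0}) (by simp; omega)
      (Finset.singleton_nonempty 0)).trans (mul_le_mul_right (cpl_mono_set ?_) _)
    simp [balls]
  · exact lowerConst_le_of_nonempty hα hN ht0 ht hS hne

lemma lowerConst_le_theta {α : ℝ} (hα : 0 < α) {t : ℝ} (ht0 : 0 < t) (ht : t ≤ 1 / 4) :
    ENNReal.ofReal (lowerConst α) ≤ theta α t := by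
  refine le_iInf₂ fun x _ => le_liminf_of_le (by isBoundedDefault) ?_
  filter_upwards [eventually_gt_atTop 0] with N hN
  rw [rescaledCompliance_pixelSet hα (memLp_const_unitSquare 1)]
  exact lowerConst_le hα hN ht0 ht (Finset.card_image_le.trans (by simp))

lemma tendsto_density_top {α m : ℝ} (hα : 0 < α) (hm : 0 < m) :
    Tendsto (density α m) (𝓝[>] 0) (𝓝 ⊤) := by
  have h1 : Tendsto (fun a : ℝ => ENNReal.ofReal (lowerConst α) / ENNReal.ofReal a) (𝓝[>] 0)
      (𝓝 ⊤) := by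
    have h2 : Tendsto (fun a : ℝ => ENNReal.ofReal a) (𝓝[>] 0) (𝓝 0) := by
      simpa using (ENNReal.tendsto_ofReal (tendsto_id (α := ℝ) (x := 𝓝 0))).mono_left
        nhdsWithin_le_nhds
    have := ENNReal.Tendsto.const_div (a := ENNReal.ofReal (lowerConst α)) h2
      (Or.inr ENNReal.ofReal_ne_top)
    rwa [ENNReal.div_zero (by simpa using lowerConst_pos hα)] at this
  refine tendsto_of_tendsto_of_tendsto_of_le_of_le' h1 tendsto_const_nhds ?_
    (Eventually.of_forall fun _ => le_top)
  have hlim : Tendsto (fun a : ℝ => m * √a) (𝓝[>] 0) (𝓝 0) := by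
    have : Tendsto (fun a : ℝ => m * √a) (𝓝 0) (𝓝 (m * √0)) :=
      (by fun_prop : Continuous fun a : ℝ => m * √a).tendsto 0
    simpa using this.mono_left nhdsWithin_le_nhds
  filter_upwards [hlim.eventually_le_const (by norm_num : (0 : ℝ) < 1 / 4),
    self_mem_nhdsWithin] with a ha ha0
  rw [density]
  gcongr
  exact lowerConst_le_theta hα (mul_pos hm (Real.sqrt_pos.2 ha0)) ha

/-! ### Closed squares of the grid and differentiation of measures -/

/-- Closed squares. -/
def closedSq (p : Plane) (ℓ : ℝ) : Set Plane := {x | ∀ i, x i ∈ Set.Icc (p i) (p i + ℓ)}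

/-- The closed squares of the grid. -/
def closedCell (ℓ : ℝ) (z : ℤ × ℤ) : Set Plane := closedSq (corner ℓ z) ℓ

lemma isClosed_closedSq (p : Plane) (ℓ : ℝ) : IsClosed (closedSq p ℓ) := by
  simp only [closedSq, Set.ofPred_forall]
  exact isClosed_iInter fun i => isClosed_Icc.preimage (by fun_prop)

lemma openSq_subset_closedSq (p : Plane) (ℓ : ℝ) : openSq p ℓ ⊆ closedSq p ℓ :=
  fun _ hx i => Set.Ioo_subset_Icc_self (hx i)

lemma preimage_aff_closedSq (p : Plane) {ℓ : ℝ} (hℓ : 0 < ℓ) :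
    aff p ℓ ⁻¹' closedSq p ℓ = closedSquare := by
  ext x
  simp only [closedSq, closedSquare, Set.mem_preimage, Set.mem_ofPred_eq, aff_apply, Set.mem_Icc]
  refine forall_congr' fun i => ?_
  constructor
  · rintro ⟨h1, h2⟩
    constructor <;> nlinarith
  · rintro ⟨h1, h2⟩
    constructor <;> nlinarith

lemma closedSq_subset_closure (p : Plane) {ℓ : ℝ} (hℓ : 0 < ℓ) :
    closedSq p ℓ ⊆ closure (openSq p ℓ) := by
  intro x hx
  have h1 : (affHomeo p hℓ.ne').symm x ∈ closure unitSquare := by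
    refine closedSquare_subset_closure ?_
    rw [← preimage_aff_closedSq p hℓ]
    change affHomeo p hℓ.ne' _ ∈ closedSq p ℓ
    simpa using hx
  rw [← preimage_aff_openSq p hℓ] at h1
  change _ ∈ closure (affHomeo p hℓ.ne' ⁻¹' _) at h1
  rw [← (affHomeo p hℓ.ne').preimage_closure] at h1
  simpa using h1

lemma closedSq_ae_eq (p : Plane) (ℓ : ℝ) : closedSq p ℓ =ᵐ[volume] openSq p ℓ := by
  have h : ∀ᵐ x : Plane, ∀ i : Fin 2, x i ≠ p i ∧ x i ≠ p i + ℓ := by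
    rw [ae_all_iff]; intro i
    exact (ae_coord_ne i _).and (ae_coord_ne i _)
  filter_upwards [h] with x hx
  refine propext (forall_congr' fun i => ?_)
  exact ⟨fun h => ⟨lt_of_le_of_ne h.1 (hx i).1.symm, lt_of_le_of_ne h.2 (hx i).2⟩,
    fun h => ⟨h.1.le, h.2.le⟩⟩

lemma volume_closedSq (p : Plane) {ℓ : ℝ} (hℓ : 0 ≤ ℓ) :
    volume (closedSq p ℓ) = ENNReal.ofReal (ℓ ^ 2) := by
  rw [measure_congr (closedSq_ae_eq p ℓ), volume_openSq p hℓ]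

lemma dist_le_of_mem_closedSq {p : Plane} {ℓ : ℝ} {x y : Plane} (hx : x ∈ closedSq p ℓ)
    (hy : y ∈ closedSq p ℓ) : dist x y ≤ 2 * ℓ := by
  have h0 : ∀ i, |x i - y i| ≤ ℓ := fun i =>
    abs_le.2 ⟨by linarith [(hx i).1, (hy i).2], by linarith [(hx i).2, (hy i).1]⟩
  have hℓ : 0 ≤ ℓ := (abs_nonneg _).trans (h0 0)
  rw [EuclideanSpace.dist_eq, Real.sqrt_le_left (by positivity), Fin.sum_univ_two, Real.dist_eq,
    Real.dist_eq]
  nlinarith [h0 0, h0 1, abs_nonneg (x 0 - y 0), abs_nonneg (x 1 - y 1)]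

lemma mem_closedCell_index {ℓ : ℝ} (hℓ : 0 < ℓ) (x : Plane) : x ∈ closedCell ℓ (index ℓ x) :=
  fun i => ⟨((index_eq_iff hℓ).1 rfl i).1, ((index_eq_iff hℓ).1 rfl i).2.le⟩

lemma volume_closedBall_eq (x : Plane) {r : ℝ} (hr : 0 ≤ r) :
    volume (Metric.closedBall x r) = ENNReal.ofReal (Real.pi * r ^ 2) := by
  rw [EuclideanSpace.volume_closedBall_fin_two, ← ENNReal.ofReal_pow hr, mul_comm,
      ENNReal.ofReal_mul Real.pi_nonneg]

/-- The Vitali family used for squares. -/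
def squareFamily : VitaliFamily (volume : Measure Plane) :=
  Vitali.vitaliFamily volume 144 fun x => by
    refine Eventually.frequently ?_
    filter_upwards [self_mem_nhdsWithin] with r hr
    have hr : 0 < r := hr
    rw [volume_closedBall_eq x (by positivity), volume_closedBall_eq x hr.le]
    have : ((144 : NNReal) : ℝ≥0∞) = ENNReal.ofReal 144 := by simp
    rw [this, ← ENNReal.ofReal_mul (by norm_num)]
    refine ENNReal.ofReal_le_ofReal ?_
    nlinarith [Real.pi_pos, mul_pos Real.pi_pos (pow_pos hr 2)]

lemma tendsto_closedCell_filterAt {ℓ : ℕ → ℝ} (hℓ : ∀ k, 0 < ℓ k) (h0 : Tendsto ℓ atTop (𝓝 0))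
    (x : Plane) :
    Tendsto (fun k => closedCell (ℓ k) (index (ℓ k) x)) atTop (squareFamily.filterAt x) := by
  rw [VitaliFamily.tendsto_filterAt_iff]
  have hsub : ∀ k, closedCell (ℓ k) (index (ℓ k) x) ⊆ Metric.closedBall x (2 * ℓ k) :=
    fun k y hy => dist_le_of_mem_closedSq hy (mem_closedCell_index (hℓ k) x)
  constructor
  · refine Eventually.of_forall fun k => ?_
    refine ⟨isClosed_closedSq _ _, ?_, 2 * ℓ k, hsub k, ?_⟩
    · refine ⟨corner (ℓ k) (index (ℓ k) x) + !₂[ℓ k / 2, ℓ k / 2],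
        interior_maximal (openSq_subset_closedSq _ _) (isOpen_openSq _ _) fun i => ?_⟩
      have := hℓ k
      fin_cases i <;> simp <;> linarith
    · have := hℓ k
      rw [volume_closedBall_eq x (by positivity), closedCell, volume_closedSq _ this.le]
      have e : ((144 : NNReal) : ℝ≥0∞) = ENNReal.ofReal 144 := by simp
      rw [e, ← ENNReal.ofReal_mul (by norm_num)]
      refine ENNReal.ofReal_le_ofReal ?_
      nlinarith [Real.pi_le_four, pow_pos this 2,
        mul_le_mul_of_nonneg_right Real.pi_le_four (sq_nonneg (ℓ k))]
  · intro ε hε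
    have h1 : ∀ᶠ k in atTop, ℓ k < ε / 2 := h0.eventually_lt_const (by positivity)
    filter_upwards [h1] with k hk
    exact (hsub k).trans (Metric.closedBall_subset_closedBall (by linarith))

lemma ae_tendsto_closedCell_div (ρ : Measure Plane) [IsLocallyFiniteMeasure ρ] {ℓ : ℕ → ℝ}
    (hℓ : ∀ k, 0 < ℓ k) (h0 : Tendsto ℓ atTop (𝓝 0)) :
    ∀ᵐ x : Plane, Tendsto (fun k => ρ (closedCell (ℓ k) (index (ℓ k) x)) / ENNReal.ofReal (ℓ k ^ 2))
      atTop (𝓝 (ρ.rnDeriv volume x)) := by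
  filter_upwards [squareFamily.ae_tendsto_rnDeriv ρ] with x hx
  refine (hx.comp (tendsto_closedCell_filterAt hℓ h0 x)).congr fun k => ?_
  simp only [Function.comp, closedCell, volume_closedSq _ (hℓ k).le]

lemma exists_cutoff_openSq (p : Plane) {ℓ r : ℝ} (hr : 0 < r) :
    ∃ χ : Plane → ℝ, ContDiff ℝ ∞ χ ∧ (∀ x, |χ x| ≤ 1) ∧ tsupport χ ⊆ openSq p ℓ ∧
      ∀ x, (∀ i, p i + r < x i ∧ x i < p i + ℓ - r) → χ x = 1 ∧ fderiv ℝ χ x = 0 := by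
  set s : Set Plane := {x | ∀ i, x i ∈ Set.Icc (p i + r) (p i + ℓ - r)} with hs
  set t : Set Plane := {x | ∀ i, x i ∈ Set.Icc (p i + r / 2) (p i + ℓ - r / 2)} with ht
  have hsc : IsClosed s := by
    simp only [hs, Set.ofPred_forall]
    exact isClosed_iInter fun i => isClosed_Icc.preimage (by fun_prop)
  have htc : IsClosed t := by
    simp only [ht, Set.ofPred_forall]
    exact isClosed_iInter fun i => isClosed_Icc.preimage (by fun_prop)
  have hst : s ⊆ interior t := by
    have ho : IsOpen {x : Plane | ∀ i, x i ∈ Set.Ioo (p i + r / 2) (p i + ℓ - r / 2)} := by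
      simp only [Set.ofPred_forall]
      exact isOpen_iInter_of_finite fun i => isOpen_Ioo.preimage (by fun_prop)
    refine Set.Subset.trans ?_
      (interior_maximal (fun x (hx : ∀ i, _) i => Set.Ioo_subset_Icc_self (hx i)) ho)
    exact fun x hx i => ⟨by linarith [(hx i).1], by linarith [(hx i).2]⟩
  obtain ⟨f, hf1, hf0, hf⟩ := exists_contMDiffMap_one_nhds_of_subset_interior (n := ⊤)
    (modelWithCornersSelf ℝ Plane) hsc hst
  refine ⟨f, f.contMDiff.contDiff, fun x => abs_le.2 ⟨by linarith [(hf x).1], (hf x).2⟩, ?_, ?_⟩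
  · have h1 : tsupport f ⊆ t := by
      refine closure_minimal (fun x hx => ?_) htc
      by_contra hxt
      exact hx (hf0 x hxt)
    exact h1.trans fun x hx i => ⟨by linarith [(hx i).1], by linarith [(hx i).2]⟩
  · intro x hx
    have hxs : x ∈ s := fun i => ⟨(hx i).1.le, (hx i).2.le⟩
    have h1 : ∀ᶠ y in 𝓝 x, f y = 1 := (hf1.filter_mono (nhds_le_nhdsSet hxs))
    refine ⟨h1.self_of_nhds, ?_⟩
    have h2 : (f : Plane → ℝ) =ᶠ[𝓝 x] fun _ => (1 : ℝ) := h1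
    rw [h2.fderiv_eq]
    simp

/-! ### Estimates on a single cell -/

section Cell

variable {α m : ℝ}

lemma radius_div {ℓ : ℝ} (hℓ : 0 < ℓ) (m : ℝ) (n : ℕ) : radius m n / ℓ = m / √(n * ℓ ^ 2) := by
  rw [radius, Real.sqrt_mul (Nat.cast_nonneg n), Real.sqrt_sq hℓ.le, div_div]

lemma tendsto_natCast_mul_sq {ℓ : ℝ} (hℓ : 0 < ℓ) :
    Tendsto (fun n : ℕ => (n : ℝ) * ℓ ^ 2) atTop atTop :=
  tendsto_natCast_atTop_atTop.atTop_mul_const (by positivity)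

lemma mul_cpl_openSq_le (hα : 0 < α) {C : ℝ} (hC : 0 < C) (p : Plane) {ℓ : ℝ} (hℓ : 0 < ℓ)
    {n : ℕ} (hn : 0 < n) {T : Finset Plane}
    (hT : ∀ φ G, IsSobolevPair unitSquare φ G →
      VanishesOn unitSquare (balls T (m / √(n * ℓ ^ 2))) φ →
        ∫ x in unitSquare, φ x ^ 2 ≤ C / (n * ℓ ^ 2) * ∫ x in unitSquare, ‖G x‖ ^ 2)
    {f : Plane → ℝ} (hf : MemLp f 2 (volume.restrict (openSq p ℓ))) :
    n * cpl α 0 (openSq p ℓ) (balls (T.image (aff p ℓ)) (radius m n)) f ≤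
      ENNReal.ofReal (C / α * ∫ x in openSq p ℓ, f x ^ 2) := by
  have hn' : (0 : ℝ) < n := by exact_mod_cast hn
  rw [cpl_openSq α 0 p hℓ, zero_mul, radius_div hℓ]
  have hf' := memLp_comp_aff p hℓ _ hf
  have e := setIntegral_comp_aff p hℓ (openSq p ℓ) fun x => f x ^ 2
  rw [preimage_aff_openSq p hℓ] at hf' e
  have h1 := cpl_le_of_poincare hα (P := C / (n * ℓ ^ 2)) (by positivity) hf' hT
  calc (n : ℝ≥0∞) * (ENNReal.ofReal (ℓ ^ 4) * cpl α 0 unitSquare (balls T (m / √(n * ℓ ^ 2)))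
        fun x => f (aff p ℓ x))
      ≤ ENNReal.ofReal n * (ENNReal.ofReal (ℓ ^ 4) * ENNReal.ofReal
        (C / (n * ℓ ^ 2) / α * ∫ x in unitSquare, f (aff p ℓ x) ^ 2)) := by
        rw [ENNReal.ofReal_natCast]; gcongr
    _ = ENNReal.ofReal (C / α * ∫ x in openSq p ℓ, f x ^ 2) := by
        rw [← ENNReal.ofReal_mul (by positivity), ← ENNReal.ofReal_mul (by positivity), e]
        congr 1
        field_simp

lemma cpl_openSq_const (hα : 0 ≤ α) {s : ℝ} (hs : 0 ≤ s) (p : Plane) {ℓ : ℝ} (hℓ : 0 < ℓ) (n : ℕ)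
    (T : Finset Plane) (c : ℝ) :
    (n * cpl α s (openSq p ℓ) (balls (T.image (aff p ℓ)) (radius m n)) fun _ => c) =
      ENNReal.ofReal (c ^ 2 * ℓ ^ 2) * (ENNReal.ofReal (n * ℓ ^ 2) *
        cpl α (s * ℓ ^ 2) unitSquare (balls T (m / √(n * ℓ ^ 2))) fun _ => 1) := by
  have h := cpl_const_mul (D := openSq p ℓ) (K := balls (T.image (aff p ℓ)) (radius m n)) hα hs
    (fun _ => 1) c
  simp only [mul_one] at h
  rw [h, cpl_openSq α s p hℓ, radius_div hℓ, ENNReal.ofReal_mul (by positivity),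
    ENNReal.ofReal_mul (by positivity), ENNReal.ofReal_natCast,
    show ℓ ^ 4 = ℓ ^ 2 * ℓ ^ 2 by ring, ENNReal.ofReal_mul (by positivity)]
  ring

lemma eventually_mul_density_le (hα : 0 < α) (hm : 0 < m) {a : ℝ} (ha : 0 < a) {t : ℝ≥0∞}
    (ht : t < 1) :
    ∀ᶠ y : ℝ in atTop, t * density α m a ≤ ENNReal.ofReal y * cost α 1 ⌊a * y⌋₊ (m / √y) := by
  rcases eq_or_ne (density α m a) 0 with h | h
  · simp [h]
  · refine eventually_le_of_lt_density hα hm ha ?_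
    conv_rhs => rw [← one_mul (density α m a)]
    exact ENNReal.mul_lt_mul_left h (density_ne_top hα hm ha) ht

/-- Balls in a square, most of whose centres lie in the closed square, may be enlarged to a set `L`
which contains a boundary layer, on which the compliance of constants is bounded below, and on which
the compliance is continuous in `L²` with constant `C`. -/
def IsLowerCellConst (α m ε C : ℝ) : Prop :=
  ∀ (p : Plane) (ℓ : ℝ), 0 < ℓ → ℓ ≤ 1 → ∀ b : ℝ, 0 ≤ b → ∀ t : ℝ≥0∞, t < 1 →
    ∀ᶠ n : ℕ in atTop, ∀ S : Finset Plane,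
      (∃ S' : Finset Plane, (S'.card : ℝ) ≤ b * (n * ℓ ^ 2) ∧ ∀ x ∈ S, x ∈ closedSq p ℓ → x ∈ S') →
      ∃ L : Set Plane, MeasurableSet L ∧ openSq p ℓ ∩ balls S (radius m n) ⊆ L ∧
        (∃ χ : Plane → ℝ, ContDiff ℝ ∞ χ ∧ (∀ x, |χ x| ≤ 1) ∧ tsupport χ ⊆ openSq p ℓ ∧
          ∀ x ∈ openSq p ℓ, x ∉ L → χ x = 1 ∧ fderiv ℝ χ x = 0) ∧
        (∀ c : ℝ, ENNReal.ofReal (c ^ 2 * ℓ ^ 2) * (t * density α m (b + ε)) ≤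
          n * cpl α 1 (openSq p ℓ) L fun _ => c) ∧
        ∀ f : Plane → ℝ, MemLp f 2 (volume.restrict (openSq p ℓ)) →
          n * cpl α 1 (openSq p ℓ) L f ≤ ENNReal.ofReal (C * ∫ x in openSq p ℓ, f x ^ 2)

lemma exists_lower_cell (hα : 0 < α) (hm : 0 < m) {ε : ℝ} (hε : 0 < ε) :
    ∃ C > 0, IsLowerCellConst α m ε C := by
  classical
  obtain ⟨C, hC, hlines⟩ := exists_lines_budget (half_pos hε) hm
  refine ⟨C / α, by positivity, fun p ℓ hℓ hℓ1 b hb t ht => ?_⟩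
  have hy := tendsto_natCast_mul_sq hℓ
  filter_upwards [hy.eventually hlines, hy.eventually (exists_boundary_budget (half_pos hε) hm),
    hy.eventually (eventually_mul_density_le hα hm (a := b + ε) (by positivity) ht),
    eventually_gt_atTop 0] with n h1 h2 h3 hn S hS
  obtain ⟨S', hS', hSS'⟩ := hS
  obtain ⟨T₁, hT₁, hpoin⟩ := h1
  obtain ⟨T₂, hT₂, hlayer⟩ := h2
  have hn' : (0 : ℝ) < n := by exact_mod_cast hn
  have hr : 0 < radius m n := by rw [radius]; positivity
  set e := affHomeo p hℓ.ne' with he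
  have heq : ∀ x, e x = aff p ℓ x := fun _ => rfl
  set T : Finset Plane := S'.image e.symm ∪ T₁ ∪ T₂ with hT
  have hcard : T.card ≤ ⌊(b + ε) * (n * ℓ ^ 2)⌋₊ := by
    refine Nat.le_floor ?_
    have k1 : T.card ≤ S'.card + T₁.card + T₂.card := by
      refine (Finset.card_union_le _ _).trans (Nat.add_le_add_right ?_ _)
      exact (Finset.card_union_le _ _).trans (Nat.add_le_add_right Finset.card_image_le _)
    have k2 : (T.card : ℝ) ≤ S'.card + T₁.card + T₂.card := by exact_mod_cast k1
    nlinarith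
  have hmemL : ∀ u, aff p ℓ u ∈ balls (T.image (aff p ℓ)) (radius m n) ↔
      u ∈ balls T (m / √(n * ℓ ^ 2)) := fun u => by
    rw [← radius_div hℓ, ← preimage_aff_balls p hℓ]; rfl
  have hlay : ∀ x ∈ openSq p ℓ, x ∉ balls (T.image (aff p ℓ)) (radius m n) →
      ∀ i, p i + radius m n < x i ∧ x i < p i + ℓ - radius m n := by
    intro x hx hxL i
    obtain ⟨u, rfl⟩ : ∃ u, aff p ℓ u = x := ⟨e.symm x, e.apply_symm_apply x⟩
    have hu : u ∈ unitSquare := by rw [← preimage_aff_openSq p hℓ]; exact hx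
    have hu' : u ∉ balls T₂ (m / √(n * ℓ ^ 2)) := fun h =>
      hxL ((hmemL u).2 (balls_mono Finset.subset_union_right le_rfl h))
    have := hlayer u hu hu' i
    rw [← radius_div hℓ, div_lt_iff₀ hℓ, lt_sub_comm, div_lt_iff₀ hℓ] at this
    rw [aff_apply]
    constructor <;> nlinarith
  refine ⟨balls (T.image (aff p ℓ)) (radius m n), measurableSet_balls _ _, ?_, ?_, ?_, ?_⟩
  · rintro x ⟨hx, hxS⟩
    by_contra hxL
    have hl := hlay x hx hxL
    obtain ⟨z, hz, hd⟩ := mem_balls.1 hxS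
    have hzc : z ∈ closedSq p ℓ := by
      intro i
      have h1 : |x i - z i| ≤ radius m n := by
        refine le_trans ?_ hd
        rw [dist_eq_norm]
        exact PiLp.norm_apply_le (x - z) i
      have := abs_le.1 h1
      exact ⟨by linarith [(hl i).1], by linarith [(hl i).2]⟩
    refine hxL (mem_balls.2 ⟨z, ?_, hd⟩)
    refine Finset.mem_image.2 ⟨e.symm z, ?_, e.apply_symm_apply z⟩
    exact Finset.mem_union_left _ (Finset.mem_union_left _
      (Finset.mem_image_of_mem _ (hSS' z hz hzc)))
  · obtain ⟨χ, c1, c2, c3, c4⟩ := exists_cutoff_openSq p (ℓ := ℓ) hr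
    exact ⟨χ, c1, c2, c3, fun x hx hxL => c4 x (hlay x hx hxL)⟩
  · intro c
    rw [cpl_openSq_const hα.le zero_le_one p hℓ]
    refine mul_le_mul_right (h3.trans (mul_le_mul_right ?_ _)) _
    exact (cost_le hcard).trans (cpl_mono_mass (by nlinarith))
  · intro f hf
    refine (mul_le_mul_right (cpl_mono_mass zero_le_one) _).trans
      (mul_cpl_openSq_le hα hC p hℓ hn (fun φ G hφ hv => hpoin φ G hφ ?_) hf)
    refine hv.mono fun z hz => ⟨hz.1, balls_mono ?_ le_rfl hz.2⟩
    exact Finset.subset_union_right.trans Finset.subset_union_left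

/-- In a square, balls with density close to `a` can be placed so that the compliance of constants
is close to optimal and the compliance is continuous in `L²` with constant `C`. -/
def IsUpperCellConst (α m ε C : ℝ) : Prop :=
  ∀ (p : Plane) (ℓ : ℝ), 0 < ℓ → ∀ a : ℝ, 0 < a → ∀ c : ℝ≥0∞, density α m a < c →
    ∀ᶠ n : ℕ in atTop, ∃ S : Finset Plane, (S.card : ℝ) ≤ (a + ε) * (n * ℓ ^ 2) ∧
      (∀ x ∈ S, x ∈ closedSq p ℓ) ∧
      (∀ b : ℝ, (n * cpl α 0 (openSq p ℓ) (balls S (radius m n)) fun _ => b) ≤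
        ENNReal.ofReal (b ^ 2 * ℓ ^ 2) * c) ∧
      ∀ f : Plane → ℝ, MemLp f 2 (volume.restrict (openSq p ℓ)) →
        n * cpl α 0 (openSq p ℓ) (balls S (radius m n)) f ≤
          ENNReal.ofReal (C * ∫ x in openSq p ℓ, f x ^ 2)

lemma exists_upper_cell (hα : 0 < α) (hm : 0 < m) {ε : ℝ} (hε : 0 < ε) :
    ∃ C > 0, IsUpperCellConst α m ε C := by
  classical
  obtain ⟨C, hC, hlines⟩ := exists_lines_budget hε hm
  refine ⟨C / α, by positivity, fun p ℓ hℓ a ha c hc => ?_⟩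
  obtain ⟨c', hc1, hc2⟩ := exists_between hc
  have hy := tendsto_natCast_mul_sq hℓ
  filter_upwards [hy.eventually hlines, hy.eventually (eventually_cost_zero_le hα hm ha hc1),
    eventually_gt_atTop 0] with n h1 h2 hn
  obtain ⟨T₁, hT₁, hpoin⟩ := h1
  have hn' : (0 : ℝ) < n := by exact_mod_cast hn
  have hyp : (0 : ℝ) < n * ℓ ^ 2 := by positivity
  obtain ⟨T₂, hT₂, hcost⟩ := exists_of_cost_lt (α := α) (s := 0) (N := ⌊a * (n * ℓ ^ 2)⌋₊)
      (r := m / √(n * ℓ ^ 2)) (c := c / ENNReal.ofReal (n * ℓ ^ 2)) (by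
    rw [ENNReal.lt_div_iff_mul_lt (Or.inl (ENNReal.ofReal_pos.2 hyp).ne')
      (Or.inl ENNReal.ofReal_ne_top), mul_comm]
    exact h2.trans_lt hc2)
  obtain ⟨T, hT, hTc, hTs⟩ := exists_clamped (T₁ ∪ T₂)
  have hmono : ∀ {f : Plane → ℝ} {T' : Finset Plane}, T' ⊆ T₁ ∪ T₂ →
      cpl α 0 unitSquare (balls T (m / √(n * ℓ ^ 2))) f ≤
        cpl α 0 unitSquare (balls T' (m / √(n * ℓ ^ 2))) f := fun hT' =>
    cpl_mono_set fun z hz => hTs _ ⟨hz.1, balls_mono hT' le_rfl hz.2⟩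
  refine ⟨T.image (aff p ℓ), ?_, ?_, ?_, ?_⟩
  · have k1 : (T.image (aff p ℓ)).card ≤ T₁.card + T₂.card :=
      Finset.card_image_le.trans (hT.trans (Finset.card_union_le _ _))
    have k2 : ((T.image (aff p ℓ)).card : ℝ) ≤ T₁.card + T₂.card := by exact_mod_cast k1
    have k3 : (T₂.card : ℝ) ≤ a * (n * ℓ ^ 2) :=
      (Nat.cast_le.2 hT₂).trans (Nat.floor_le (by positivity))
    nlinarith
  · intro x hx
    obtain ⟨u, hu, rfl⟩ := Finset.mem_image.1 hx
    have := hTc u hu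
    rwa [← preimage_aff_closedSq p hℓ] at this
  · intro b
    rw [cpl_openSq_const hα.le le_rfl p hℓ, zero_mul]
    refine mul_le_mul_right ?_ _
    have := (hmono (f := fun _ => 1) Finset.subset_union_right).trans_lt hcost
    rw [ENNReal.lt_div_iff_mul_lt (Or.inl (ENNReal.ofReal_pos.2 hyp).ne')
      (Or.inl ENNReal.ofReal_ne_top), mul_comm]
      at this
    exact this.le
  · intro f hf
    refine mul_cpl_openSq_le hα hC p hℓ hn (fun φ G hφ hv => hpoin φ G hφ ?_) hf
    exact hv.mono fun z hz => ⟨hz.1, hTs _ ⟨hz.1, balls_mono Finset.subset_union_left le_rfl hz.2⟩⟩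

end Cell

/-! ### The lower bound on a fixed grid -/

lemma openSq_nonempty (p : Plane) {ℓ : ℝ} (hℓ : 0 < ℓ) : (openSq p ℓ).Nonempty :=
  ⟨p + !₂[ℓ / 2, ℓ / 2], fun i => by fin_cases i <;> simp <;> linarith⟩

lemma finite_setOf_closedCell_inter {ℓ : ℝ} (hℓ : 0 < ℓ) {B : Set Plane}
    (hB : Bornology.IsBounded B) : {z : ℤ × ℤ | (closedCell ℓ z ∩ B).Nonempty}.Finite := by
  obtain ⟨R, hR⟩ := hB.subset_closedBall 0
  set M : ℤ := ⌈R / ℓ⌉ + 1 with hM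
  refine (Set.finite_Icc ((-M, -M) : ℤ × ℤ) (M, M)).subset ?_
  rintro z ⟨x, hx, hxB⟩
  have hxi : ∀ i, |x i| ≤ R := fun i =>
    (PiLp.norm_apply_le x i).trans (by simpa using hR hxB)
  have hc : R ≤ ℓ * (M - 1) := by
    have := Int.le_ceil (R / ℓ)
    rw [div_le_iff₀ hℓ] at this
    rw [hM]; push_cast; linarith
  have key : ∀ (i : Fin 2) (k : ℤ), corner ℓ z i = ℓ * k → -M ≤ k ∧ k ≤ M := by
    intro i k hk
    have h1 := hx i
    rw [hk] at h1
    have h2 := abs_le.1 (hxi i)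
    constructor
    · have : (-M : ℝ) ≤ k := by
        by_contra! h
        nlinarith [h1.1, h1.2]
      exact_mod_cast this
    · have : (k : ℝ) ≤ M := by
        by_contra! h
        nlinarith [h1.1, h1.2]
      exact_mod_cast this
  have h0 := key 0 z.1 (by simp [corner])
  have h1 := key 1 z.2 (by simp [corner])
  exact ⟨⟨h0.1, h1.1⟩, h0.2, h1.2⟩

lemma finite_setOf_cell_subset {ℓ : ℝ} (hℓ : 0 < ℓ) {D : Set Plane}
    (hD : Bornology.IsBounded D) : {z : ℤ × ℤ | cell ℓ z ⊆ D}.Finite := by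
  refine (finite_setOf_closedCell_inter hℓ hD).subset fun z hz => ?_
  obtain ⟨x, hx⟩ := openSq_nonempty (corner ℓ z) hℓ
  exact ⟨x, openSq_subset_closedSq _ _ hx, hz hx⟩

lemma empirical_apply (n : ℕ) (x : Fin n → Plane) {A : Set Plane} (hA : MeasurableSet A)
    [DecidablePred fun i => x i ∈ A] :
    empirical n x A = (n : ℝ≥0∞)⁻¹ * (Finset.univ.filter fun i => x i ∈ A).card := by
  classical
  simp only [empirical, Measure.smul_apply, Measure.finsetSum_apply, Measure.dirac_apply' _ hA,
    smul_eq_mul, Set.indicator_apply, Pi.one_apply, Finset.sum_boole]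

section Lower

variable {α m : ℝ} {D : Set Plane} {g : Plane → ℝ}

lemma eventually_map_closed_lt {μ : ProbabilityMeasure (closure D)}
    {w : ℕ → ProbabilityMeasure (closure D)} (hw : Tendsto w atTop (𝓝 μ)) {A : Set Plane}
    (hA : IsClosed A) {ε : ℝ} (hε : 0 < ε) :
    ∀ᶠ n in atTop, (w n : Measure (closure D)).map Subtype.val A <
      ENNReal.ofReal (((μ : Measure (closure D)).map Subtype.val A).toReal + ε) := by
  have h1 := ProbabilityMeasure.limsup_measure_closed_le_of_tendsto hw
    (hA.preimage continuous_subtype_val)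
  have h2 : ∀ ν : ProbabilityMeasure (closure D), (ν : Measure (closure D)).map Subtype.val A =
      (ν : Measure (closure D)) (Subtype.val ⁻¹' A) := fun ν =>
    Measure.map_apply measurable_subtype_coe hA.measurableSet
  simp only [h2]
  refine eventually_lt_of_limsup_lt (h1.trans_lt ?_)
  rw [ENNReal.ofReal_add ENNReal.toReal_nonneg hε.le, ENNReal.ofReal_toReal (measure_ne_top _ _)]
  exact ENNReal.lt_add_right (measure_ne_top _ _) (by simpa using hε)

lemma sum_density_le (hα : 0 < α) (hDo : IsOpen D)
    (hg : MemLp g 2 (volume.restrict D)) {ε C : ℝ} (hε : 0 < ε)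
    (hC : IsLowerCellConst α m ε C)
    {ℓ : ℝ} (hℓ : 0 < ℓ) (hℓ1 : ℓ ≤ 1) {Z : Finset (ℤ × ℤ)} (hZ : ∀ z ∈ Z, cell ℓ z ⊆ D)
    (c : ℤ × ℤ → ℝ) {t : ℝ≥0∞} (ht : t < 1) {δ : ℝ} (hδ : 0 < δ)
    {μ : ProbabilityMeasure (closure D)}
    {w : ℕ → ProbabilityMeasure (closure D)} (hw : Tendsto w atTop (𝓝 μ)) :
    ∑ z ∈ Z, ENNReal.ofReal (c z ^ 2 * ℓ ^ 2) * (t * density α m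
        (((μ : Measure (closure D)).map Subtype.val (closedCell ℓ z)).toReal / ℓ ^ 2 + 2 * ε)) ≤
      ENNReal.ofReal (1 + δ) * liminf (fun n => pixelFunctional α D g m n (w n)) atTop +
      ENNReal.ofReal (1 + δ⁻¹) *
        ∑ z ∈ Z, ENNReal.ofReal (C * ∫ x in cell ℓ z, (c z - g x) ^ 2) := by
  classical
  set ρ := (μ : Measure (closure D)).map Subtype.val with hρ
  set E := ENNReal.ofReal (1 + δ⁻¹) *
        ∑ z ∈ Z, ENNReal.ofReal (C * ∫ x in cell ℓ z, (c z - g x) ^ 2) with hE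
  set b : ℤ × ℤ → ℝ := fun z => (ρ (closedCell ℓ z)).toReal / ℓ ^ 2 + ε with hb
  have hb0 : ∀ z, 0 ≤ b z := fun z => by positivity
  have hbε : ∀ z, (ρ (closedCell ℓ z)).toReal / ℓ ^ 2 + 2 * ε = b z + ε := fun z => by
    simp only [hb]; ring
  simp only [hbε]
  have hd0 : ENNReal.ofReal (1 + δ) ≠ 0 := by simp; positivity
  rw [← tsub_le_iff_right, mul_comm, ← ENNReal.div_le_iff hd0 ENNReal.ofReal_ne_top]
  refine le_liminf_of_le (by isBoundedDefault) ?_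
  have hev : ∀ᶠ n : ℕ in atTop, ∀ z ∈ Z, _ := (Filter.eventually_all_finset Z).2 fun z _ =>
    (hC (corner ℓ z) ℓ hℓ hℓ1 (b z) (hb0 z) t ht).and
      (eventually_map_closed_lt hw (isClosed_closedSq (corner ℓ z) ℓ)
        (ε := ε * ℓ ^ 2) (by positivity))
  filter_upwards [hev, eventually_gt_atTop 0] with n hn hn0
  have hn' : (0 : ℝ) < n := by exact_mod_cast hn0
  refine le_iInf fun x => le_iInf fun hx => le_iInf fun hmap => ?_
  rw [ENNReal.div_le_iff hd0 ENNReal.ofReal_ne_top, tsub_le_iff_right,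
    rescaledCompliance_pixelSet hα hg]
  set S := Finset.univ.image x with hS
  have hex : ∀ z, ∃ L : Set Plane, z ∈ Z → MeasurableSet L ∧
      cell ℓ z ∩ balls S (radius m n) ⊆ L ∧
          (∃ χ : Plane → ℝ, ContDiff ℝ ∞ χ ∧ (∀ x, |χ x| ≤ 1) ∧ tsupport χ ⊆ cell ℓ z ∧
            ∀ x ∈ cell ℓ z, x ∉ L → χ x = 1 ∧ fderiv ℝ χ x = 0) ∧
          (∀ c : ℝ, ENNReal.ofReal (c ^ 2 * ℓ ^ 2) * (t * density α m (b z + ε)) ≤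
            n * cpl α 1 (cell ℓ z) L fun _ => c) ∧
          ∀ f : Plane → ℝ, MemLp f 2 (volume.restrict (cell ℓ z)) →
            n * cpl α 1 (cell ℓ z) L f ≤ ENNReal.ofReal (C * ∫ x in cell ℓ z, f x ^ 2) := by
    intro z
    by_cases hz : z ∈ Z
    · obtain ⟨h1, h2⟩ := hn z hz
      refine (h1 S ⟨(Finset.univ.filter fun i => x i ∈ closedCell ℓ z).image x, ?_, ?_⟩).imp
        fun L hL _ => hL
      · change (w n : Measure (closure D)).map Subtype.val (closedCell ℓ z) < _ at h2
        rw [hmap, empirical_apply n x (A := closedCell ℓ z) (isClosed_closedSq _ _).measurableSet,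
          ← ENNReal.div_eq_inv_mul, ENNReal.div_lt_iff (Or.inl (by simpa using hn0.ne'))
          (Or.inl (by simp)), ← ENNReal.ofReal_natCast n,
          ← ENNReal.ofReal_mul (by positivity), ← ENNReal.ofReal_natCast,
          ENNReal.ofReal_lt_ofReal_iff_of_nonneg (Nat.cast_nonneg _)] at h2
        have h3 : (((Finset.univ.filter fun i => x i ∈ closedCell ℓ z).image x).card : ℝ) ≤
          (Finset.univ.filter fun i => x i ∈ closedCell ℓ z).card := by
            exact_mod_cast Finset.card_image_le
        have e : b z * (n * ℓ ^ 2) = ((ρ (closedCell ℓ z)).toReal + ε * ℓ ^ 2) * n := by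
          simp only [hb]; field_simp
        rw [e]
        exact h3.trans h2.le
      · intro y hy hyc
        obtain ⟨i, -, rfl⟩ := Finset.mem_image.1 hy
        exact Finset.mem_image_of_mem _ (Finset.mem_filter.2 ⟨Finset.mem_univ i, hyc⟩)
    · exact ⟨∅, fun h => (hz h).elim⟩
  choose L hL using hex
  have hgz : ∀ z ∈ Z, MemLp g 2 (volume.restrict (cell ℓ z)) := fun z hz =>
    hg.mono_measure (Measure.restrict_mono (hZ z hz) le_rfl)
  have hcz : ∀ z, MemLp (fun _ : Plane => c z) 2 (volume.restrict (cell ℓ z)) := fun z => by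
    have : IsFiniteMeasure (volume.restrict (cell ℓ z)) := ⟨by
      rw [Measure.restrict_apply_univ, cell, volume_openSq _ hℓ.le]; simp⟩
    exact memLp_const _
  have hstep : ∀ z ∈ Z, ENNReal.ofReal (c z ^ 2 * ℓ ^ 2) * (t * density α m (b z + ε)) ≤
      ENNReal.ofReal (1 + δ) * (n * cpl α 1 (cell ℓ z) (L z) g) +
      ENNReal.ofReal (1 + δ⁻¹) * ENNReal.ofReal (C * ∫ x in cell ℓ z, (c z - g x) ^ 2) := by
    intro z hz
    obtain ⟨-, -, -, h4, h5⟩ := hL z hz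
    have h6 := cpl_add_le (α := α) (s := 1) (K := L z) hδ (hgz z hz) ((hcz z).sub (hgz z hz))
    have h7 := h5 _ ((hcz z).sub (hgz z hz))
    simp only [Pi.sub_apply, add_sub_cancel] at h6 h7
    calc _ ≤ n * cpl α 1 (cell ℓ z) (L z) fun _ => c z := h4 (c z)
      _ ≤ n * (ENNReal.ofReal (1 + δ) * cpl α 1 (cell ℓ z) (L z) g +
        ENNReal.ofReal (1 + δ⁻¹) * cpl α 1 (cell ℓ z) (L z) ((fun _ => c z) - g)) :=
          mul_le_mul_right h6 _
      _ = ENNReal.ofReal (1 + δ) * (n * cpl α 1 (cell ℓ z) (L z) g) +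
        ENNReal.ofReal (1 + δ⁻¹) * (n * cpl α 1 (cell ℓ z) (L z) ((fun _ => c z) - g)) := by ring
      _ ≤ _ := by gcongr
  refine (Finset.sum_le_sum hstep).trans ?_
  rw [Finset.sum_add_distrib, ← Finset.mul_sum, ← Finset.mul_sum, ← Finset.mul_sum, ← hE,
    mul_comm _ (ENNReal.ofReal (1 + δ))]
  gcongr
  refine sum_cpl_le hDo.measurableSet (measurableSet_balls _ _) (fun z hz => (hL z hz).1)
    (fun z _ => isOpen_openSq _ _) hZ (pairwiseDisjoint_cell hℓ _) hα hg
    (fun z hz => (hL z hz).2.1) (fun z hz => (hL z hz).2.2.1)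

end Lower

/-! ### Step functions on the grid -/

/-- The step function with value `F z` on the cells of index `z` contained in `D`. -/
def stepFun (ℓ : ℝ) (D : Set Plane) (F : ℤ × ℤ → ℝ≥0∞) (x : Plane) : ℝ≥0∞ :=
  open Classical in if cell ℓ (index ℓ x) ⊆ D then F (index ℓ x) else 0

lemma measurable_index (ℓ : ℝ) : Measurable (index ℓ) := by
  unfold index
  exact (Int.measurable_floor.comp (by fun_prop)).prodMk (Int.measurable_floor.comp (by fun_prop))

lemma measurable_stepFun (ℓ : ℝ) (D : Set Plane) (F : ℤ × ℤ → ℝ≥0∞) :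
    Measurable (stepFun ℓ D F) := by
  classical
  exact (Measurable.of_discrete (f := fun z => if cell ℓ z ⊆ D then F z else 0)).comp
    (measurable_index ℓ)

lemma lintegral_stepFun {ℓ : ℝ} (hℓ : 0 < ℓ) {D : Set Plane} (hD : MeasurableSet D)
    {Z : Finset (ℤ × ℤ)} (hZ : ∀ z, z ∈ Z ↔ cell ℓ z ⊆ D) (F : ℤ × ℤ → ℝ≥0∞) :
    ∫⁻ x in D, stepFun ℓ D F x = ∑ z ∈ Z, F z * ENNReal.ofReal (ℓ ^ 2) := by
  have hcm : ∀ z, MeasurableSet (cell ℓ z) := fun z => (isOpen_openSq _ _).measurableSet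
  have h1 : ∫⁻ x in D, stepFun ℓ D F x = ∫⁻ x in ⋃ z ∈ Z, cell ℓ z, stepFun ℓ D F x := by
    rw [← lintegral_indicator hD,
      ← lintegral_indicator (Finset.measurableSet_biUnion _ fun z _ => hcm z)]
    refine lintegral_congr_ae ?_
    filter_upwards [ae_mem_cell_index hℓ] with x hx
    by_cases hc : cell ℓ (index ℓ x) ⊆ D
    · rw [Set.indicator_of_mem (hc hx), Set.indicator_of_mem]
      exact Set.mem_biUnion ((hZ _).2 hc) hx
    · have : stepFun ℓ D F x = 0 := if_neg hc
      simp [Set.indicator, this]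
  rw [h1, lintegral_biUnion_finset (pairwiseDisjoint_cell hℓ _) fun z _ => hcm z]
  refine Finset.sum_congr rfl fun z hz => ?_
  rw [← volume_openSq (corner ℓ z) hℓ.le, ← setLIntegral_const]
  refine setLIntegral_congr_fun (hcm z) fun x hx => ?_
  rw [stepFun, index_of_mem_cell hℓ hx, if_pos ((hZ z).1 hz)]

lemma eventually_stepFun_eq {ℓ : ℕ → ℝ} (hℓ : ∀ k, 0 < ℓ k) (h0 : Tendsto ℓ atTop (𝓝 0))
    {D : Set Plane} (hD : IsOpen D) {x : Plane} (hx : x ∈ D) (F : ℕ → ℤ × ℤ → ℝ≥0∞) :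
    ∀ᶠ k in atTop, stepFun (ℓ k) D (F k) x = F k (index (ℓ k) x) := by
  obtain ⟨ε, hε, hball⟩ := Metric.nhds_basis_closedBall.mem_iff.1 (hD.mem_nhds hx)
  filter_upwards [h0.eventually_lt_const (show 0 < ε / 2 by positivity)] with k hk
  refine if_pos fun y hy => hball ?_
  have := dist_le_of_mem_closedSq (openSq_subset_closedSq _ _ hy) (mem_closedCell_index (hℓ k) x)
  exact this.trans (by linarith)

lemma corner_mem_closedCell {ℓ : ℝ} (hℓ : 0 < ℓ) (z : ℤ × ℤ) : corner ℓ z ∈ closedCell ℓ z :=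
  fun _ => ⟨le_rfl, by linarith⟩

lemma tendsto_corner_index {ℓ : ℕ → ℝ} (hℓ : ∀ k, 0 < ℓ k) (h0 : Tendsto ℓ atTop (𝓝 0))
    (x : Plane) : Tendsto (fun k => corner (ℓ k) (index (ℓ k) x)) atTop (𝓝 x) := by
  rw [tendsto_iff_dist_tendsto_zero]
  refine squeeze_zero (fun _ => dist_nonneg) (fun k => dist_le_of_mem_closedSq
    (corner_mem_closedCell (hℓ k) _) (mem_closedCell_index (hℓ k) x)) ?_
  simpa using h0.const_mul 2

lemma exists_continuous_approx {D : Set Plane} (hD : MeasurableSet D) {g : Plane → ℝ}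
    (hg : MemLp g 2 (volume.restrict D)) {η : ℝ} (hη : 0 < η) :
    ∃ h : Plane → ℝ, Continuous h ∧ HasCompactSupport h ∧ MemLp h 2 (volume.restrict D) ∧
      ∫ x in D, (h x - g x) ^ 2 ≤ η := by
  have e2 : ENNReal.ofReal 2 = 2 := by simp
  have hg' : MemLp (D.indicator g) (ENNReal.ofReal 2) volume := by
    rw [e2]; exact (memLp_indicator_iff_restrict hD).2 hg
  obtain ⟨h, h1, h2, h3, h4⟩ := hg'.exists_hasCompactSupport_integral_rpow_sub_le two_pos hη
  rw [e2] at h4 hg'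
  refine ⟨h, h3, h1, h4.restrict D, le_trans ?_ h2⟩
  have e : ∀ x, ‖D.indicator g x - h x‖ ^ (2 : ℝ) = (h x - D.indicator g x) ^ 2 := fun x => by
    rw [Real.rpow_two, Real.norm_eq_abs, sq_abs]; ring
  simp only [e]
  calc ∫ x in D, (h x - g x) ^ 2 = ∫ x in D, (h x - D.indicator g x) ^ 2 :=
        setIntegral_congr_fun hD fun x hx => by simp [Set.indicator_of_mem hx]
    _ ≤ ∫ x, (h x - D.indicator g x) ^ 2 :=
        setIntegral_le_integral (h4.sub hg').integrable_sq
          (Eventually.of_forall fun x => sq_nonneg _)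

/-- A sufficiently fine grid on which a continuous function is nearly constant on cells. -/
lemma eventually_sum_integral_le {D : Set Plane} (hD : Bornology.IsBounded D) {g h : Plane → ℝ}
    (hg : MemLp g 2 (volume.restrict D)) (hh : MemLp h 2 (volume.restrict D)) (hc : Continuous h)
    (hs : HasCompactSupport h) {η : ℝ} (hη : 0 < η) (hgh : ∫ x in D, (h x - g x) ^ 2 ≤ η)
    {ℓ : ℕ → ℝ} (hℓ : ∀ k, 0 < ℓ k) (h0 : Tendsto ℓ atTop (𝓝 0)) :
    ∀ᶠ k in atTop, ∀ Z : Finset (ℤ × ℤ), (∀ z ∈ Z, cell (ℓ k) z ⊆ D) →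
      ∑ z ∈ Z, ∫ x in cell (ℓ k) z, (h (corner (ℓ k) z) - g x) ^ 2 ≤ 4 * η := by
  set V := (volume D).toReal with hV
  have hVt : volume D ≠ ⊤ := hD.measure_lt_top.ne
  obtain ⟨β, hβ, hβV⟩ : ∃ β > 0, β ^ 2 * V ≤ η := by
    refine ⟨√(η / (V + 1)), Real.sqrt_pos.2 (by positivity), ?_⟩
    rw [Real.sq_sqrt (by positivity), div_mul_eq_mul_div, div_le_iff₀ (by positivity)]
    nlinarith [ENNReal.toReal_nonneg (a := volume D)]
  obtain ⟨κ, hκ, hunif⟩ := Metric.uniformContinuous_iff.1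
    (hs.uniformContinuous_of_continuous hc) β hβ
  filter_upwards [h0.eventually_lt_const (show 0 < κ / 2 by positivity)] with k hk Z hZ
  have hcm : ∀ z ∈ Z, MeasurableSet (cell (ℓ k) z) := fun z _ => (isOpen_openSq _ _).measurableSet
  have hfin : IsFiniteMeasure (volume.restrict D) := ⟨by simpa using hVt.lt_top⟩
  have hfi : IntegrableOn (fun x => 2 * (h x - g x) ^ 2 + 2 * β ^ 2) D :=
    ((hh.sub hg).integrable_sq.const_mul 2).add (integrable_const _)
  calc ∑ z ∈ Z, ∫ x in cell (ℓ k) z, (h (corner (ℓ k) z) - g x) ^ 2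
      ≤ ∑ z ∈ Z, ∫ x in cell (ℓ k) z, (2 * (h x - g x) ^ 2 + 2 * β ^ 2) := by
        refine Finset.sum_le_sum fun z hz => ?_
        have hm : IsFiniteMeasure (volume.restrict (cell (ℓ k) z)) :=
          ⟨by simpa using (measure_mono (hZ z hz)).trans_lt hVt.lt_top⟩
        have hgz : MemLp g 2 (volume.restrict (cell (ℓ k) z)) :=
          hg.mono_measure (Measure.restrict_mono (hZ z hz) le_rfl)
        refine setIntegral_mono_on ((memLp_const (h (corner (ℓ k) z))).sub hgz).integrable_sq
          (hfi.mono_set (hZ z hz)) (hcm z hz) fun x hx => ?_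
        have h1 : dist (corner (ℓ k) z) x < κ := (dist_le_of_mem_closedSq
          (corner_mem_closedCell (hℓ k) z) (openSq_subset_closedSq _ _ hx)).trans_lt (by linarith)
        have h2 := hunif h1
        rw [Real.dist_eq] at h2
        have h3 : (h (corner (ℓ k) z) - h x) ^ 2 ≤ β ^ 2 := by
          rw [← sq_abs]; gcongr
        nlinarith [sq_nonneg (h (corner (ℓ k) z) - h x - (h x - g x))]
    _ ≤ ∫ x in D, (2 * (h x - g x) ^ 2 + 2 * β ^ 2) :=
        sum_setIntegral_le hcm hZ (pairwiseDisjoint_cell (hℓ k) _) hfi fun x => by positivity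
    _ = 2 * (∫ x in D, (h x - g x) ^ 2) + 2 * β ^ 2 * V := by
        have hi : Integrable (fun x => (h x - g x) ^ 2) (volume.restrict D) :=
          (hh.sub hg).integrable_sq
        rw [integral_add (hi.const_mul 2) (integrable_const _),
          integral_const_mul, integral_const]
        simp [hV, Measure.real, mul_comm]
    _ ≤ 4 * η := by nlinarith

section

variable {α m : ℝ}

lemma measurable_density_add (hα : 0 < α) (hm : 0 < m) {ε : ℝ} (hε : 0 < ε) {u : Plane → ℝ}
    (hu : Measurable u) (hu0 : ∀ x, 0 ≤ u x) : Measurable fun x => density α m (u x + ε) := by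
  have h1 : Antitone fun a : ℝ => density α m (max a 0 + ε) := fun a b hab =>
    density_anti hα hm (by positivity) (by gcongr)
  have e : (fun x => density α m (u x + ε)) = fun x => density α m (max (u x) 0 + ε) := by
    ext x; rw [max_eq_left (hu0 x)]
  rw [e]
  exact h1.measurable.comp hu

lemma lintegral_sq_mul_density_le (hα : 0 < α) (hm : 0 < m) {D : Set Plane} (hDo : IsOpen D)
    (hDb : Bornology.IsBounded D) {g h : Plane → ℝ} (hg : MemLp g 2 (volume.restrict D))
    (hh : MemLp h 2 (volume.restrict D)) (hc : Continuous h) (hs : HasCompactSupport h)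
    {η : ℝ} (hη : 0 < η) (hgh : ∫ x in D, (h x - g x) ^ 2 ≤ η) {ε C : ℝ} (hε : 0 < ε)
    (hC0 : 0 < C) (hC : IsLowerCellConst α m ε C) {t : ℝ≥0∞} (ht : t < 1) {δ : ℝ} (hδ : 0 < δ)
    {μ : ProbabilityMeasure (closure D)}
    {w : ℕ → ProbabilityMeasure (closure D)} (hw : Tendsto w atTop (𝓝 μ)) :
    ∫⁻ x in D, ENNReal.ofReal (h x ^ 2) * (t * density α m ((acDensity μ x).toReal + 2 * ε)) ≤
      ENNReal.ofReal (1 + δ) * liminf (fun n => pixelFunctional α D g m n (w n)) atTop +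
      ENNReal.ofReal (1 + δ⁻¹) * ENNReal.ofReal (C * (4 * η)) := by
  set ρ := (μ : Measure (closure D)).map Subtype.val with hρ
  have hρp : IsProbabilityMeasure ρ :=
    Measure.isProbabilityMeasure_map measurable_subtype_coe.aemeasurable
  set ℓ : ℕ → ℝ := fun k => 1 / ((k : ℝ) + 1) with hℓdef
  have hℓ : ∀ k, 0 < ℓ k := fun k => by positivity
  have h0 : Tendsto ℓ atTop (𝓝 0) := tendsto_one_div_add_atTop_nhds_zero_nat
  have hℓ1 : ∀ k, ℓ k ≤ 1 := fun k => by
    rw [hℓdef]; simp only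
    rw [div_le_one (by positivity)]
    linarith [Nat.cast_nonneg (α := ℝ) k]
  set F : ℕ → ℤ × ℤ → ℝ≥0∞ := fun k z => ENNReal.ofReal (h (corner (ℓ k) z) ^ 2) *
    (t * density α m ((ρ (closedCell (ℓ k) z)).toReal / ℓ k ^ 2 + 2 * ε)) with hF
  have hlim : ∀ᵐ x ∂volume.restrict D, Tendsto (fun k => stepFun (ℓ k) D (F k) x) atTop
      (𝓝 (ENNReal.ofReal (h x ^ 2) * (t * density α m ((acDensity μ x).toReal + 2 * ε)))) := by
    filter_upwards [ae_restrict_of_ae (ae_tendsto_closedCell_div ρ hℓ h0),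
      ae_restrict_of_ae (ρ.rnDeriv_lt_top volume), ae_restrict_mem hDo.measurableSet]
      with x h1 h2 hx
    have k1 : Tendsto (fun k => F k (index (ℓ k) x)) atTop
        (𝓝 (ENNReal.ofReal (h x ^ 2) * (t * density α m ((acDensity μ x).toReal + 2 * ε)))) := by
      have k2 : Tendsto (fun k => ENNReal.ofReal (h (corner (ℓ k) (index (ℓ k) x)) ^ 2)) atTop
          (𝓝 (ENNReal.ofReal (h x ^ 2))) :=
        ENNReal.tendsto_ofReal (((hc.tendsto x).comp (tendsto_corner_index hℓ h0 x)).pow 2)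
      have k3 : Tendsto (fun k => (ρ (closedCell (ℓ k) (index (ℓ k) x))).toReal / ℓ k ^ 2 + 2 * ε)
          atTop (𝓝 ((acDensity μ x).toReal + 2 * ε)) := by
        refine Tendsto.add_const _ (((ENNReal.tendsto_toReal h2.ne).comp h1).congr fun k => ?_)
        have := hℓ k
        simp only [Function.comp, ENNReal.toReal_div]
        rw [ENNReal.toReal_ofReal (by positivity)]
      have hpos : 0 < (acDensity μ x).toReal + 2 * ε := by positivity
      have k4 := (continuousAt_density hα hm hpos).tendsto.comp k3
      have k5 := ENNReal.Tendsto.const_mul k4 (Or.inr (ht.trans ENNReal.one_lt_top).ne)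
      refine ENNReal.Tendsto.mul k2 (Or.inr ?_) k5 (Or.inr ENNReal.ofReal_ne_top)
      exact ENNReal.mul_ne_top (ht.trans ENNReal.one_lt_top).ne (density_ne_top hα hm hpos)
    exact k1.congr' ((eventually_stepFun_eq hℓ h0 hDo hx F).mono fun k hk => hk.symm)
  calc _ = ∫⁻ x in D, liminf (fun k => stepFun (ℓ k) D (F k) x) atTop :=
        lintegral_congr_ae (hlim.mono fun x hx => hx.liminf_eq.symm)
    _ ≤ liminf (fun k => ∫⁻ x in D, stepFun (ℓ k) D (F k) x) atTop :=
        lintegral_liminf_le fun k => measurable_stepFun _ _ _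
    _ ≤ _ := by
        refine liminf_le_of_frequently_le' (Eventually.frequently ?_)
        filter_upwards [eventually_sum_integral_le hDb hg hh hc hs hη hgh hℓ h0] with k hk
        have hfin := finite_setOf_cell_subset (hℓ k) hDb
        have hZ : ∀ z, z ∈ hfin.toFinset ↔ cell (ℓ k) z ⊆ D := fun z => by simp
        rw [lintegral_stepFun (hℓ k) hDo.measurableSet hZ]
        have h1 := sum_density_le hα hDo hg hε hC (hℓ k) (hℓ1 k) (fun z hz => (hZ z).1 hz)
          (fun z => h (corner (ℓ k) z)) ht hδ hw
        refine le_trans (le_of_eq (Finset.sum_congr rfl fun z _ => ?_)) (h1.trans ?_)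
        · simp only [hF]
          rw [ENNReal.ofReal_mul (sq_nonneg _)]
          ring
        · gcongr
          rw [← ENNReal.ofReal_sum_of_nonneg fun z _ => mul_nonneg hC0.le
            (integral_nonneg fun x => sq_nonneg _), ← Finset.mul_sum]
          gcongr
          exact hk _ fun z hz => (hZ z).1 hz

end

/-! ### The lower bound -/

lemma ofReal_sq_le {δ : ℝ} (hδ : 0 < δ) (a b : ℝ) :
    ENNReal.ofReal (a ^ 2) ≤ ENNReal.ofReal (1 + δ) * ENNReal.ofReal (b ^ 2) +
      ENNReal.ofReal (1 + δ⁻¹) * ENNReal.ofReal ((b - a) ^ 2) := by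
  rw [← ENNReal.ofReal_mul (by positivity), ← ENNReal.ofReal_mul (by positivity),
    ← ENNReal.ofReal_add (by positivity) (by positivity)]
  refine ENNReal.ofReal_le_ofReal ?_
  have h : (1 + δ) * b ^ 2 + (1 + δ⁻¹) * (b - a) ^ 2 - a ^ 2 = (δ * b + (b - a)) ^ 2 / δ := by
    field_simp; ring
  have : 0 ≤ (δ * b + (b - a)) ^ 2 / δ := by positivity
  linarith

lemma lintegral_sq_mul_le {δ : ℝ} (hδ : 0 < δ) {D : Set Plane} {f₁ f₂ : Plane → ℝ}
    (h₁ : MemLp f₁ 2 (volume.restrict D)) (h₂ : MemLp f₂ 2 (volume.restrict D)) {η : ℝ}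
    (hη : ∫ x in D, (f₂ x - f₁ x) ^ 2 ≤ η) {d : Plane → ℝ≥0∞} {M : ℝ≥0∞} (hd : ∀ x, d x ≤ M) :
    ∫⁻ x in D, ENNReal.ofReal (f₁ x ^ 2) * d x ≤
      ENNReal.ofReal (1 + δ) * (∫⁻ x in D, ENNReal.ofReal (f₂ x ^ 2) * d x) +
        ENNReal.ofReal (1 + δ⁻¹) * (M * ENNReal.ofReal η) := by
  have hi : Integrable (fun x => (f₂ x - f₁ x) ^ 2) (volume.restrict D) :=
    (h₂.sub h₁).integrable_sq
  have hm : AEMeasurable (fun x => ENNReal.ofReal ((f₂ x - f₁ x) ^ 2)) (volume.restrict D) :=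
    hi.aestronglyMeasurable.aemeasurable.ennreal_ofReal
  calc ∫⁻ x in D, ENNReal.ofReal (f₁ x ^ 2) * d x
      ≤ ∫⁻ x in D, (ENNReal.ofReal (1 + δ) * (ENNReal.ofReal (f₂ x ^ 2) * d x) +
        ENNReal.ofReal (1 + δ⁻¹) * (M * ENNReal.ofReal ((f₂ x - f₁ x) ^ 2))) := by
        refine lintegral_mono fun x => ?_
        calc _ ≤ (ENNReal.ofReal (1 + δ) * ENNReal.ofReal (f₂ x ^ 2) +
              ENNReal.ofReal (1 + δ⁻¹) * ENNReal.ofReal ((f₂ x - f₁ x) ^ 2)) * d x :=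
              mul_le_mul_left (ofReal_sq_le hδ _ _) _
          _ = ENNReal.ofReal (1 + δ) * (ENNReal.ofReal (f₂ x ^ 2) * d x) +
              ENNReal.ofReal (1 + δ⁻¹) * (d x * ENNReal.ofReal ((f₂ x - f₁ x) ^ 2)) := by ring
          _ ≤ _ := by gcongr; exact hd x
    _ = ENNReal.ofReal (1 + δ) * (∫⁻ x in D, ENNReal.ofReal (f₂ x ^ 2) * d x) +
        ENNReal.ofReal (1 + δ⁻¹) * (M * ∫⁻ x in D, ENNReal.ofReal ((f₂ x - f₁ x) ^ 2)) := by
        rw [lintegral_add_right' _ ((hm.const_mul _).const_mul _),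
          lintegral_const_mul' _ _ ENNReal.ofReal_ne_top,
          lintegral_const_mul' _ _ ENNReal.ofReal_ne_top, lintegral_const_mul'' _ hm]
    _ ≤ _ := by
        rw [← ofReal_integral_eq_lintegral_ofReal hi (Eventually.of_forall fun x => sq_nonneg _)]
        gcongr

/-- A number bounded by quantities that tend to `A` with a small parameter. -/
lemma le_of_forall_ofReal_mul_le {X A : ℝ≥0∞}
    (h : ∀ δ : ℝ, 0 < δ → δ < 1 → ENNReal.ofReal (1 - δ) * X ≤ ENNReal.ofReal ((1 + δ) ^ 2) * A) :
    X ≤ A := by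
  have ht : Tendsto (fun δ : ℝ => δ) (𝓝[>] 0) (𝓝 0) := nhdsWithin_le_nhds
  have h1 : Tendsto (fun δ : ℝ => ENNReal.ofReal (1 - δ) * X) (𝓝[>] 0) (𝓝 X) := by
    have := ENNReal.Tendsto.mul_const (b := X) (ENNReal.tendsto_ofReal (ht.const_sub 1))
      (Or.inl (by simp))
    simpa using this
  have h2 : Tendsto (fun δ : ℝ => ENNReal.ofReal ((1 + δ) ^ 2) * A) (𝓝[>] 0) (𝓝 A) := by
    have := ENNReal.Tendsto.mul_const (b := A) (ENNReal.tendsto_ofReal ((ht.const_add 1).pow 2))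
      (Or.inl (by simp))
    simpa using this
  refine le_of_tendsto_of_tendsto h1 h2 ?_
  filter_upwards [Ioo_mem_nhdsGT (zero_lt_one (α := ℝ))] with δ hδ using h δ hδ.1 hδ.2

lemma le_of_forall_le_add_mul {X A B : ℝ≥0∞} (hB : B ≠ ⊤)
    (h : ∀ η : ℝ, 0 < η → X ≤ A + B * ENNReal.ofReal η) : X ≤ A := by
  have ht : Tendsto (fun η : ℝ => η) (𝓝[>] 0) (𝓝 0) := nhdsWithin_le_nhds
  have h2 : Tendsto (fun η : ℝ => A + B * ENNReal.ofReal η) (𝓝[>] 0) (𝓝 (A + B * 0)) := by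
    refine tendsto_const_nhds.add (ENNReal.Tendsto.const_mul ?_ (Or.inr hB))
    simpa using ENNReal.tendsto_ofReal ht
  rw [mul_zero, add_zero] at h2
  exact ge_of_tendsto h2 (eventually_nhdsWithin_of_forall fun η hη => h η hη)

section

variable {α m : ℝ} {D : Set Plane} {g : Plane → ℝ}

lemma lintegral_density_add_le_liminf (hα : 0 < α) (hm : 0 < m) (hDo : IsOpen D)
    (hDb : Bornology.IsBounded D) (hg : MemLp g 2 (volume.restrict D)) {ε : ℝ} (hε : 0 < ε)
    {μ : ProbabilityMeasure (closure D)}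
    {w : ℕ → ProbabilityMeasure (closure D)} (hw : Tendsto w atTop (𝓝 μ)) :
    ∫⁻ x in D, ENNReal.ofReal (g x ^ 2) * density α m ((acDensity μ x).toReal + 2 * ε) ≤
      liminf (fun n => pixelFunctional α D g m n (w n)) atTop := by
  obtain ⟨C, hC0, hC⟩ := exists_lower_cell hα hm hε
  set A := liminf (fun n => pixelFunctional α D g m n (w n)) atTop with hA
  set d : Plane → ℝ≥0∞ := fun x => density α m ((acDensity μ x).toReal + 2 * ε) with hd
  set M := density α m (2 * ε) with hM
  have hMt : M ≠ ⊤ := density_ne_top hα hm (by positivity)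
  have hdM : ∀ x, d x ≤ M := fun x =>
    density_anti hα hm (by positivity) (by linarith [ENNReal.toReal_nonneg (a := acDensity μ x)])
  refine le_of_forall_ofReal_mul_le fun δ hδ hδ1 => ?_
  set t := ENNReal.ofReal (1 - δ) with ht
  have ht1 : t < 1 := by
    rw [ht, ← ENNReal.ofReal_one]
    exact (ENNReal.ofReal_lt_ofReal_iff one_pos).2 (by linarith)
  refine le_of_forall_le_add_mul (B := ENNReal.ofReal (1 + δ) *
    (ENNReal.ofReal (1 + δ⁻¹) * ENNReal.ofReal (C * 4)) + ENNReal.ofReal (1 + δ⁻¹) * M) ?_ ?_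
  · exact ENNReal.add_ne_top.2 ⟨ENNReal.mul_ne_top ENNReal.ofReal_ne_top
      (ENNReal.mul_ne_top ENNReal.ofReal_ne_top ENNReal.ofReal_ne_top),
      ENNReal.mul_ne_top ENNReal.ofReal_ne_top hMt⟩
  intro η hη
  obtain ⟨h, hc, hs, hh, hgh⟩ := exists_continuous_approx hDo.measurableSet hg hη
  have h1 := lintegral_sq_mul_density_le hα hm hDo hDb hg hh hc hs hη hgh hε hC0 hC ht1 hδ hw
  have h2 := lintegral_sq_mul_le hδ hg hh hgh (d := fun x => t * d x) (M := M)
    fun x => (mul_le_of_le_one_left zero_le ht1.le).trans (hdM x)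
  calc t * ∫⁻ x in D, ENNReal.ofReal (g x ^ 2) * d x
      = ∫⁻ x in D, ENNReal.ofReal (g x ^ 2) * (t * d x) := by
        rw [← lintegral_const_mul' _ _ ENNReal.ofReal_ne_top]
        refine lintegral_congr fun x => by ring
    _ ≤ _ := h2
    _ ≤ ENNReal.ofReal (1 + δ) * (ENNReal.ofReal (1 + δ) * A +
        ENNReal.ofReal (1 + δ⁻¹) * ENNReal.ofReal (C * (4 * η))) +
        ENNReal.ofReal (1 + δ⁻¹) * (M * ENNReal.ofReal η) := by gcongr
    _ = _ := by
        rw [ENNReal.ofReal_pow (by positivity), ← mul_assoc C,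
          ENNReal.ofReal_mul (p := C * 4) (by positivity)]
        ring

lemma integrand_eq {u : ℝ≥0∞} (ht : u ≠ ⊤) (c : ℝ≥0∞) :
    c / u * theta α (m * √u.toReal) = c * density α m u.toReal := by
  rw [density, ENNReal.ofReal_toReal ht, ENNReal.div_eq_inv_mul, ENNReal.div_eq_inv_mul]
  ring

lemma limitFunctional_le_liminf (hα : 0 < α) (hm : 0 < m) (hDo : IsOpen D)
    (hDb : Bornology.IsBounded D) (hg : MemLp g 2 (volume.restrict D))
    {μ : ProbabilityMeasure (closure D)}
    {w : ℕ → ProbabilityMeasure (closure D)} (hw : Tendsto w atTop (𝓝 μ)) :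
    limitFunctional α D g m μ ≤ liminf (fun n => pixelFunctional α D g m n (w n)) atTop := by
  have hρp : IsProbabilityMeasure ((μ : Measure (closure D)).map Subtype.val) :=
    Measure.isProbabilityMeasure_map measurable_subtype_coe.aemeasurable
  set ε : ℕ → ℝ := fun k => 1 / ((k : ℝ) + 1) with hε
  have hε0 : ∀ k, 0 < ε k := fun k => by positivity
  have hεt : Tendsto ε atTop (𝓝 0) := tendsto_one_div_add_atTop_nhds_zero_nat
  have hεt2 : Tendsto (fun k => 2 * ε k) atTop (𝓝 0) := by simpa using hεt.const_mul 2
  have hmeas : Measurable fun x => (acDensity μ x).toReal :=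
    (Measure.measurable_rnDeriv _ _).ennreal_toReal
  calc limitFunctional α D g m μ
      ≤ ∫⁻ x in D, liminf (fun k => ENNReal.ofReal (g x ^ 2) *
          density α m ((acDensity μ x).toReal + 2 * ε k)) atTop := by
        refine lintegral_mono_ae ?_
        filter_upwards [ae_restrict_of_ae
          (((μ : Measure (closure D)).map Subtype.val).rnDeriv_lt_top volume)] with x hx
        change acDensity μ x < ⊤ at hx
        by_cases hgx : g x = 0
        · simp [hgx]
        have hg0 : ENNReal.ofReal (g x ^ 2) ≠ 0 := by simp; positivity
        by_cases hu : acDensity μ x = 0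
        · have h1 : Tendsto (fun k => ENNReal.ofReal (g x ^ 2) *
              density α m ((acDensity μ x).toReal + 2 * ε k)) atTop (𝓝 ⊤) := by
            have h2 : Tendsto (fun k => density α m ((acDensity μ x).toReal + 2 * ε k)) atTop
                (𝓝 ⊤) := by
              refine (tendsto_density_top hα hm).comp (tendsto_nhdsWithin_iff.2 ⟨?_, ?_⟩)
              · simpa [hu] using hεt2
              · exact Eventually.of_forall fun k => by simpa [hu] using hε0 k
            have := ENNReal.Tendsto.const_mul h2 (a := ENNReal.ofReal (g x ^ 2)) (Or.inl (by simp))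
            rwa [ENNReal.mul_top hg0] at this
          rw [h1.liminf_eq]
          exact le_top
        · rw [integrand_eq hx.ne]
          have hpos := ENNReal.toReal_pos hu hx.ne
          have h3 : Tendsto (fun k => (acDensity μ x).toReal + 2 * ε k) atTop
              (𝓝 (acDensity μ x).toReal) := by simpa using hεt2.const_add (acDensity μ x).toReal
          have h1 := ENNReal.Tendsto.const_mul (a := ENNReal.ofReal (g x ^ 2))
            ((continuousAt_density hα hm hpos).tendsto.comp h3) (Or.inr ENNReal.ofReal_ne_top)
          exact h1.liminf_eq.ge
    _ ≤ liminf (fun k => ∫⁻ x in D, ENNReal.ofReal (g x ^ 2) *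
          density α m ((acDensity μ x).toReal + 2 * ε k)) atTop := by
        refine lintegral_liminf_le' fun k => ?_
        refine (hg.integrable_sq.aestronglyMeasurable.aemeasurable.ennreal_ofReal).mul ?_
        have := hε0 k
        exact (measurable_density_add hα hm (by positivity) hmeas
          fun x => ENNReal.toReal_nonneg).aemeasurable
    _ ≤ _ := liminf_le_of_frequently_le' (Eventually.frequently (Eventually.of_forall fun k =>
        lintegral_density_add_le_liminf hα hm hDo hDb hg (hε0 k) hw))

end

/-! ### Configurations of balls -/

lemma mem_index_fiber_closedCell {ℓ : ℝ} (hℓ : 0 < ℓ) {x : Plane} {z : ℤ × ℤ} (h : index ℓ x = z) :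
    x ∈ closedCell ℓ z := h ▸ mem_closedCell_index hℓ x

lemma exists_cover {B W : Set Plane} (hB : Bornology.IsBounded B) {r : ℝ} (hr : 0 < r)
    (hW : ∀ x ∈ B, Metric.closedBall x r ⊆ W) :
    ∃ T : Finset Plane, (∀ x ∈ T, x ∈ B) ∧ B ⊆ balls T r ∧
      T.card * ENNReal.ofReal (r ^ 2 / 4) ≤ volume W := by
  classical
  have hr2 : 0 < r / 2 := by positivity
  have hfin : (index (r / 2) '' B).Finite :=
    (finite_setOf_closedCell_inter hr2 hB).subset (by
      rintro _ ⟨x, hx, rfl⟩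
      exact ⟨x, mem_closedCell_index hr2 x, hx⟩)
  choose! q hq using fun z (hz : z ∈ index (r / 2) '' B) => hz
  refine ⟨hfin.toFinset.image q, ?_, ?_, ?_⟩
  · intro x hx
    obtain ⟨z, hz, rfl⟩ := Finset.mem_image.1 hx
    exact (hq z (by simpa using hz)).1
  · intro x hx
    have hz : index (r / 2) x ∈ index (r / 2) '' B := ⟨x, hx, rfl⟩
    refine mem_balls.2 ⟨q (index (r / 2) x),
      Finset.mem_image_of_mem _ (by simpa using ⟨x, hx, rfl⟩), ?_⟩
    have := dist_le_of_mem_closedSq (mem_closedCell_index hr2 x)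
      (mem_index_fiber_closedCell hr2 (hq _ hz).2)
    linarith
  · calc ((hfin.toFinset.image q).card : ℝ≥0∞) * ENNReal.ofReal (r ^ 2 / 4)
        ≤ hfin.toFinset.card * ENNReal.ofReal (r ^ 2 / 4) := by
          gcongr; exact Finset.card_image_le
      _ = ∑ z ∈ hfin.toFinset, volume (cell (r / 2) z) := by
          simp only [cell, volume_openSq _ hr2.le, Finset.sum_const, nsmul_eq_mul, div_pow]
          norm_num
      _ = volume (⋃ z ∈ hfin.toFinset, cell (r / 2) z) :=
          (measure_biUnion_finset (pairwiseDisjoint_cell hr2 _)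
            fun z _ => (isOpen_openSq _ _).measurableSet).symm
      _ ≤ volume W := by
          refine measure_mono (Set.iUnion₂_subset fun z hz y hy => ?_)
          obtain ⟨h1, h2⟩ := hq z (by simpa using hz)
          refine hW _ h1 ?_
          have := dist_le_of_mem_closedSq (openSq_subset_closedSq _ _ hy)
            (mem_index_fiber_closedCell hr2 h2)
          rw [Metric.mem_closedBall]
          linarith

lemma isPreconnected_closedSq (p : Plane) (ℓ : ℝ) : IsPreconnected (closedSq p ℓ) := by
  refine Convex.isPreconnected ?_
  simp only [closedSq, Set.ofPred_forall]
  exact convex_iInter fun i => (convex_Icc _ _).linear_preimage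
    (EuclideanSpace.proj (𝕜 := ℝ) i : Plane →L[ℝ] ℝ).toLinearMap

lemma mem_cthickening_frontier {ℓ : ℝ} (hℓ : 0 < ℓ) {D : Set Plane} (hD : IsOpen D) {x : Plane}
    (hx : x ∈ D) (hc : ¬ cell ℓ (index ℓ x) ⊆ D) : x ∈ Metric.cthickening (2 * ℓ) (frontier D) := by
  have h1 : ¬ closedCell ℓ (index ℓ x) ⊆ D := fun h => hc ((openSq_subset_closedSq _ _).trans h)
  have h2 : ¬ closure D ∩ closedCell ℓ (index ℓ x) ⊆ D := fun h => h1 <|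
    (isPreconnected_closedSq _ _).subset_of_closure_inter_subset hD
      ⟨x, mem_closedCell_index hℓ x, hx⟩ h
  obtain ⟨y, ⟨hy1, hy2⟩, hy3⟩ := Set.not_subset.1 h2
  refine Metric.mem_cthickening_of_dist_le x y _ _ ?_
    (dist_le_of_mem_closedSq (mem_closedCell_index hℓ x) hy2)
  rw [hD.frontier_eq]
  exact ⟨hy1, hy3⟩

lemma exists_fin_of_multiset (M : Multiset Plane) {n : ℕ} (hn : M.card = n) :
    ∃ x : Fin n → Plane, Finset.univ.val.map x = M := by
  subst hn
  obtain ⟨l, rfl⟩ : ∃ l : List Plane, (l : Multiset Plane) = M := ⟨M.toList, M.coe_toList⟩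
  exact ⟨l.get, (Fin.univ_val_map l.get).trans (congrArg _ (List.ofFn_get l))⟩

lemma exists_configuration {ι : Type*} (I : Finset ι) (K : ι → ℕ) (S : ι → Finset Plane)
    (p : ι → Plane) (T : Finset Plane) (p₀ : Plane) {n : ℕ} (hS : ∀ z ∈ I, (S z).card ≤ K z)
    (hn : ∑ z ∈ I, K z + T.card ≤ n) :
    ∃ x : Fin n → Plane, (∀ z ∈ I, S z ⊆ Finset.univ.image x) ∧ T ⊆ Finset.univ.image x ∧
      (∀ i, x i = p₀ ∨ x i ∈ T ∨ ∃ z ∈ I, x i ∈ S z ∨ x i = p z) ∧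
      ∀ (G : Set Plane) [DecidablePred fun i => x i ∈ G] (J : Finset ι), J ⊆ I →
        (∀ z ∈ J, p z ∈ G ∧ ∀ y ∈ S z, y ∈ G) →
          ∑ z ∈ J, K z ≤ (Finset.univ.filter fun i => x i ∈ G).card := by
  classical
  set P : ι → Multiset Plane := fun z => (S z).val + Multiset.replicate (K z - (S z).card) (p z)
    with hP
  have hPc : ∀ z ∈ I, (P z).card = K z := fun z hz => by
    simp only [hP, Multiset.card_add, Finset.card_val, Multiset.card_replicate]
    have := hS z hz
    omega
  set M : Multiset Plane := ∑ z ∈ I, P z + T.val +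
    Multiset.replicate (n - (∑ z ∈ I, K z + T.card)) p₀ with hM
  have hMc : M.card = n := by
    simp only [hM, Multiset.card_add, Multiset.card_sum, Finset.card_val, Multiset.card_replicate]
    rw [Finset.sum_congr rfl hPc]
    exact Nat.add_sub_cancel' hn
  obtain ⟨x, hx⟩ := exists_fin_of_multiset M hMc
  have hmem : ∀ y, y ∈ Finset.univ.image x ↔ y ∈ M := fun y => by
    rw [← hx]; simp
  have hmemM : ∀ y, y ∈ M ↔ ((∃ z ∈ I, y ∈ P z) ∨ y ∈ T) ∨
      y ∈ Multiset.replicate (n - (∑ z ∈ I, K z + T.card)) p₀ := fun y => by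
    simp only [hM, Multiset.mem_add, Multiset.mem_sum, Finset.mem_val]
  refine ⟨x, fun z hz y hy => ?_, fun y hy => ?_, fun i => ?_, fun G _ J hJ hG => ?_⟩
  · exact (hmem y).2 ((hmemM y).2 (Or.inl (Or.inl ⟨z, hz, Multiset.mem_add.2 (Or.inl hy)⟩)))
  · exact (hmem y).2 ((hmemM y).2 (Or.inl (Or.inr hy)))
  · have hi : x i ∈ M := (hmem _).1 (Finset.mem_image_of_mem _ (Finset.mem_univ i))
    rcases (hmemM _).1 hi with (⟨z, hz, h⟩ | h) | h
    · refine Or.inr (Or.inr ⟨z, hz, ?_⟩)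
      rcases Multiset.mem_add.1 h with h | h
      · exact Or.inl h
      · exact Or.inr (Multiset.eq_of_mem_replicate h)
    · exact Or.inr (Or.inl h)
    · exact Or.inl (Multiset.eq_of_mem_replicate h)
  · have h1 : (Finset.univ.filter fun i => x i ∈ G).card = M.countP (· ∈ G) := by
      rw [← hx, Multiset.countP_map, Finset.card, Finset.filter_val]; congr!
    have h2 : ∑ z ∈ J, P z ≤ M := by
      rw [hM, add_assoc]
      exact (Finset.sum_le_sum_of_subset hJ).trans (Multiset.le_add_right _ _)
    have h3 : (∑ z ∈ J, P z).countP (· ∈ G) = (∑ z ∈ J, P z).card := by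
      rw [Multiset.countP_eq_card]
      intro y hy
      obtain ⟨z, hz, hy⟩ := Multiset.mem_sum.1 hy
      rcases Multiset.mem_add.1 hy with h | h
      · exact (hG z hz).2 y h
      · exact Multiset.eq_of_mem_replicate h ▸ (hG z hz).1
    rw [h1, ← Finset.sum_congr rfl fun z hz => hPc z (hJ hz), ← Multiset.card_sum, ← h3]
    exact Multiset.countP_le_of_le _ h2

/-! ### The upper bound on a fixed grid -/

section Upper

variable {α m : ℝ} {D : Set Plane} {g : Plane → ℝ}

lemma measurableSet_index_fiber (ℓ : ℝ) (z : ℤ × ℤ) : MeasurableSet (index ℓ ⁻¹' {z}) :=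
  measurable_index ℓ (MeasurableSet.singleton z)

lemma measure_biUnion_index_fiber (ρ : Measure Plane) (ℓ : ℝ) (J : Finset (ℤ × ℤ)) :
    ρ (⋃ z ∈ J, index ℓ ⁻¹' {z}) = ∑ z ∈ J, ρ (index ℓ ⁻¹' {z}) :=
  measure_biUnion_finset (fun _ _ _ _ hne => (Set.disjoint_singleton.2 hne).preimage _)
    fun z _ => measurableSet_index_fiber ℓ z

lemma exists_boundary_cover (hm : 0 < m) (hDo : IsOpen D) (hDb : Bornology.IsBounded D) {ℓ : ℝ}
    (hℓ : 0 < ℓ) {β : ℝ} (hβ : 0 < β)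
    (hv : volume (Metric.cthickening (3 * ℓ) (frontier D)) ≤ ENNReal.ofReal (β * m ^ 2 / 4)) :
    ∀ᶠ n : ℕ in atTop, ∃ T : Finset Plane, (T.card : ℝ) ≤ β * n ∧ (∀ x ∈ T, x ∈ D) ∧
      ∀ x ∈ D, ¬ cell ℓ (index ℓ x) ⊆ D → x ∈ balls T (radius m n) := by
  have hr : Tendsto (fun n : ℕ => radius m n) atTop (𝓝 0) :=
    (tendsto_div_sqrt m).comp tendsto_natCast_atTop_atTop
  filter_upwards [hr.eventually_le_const hℓ, eventually_gt_atTop 0] with n hn hn0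
  have hn' : (0 : ℝ) < n := by exact_mod_cast hn0
  have hr0 : 0 < radius m n := by rw [radius]; positivity
  obtain ⟨T, h1, h2, h3⟩ := exists_cover (B := {x ∈ D | ¬ cell ℓ (index ℓ x) ⊆ D})
    (hDb.subset fun x hx => hx.1) hr0 (W := Metric.cthickening (3 * ℓ) (frontier D)) (by
      rintro x ⟨hx, hxc⟩ y hy
      have h1 := mem_cthickening_frontier hℓ hDo hx hxc
      have h2 := Metric.mem_cthickening_of_dist_le y x _ _ h1 hy
      refine Metric.cthickening_mono ?_ _
        (Metric.cthickening_cthickening_subset hr0.le (by positivity) _ h2)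
      linarith)
  refine ⟨T, ?_, fun x hx => (h1 x hx).1, fun x hx hxc => h2 ⟨hx, hxc⟩⟩
  have h4 := h3.trans hv
  rw [← ENNReal.ofReal_natCast, ← ENNReal.ofReal_mul (Nat.cast_nonneg _),
    ENNReal.ofReal_le_ofReal_iff (by positivity), radius, div_pow, Real.sq_sqrt hn'.le] at h4
  have h5 : (T.card : ℝ) * (m ^ 2 / n / 4) * (4 * n / m ^ 2) ≤
      β * m ^ 2 / 4 * (4 * n / m ^ 2) := by gcongr
  have e1 : (T.card : ℝ) * (m ^ 2 / n / 4) * (4 * n / m ^ 2) = T.card := by field_simp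
  have e2 : β * m ^ 2 / 4 * (4 * n / m ^ 2) = β * n := by field_simp
  rwa [e1, e2] at h5

lemma exists_recovery_on_grid (hα : 0 < α) (hm : 0 < m) (hDo : IsOpen D)
    (hDb : Bornology.IsBounded D) (hDne : D.Nonempty) (hg : MemLp g 2 (volume.restrict D))
    {ρ : Measure Plane} [IsFiniteMeasure ρ] {v : Plane → ℝ≥0∞}
    (hvρ : volume.withDensity v ≤ ρ) {ε C : ℝ} (hε : 0 < ε)
    (hC : IsUpperCellConst α m ε C) {ℓ : ℝ} (hℓ : 0 < ℓ) {β : ℝ} (hβ : 0 < β)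
    (hβv : volume (Metric.cthickening (3 * ℓ) (frontier D)) ≤ ENNReal.ofReal (β * m ^ 2 / 4))
    (htot : (ρ Set.univ).toReal + 2 * ε * (volume D).toReal + β ≤ 1)
    {Z : Finset (ℤ × ℤ)} (hZ : ∀ z, z ∈ Z ↔ cell ℓ z ⊆ D) (c : ℤ × ℤ → ℝ) {δ : ℝ} (hδ : 0 < δ)
    {κ : ℝ} (hκ : 0 < κ) :
    ∀ᶠ n : ℕ in atTop, ∃ x : Fin n → Plane, (∀ i, x i ∈ closure D) ∧
      n * cpl α 1 D (balls (Finset.univ.image x) (radius m n)) g ≤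
        ENNReal.ofReal (1 + δ) * ∑ z ∈ Z, ENNReal.ofReal (c z ^ 2 * ℓ ^ 2) *
          (density α m ((volume.withDensity v (closedCell ℓ z)).toReal / ℓ ^ 2 + ε) +
            ENNReal.ofReal κ) +
        ENNReal.ofReal (1 + δ⁻¹) *
          ∑ z ∈ Z, ENNReal.ofReal (C * ∫ x in cell ℓ z, (c z - g x) ^ 2) ∧
      ∀ G : Set Plane, IsOpen G → ρ {y ∈ closure D | Metric.closedBall y (2 * ℓ) ⊆ G} ≤
        empirical n x G + ENNReal.ofReal κ := by
  classical
  set a : ℤ × ℤ → ℝ := fun z => (volume.withDensity v (closedCell ℓ z)).toReal / ℓ ^ 2 + ε with ha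
  have ha0 : ∀ z, 0 < a z := fun z => by positivity
  have hfin := finite_setOf_closedCell_inter hℓ hDb.closure
  set I := hfin.toFinset with hI
  have hIm : ∀ z, z ∈ I ↔ (closedCell ℓ z ∩ closure D).Nonempty := fun z => by simp [hI]
  have hZI : Z ⊆ I := fun z hz => by
    obtain ⟨x, hx⟩ := openSq_nonempty (corner ℓ z) hℓ
    exact (hIm z).2 ⟨x, openSq_subset_closedSq _ _ hx, subset_closure ((hZ z).1 hz hx)⟩
  set b : ℤ × ℤ → ℝ := fun z => (ρ (index ℓ ⁻¹' {z})).toReal + if z ∈ Z then 2 * ε * ℓ ^ 2 else 0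
    with hb
  have hb0 : ∀ z, 0 ≤ b z := fun z => by
    simp only [hb]; split_ifs <;> positivity
  have hbsum : ∑ z ∈ I, b z ≤ (ρ Set.univ).toReal + 2 * ε * (volume D).toReal := by
    rw [hb, Finset.sum_add_distrib]
    gcongr
    · rw [← ENNReal.toReal_sum fun z _ => measure_ne_top _ _, ← measure_biUnion_index_fiber]
      exact ENNReal.toReal_mono (measure_ne_top _ _) (measure_mono (Set.subset_univ _))
    · rw [Finset.sum_ite_mem, Finset.inter_eq_right.2 hZI, ← Finset.mul_sum]
      gcongr
      have h1 : ∑ z ∈ Z, volume (cell ℓ z) ≤ volume D := by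
        rw [← measure_biUnion_finset (pairwiseDisjoint_cell hℓ _)
          fun z _ => (isOpen_openSq _ _).measurableSet]
        exact measure_mono (Set.iUnion₂_subset fun z hz => (hZ z).1 hz)
      have h2 := ENNReal.toReal_mono hDb.measure_lt_top.ne h1
      simp only [cell, volume_openSq _ hℓ.le] at h2
      rwa [ENNReal.toReal_sum fun z _ => ENNReal.ofReal_ne_top,
        Finset.sum_congr rfl fun z _ => ENNReal.toReal_ofReal (sq_nonneg ℓ)] at h2
  have hab : ∀ z ∈ Z, (a z + ε) * ℓ ^ 2 ≤ b z := by
    intro z hz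
    have h1 : volume.withDensity v (closedCell ℓ z) = volume.withDensity v (index ℓ ⁻¹' {z}) := by
      refine measure_congr ((withDensity_absolutelyContinuous volume v).ae_eq ?_)
      refine Filter.EventuallyLE.antisymm ?_ ?_
      · refine (closedSq_ae_eq _ _).le.trans (LE.le.eventuallyLE ?_)
        exact fun y hy => index_of_mem_cell hℓ hy
      · exact LE.le.eventuallyLE fun y hy => mem_index_fiber_closedCell hℓ hy
    have h2 : (volume.withDensity v (closedCell ℓ z)).toReal ≤ (ρ (index ℓ ⁻¹' {z})).toReal := by
      rw [h1]
      exact ENNReal.toReal_mono (measure_ne_top _ _) (hvρ _)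
    have e : (a z + ε) * ℓ ^ 2 =
        (volume.withDensity v (closedCell ℓ z)).toReal + 2 * ε * ℓ ^ 2 := by
      simp only [ha]; field_simp; ring
    rw [e, hb]
    simp only [hz, if_true]
    linarith
  obtain ⟨p₀, hp₀⟩ := hDne
  choose! p hp using fun z (hz : z ∈ I) => (hIm z).1 hz
  have hev : ∀ᶠ n : ℕ in atTop, ∀ z ∈ Z, _ := (Filter.eventually_all_finset Z).2 fun z _ =>
    hC (corner ℓ z) ℓ hℓ (a z) (ha0 z) (density α m (a z) + ENNReal.ofReal κ)
      (ENNReal.lt_add_right (density_ne_top hα hm (ha0 z)) (by simpa using hκ))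
  have hcardI : ∀ᶠ n : ℕ in atTop, (I.card : ℝ) ≤ κ * n :=
    (tendsto_natCast_atTop_atTop.const_mul_atTop hκ).eventually_ge_atTop _
  filter_upwards [hev, hcardI, exists_boundary_cover hm hDo hDb hℓ hβ hβv, eventually_gt_atTop 0]
    with n hn hIn hT hn0
  have hn' : (0 : ℝ) < n := by exact_mod_cast hn0
  obtain ⟨T, hTc, hTD, hTcov⟩ := hT
  choose! S' hS' using hn
  set S : ℤ × ℤ → Finset Plane := fun z => if z ∈ Z then S' z else ∅ with hS
  have hSZ : ∀ z ∈ Z, S z = S' z := fun z hz => if_pos hz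
  set K : ℤ × ℤ → ℕ := fun z => ⌊b z * n⌋₊ with hK
  have hSK : ∀ z ∈ I, (S z).card ≤ K z := by
    intro z _
    by_cases hz : z ∈ Z
    · rw [hSZ z hz]
      refine Nat.le_floor ((hS' z hz).1.trans ?_)
      have := mul_le_mul_of_nonneg_right (hab z hz) hn'.le
      linarith
    · simp [hS, hz]
  have hKn : ∑ z ∈ I, K z + T.card ≤ n := by
    have h1 : ∑ z ∈ I, (K z : ℝ) ≤ (∑ z ∈ I, b z) * n := by
      rw [Finset.sum_mul]
      exact Finset.sum_le_sum fun z _ => Nat.floor_le (mul_nonneg (hb0 z) hn'.le)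
    have h2 : (∑ z ∈ I, (K z : ℝ)) + T.card ≤ n := by nlinarith
    exact_mod_cast h2
  obtain ⟨x, hxS, hxT, hxm, hxG⟩ := exists_configuration I K S p T p₀ hSK hKn
  have hScl : ∀ z ∈ I, ∀ y ∈ S z, y ∈ closedCell ℓ z ∧ y ∈ closure D := by
    intro z _ y hy
    by_cases hz : z ∈ Z
    · rw [hSZ z hz] at hy
      have h1 := (hS' z hz).2.1 y hy
      exact ⟨h1, closure_mono ((hZ z).1 hz) (closedSq_subset_closure _ hℓ h1)⟩
    · simp [hS, hz] at hy
  refine ⟨x, ?_, ?_, ?_⟩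
  · intro i
    rcases hxm i with h | h | ⟨z, hz, h | h⟩
    · rw [h]; exact subset_closure hp₀
    · exact subset_closure (hTD _ h)
    · exact (hScl z hz _ h).2
    · rw [h]; exact (hp z hz).2
  · set B := balls (Finset.univ.image x) (radius m n) with hB
    have hgz : ∀ z ∈ Z, MemLp g 2 (volume.restrict (cell ℓ z)) := fun z hz =>
      hg.mono_measure (Measure.restrict_mono ((hZ z).1 hz) le_rfl)
    have hcz : ∀ z, MemLp (fun _ : Plane => c z) 2 (volume.restrict (cell ℓ z)) := fun z => by
      have : IsFiniteMeasure (volume.restrict (cell ℓ z)) := ⟨by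
        rw [Measure.restrict_apply_univ, cell, volume_openSq _ hℓ.le]; simp⟩
      exact memLp_const _
    have hstep : ∀ z ∈ Z, n * cpl α 0 (cell ℓ z) B g ≤
        ENNReal.ofReal (1 + δ) * (ENNReal.ofReal (c z ^ 2 * ℓ ^ 2) *
          (density α m (a z) + ENNReal.ofReal κ)) +
        ENNReal.ofReal (1 + δ⁻¹) * ENNReal.ofReal (C * ∫ x in cell ℓ z, (c z - g x) ^ 2) := by
      intro z hz
      obtain ⟨-, -, h3, h4⟩ := hS' z hz
      have hBz : balls (S' z) (radius m n) ⊆ B :=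
        balls_mono (hSZ z hz ▸ hxS z (hZI hz)) le_rfl
      have h5 := cpl_add_le (α := α) (s := 0) (K := B) hδ (hcz z) ((hgz z hz).sub (hcz z))
      have h6 := h4 _ ((hgz z hz).sub (hcz z))
      have e : ∀ y, (g y - c z) ^ 2 = (c z - g y) ^ 2 := fun y => by ring
      simp only [Pi.sub_apply, add_sub_cancel, e] at h5 h6
      calc n * cpl α 0 (cell ℓ z) B g
          ≤ n * (ENNReal.ofReal (1 + δ) * cpl α 0 (cell ℓ z) B (fun _ => c z) +
            ENNReal.ofReal (1 + δ⁻¹) * cpl α 0 (cell ℓ z) B (g - fun _ => c z)) :=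
            mul_le_mul_right h5 _
        _ ≤ n * (ENNReal.ofReal (1 + δ) *
              cpl α 0 (cell ℓ z) (balls (S' z) (radius m n)) (fun _ => c z) +
            ENNReal.ofReal (1 + δ⁻¹) *
              cpl α 0 (cell ℓ z) (balls (S' z) (radius m n)) (g - fun _ => c z)) := by
            gcongr <;> exact cpl_mono_set (Set.inter_subset_right.trans hBz)
        _ = ENNReal.ofReal (1 + δ) *
              (n * cpl α 0 (cell ℓ z) (balls (S' z) (radius m n)) (fun _ => c z)) +
            ENNReal.ofReal (1 + δ⁻¹) *
              (n * cpl α 0 (cell ℓ z) (balls (S' z) (radius m n)) (g - fun _ => c z)) := by ring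
        _ ≤ _ := add_le_add (mul_le_mul_right (h3 (c z)) _) (mul_le_mul_right h6 _)
    have hsum : cpl α 0 D B g ≤ ∑ z ∈ Z, cpl α 0 (cell ℓ z) B g := by
      refine cpl_le_sum hDo.measurableSet (measurableSet_balls _ _)
        (fun z _ => (isOpen_openSq _ _).measurableSet) (fun z hz => (hZ z).1 hz)
        (pairwiseDisjoint_cell hℓ _) hα.le hg ?_
      filter_upwards [ae_restrict_of_ae (ae_mem_cell_index hℓ),
        ae_restrict_mem hDo.measurableSet] with y hy hyD hyU
      refine balls_mono hxT le_rfl (hTcov y hyD fun hc => hyU ?_)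
      exact Set.mem_biUnion ((hZ _).2 hc) hy
    calc n * cpl α 1 D B g ≤ n * ∑ z ∈ Z, cpl α 0 (cell ℓ z) B g :=
          mul_le_mul_right ((cpl_mono_mass zero_le_one).trans hsum) _
      _ = ∑ z ∈ Z, n * cpl α 0 (cell ℓ z) B g := Finset.mul_sum _ _ _
      _ ≤ _ := Finset.sum_le_sum hstep
      _ = _ := by rw [Finset.sum_add_distrib, ← Finset.mul_sum, ← Finset.mul_sum]
  · intro G hG
    set J := I.filter fun z => closedCell ℓ z ⊆ G with hJ
    have hJI : J ⊆ I := Finset.filter_subset _ _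
    have h1 : {y ∈ closure D | Metric.closedBall y (2 * ℓ) ⊆ G} ⊆ ⋃ z ∈ J, index ℓ ⁻¹' {z} := by
      rintro y ⟨hy, hyG⟩
      refine Set.mem_biUnion (x := index ℓ y) ?_ rfl
      refine Finset.mem_filter.2 ⟨(hIm _).2 ⟨y, mem_closedCell_index hℓ y, hy⟩, ?_⟩
      exact fun q hq => hyG (dist_le_of_mem_closedSq hq (mem_closedCell_index hℓ y))
    have h2 := hxG G J hJI fun z hz => by
      obtain ⟨hzI, hzG⟩ := Finset.mem_filter.1 hz
      exact ⟨hzG (hp z hzI).1, fun y hy => hzG (hScl z hzI y hy).1⟩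
    set N := (Finset.univ.filter fun i => x i ∈ G).card with hN
    have h3 : (∑ z ∈ J, (ρ (index ℓ ⁻¹' {z})).toReal) * n ≤ N + κ * n := by
      have k1 : ∀ z ∈ J, (ρ (index ℓ ⁻¹' {z})).toReal * n ≤ (K z : ℝ) + 1 := by
        intro z _
        have k2 : (ρ (index ℓ ⁻¹' {z})).toReal ≤ b z := by
          simp only [hb]; split_ifs <;> nlinarith [sq_nonneg ℓ]
        exact (mul_le_mul_of_nonneg_right k2 hn'.le).trans (Nat.lt_floor_add_one _).le
      rw [Finset.sum_mul]
      refine (Finset.sum_le_sum k1).trans ?_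
      rw [Finset.sum_add_distrib]
      have k3 : ∑ z ∈ J, (K z : ℝ) ≤ N := by exact_mod_cast h2
      have k4 : (J.card : ℝ) ≤ I.card := by exact_mod_cast Finset.card_le_card hJI
      simp only [Finset.sum_const, nsmul_eq_mul, mul_one]
      linarith
    have h4 : empirical n x G = ENNReal.ofReal (N / n) := by
      rw [empirical_apply n x hG.measurableSet, ← ENNReal.div_eq_inv_mul,
        ENNReal.ofReal_div_of_pos hn', ENNReal.ofReal_natCast, ENNReal.ofReal_natCast]
    calc ρ {y ∈ closure D | Metric.closedBall y (2 * ℓ) ⊆ G}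
        ≤ ∑ z ∈ J, ρ (index ℓ ⁻¹' {z}) := (measure_mono h1).trans
          (measure_biUnion_index_fiber ρ ℓ J).le
      _ = ENNReal.ofReal (∑ z ∈ J, (ρ (index ℓ ⁻¹' {z})).toReal) := by
          rw [ENNReal.ofReal_sum_of_nonneg fun z _ => ENNReal.toReal_nonneg]
          exact Finset.sum_congr rfl fun z _ => (ENNReal.ofReal_toReal (measure_ne_top _ _)).symm
      _ ≤ ENNReal.ofReal (N / n + κ) := by
          refine ENNReal.ofReal_le_ofReal ?_
          rw [← le_div_iff₀ hn', add_div, mul_div_cancel_right₀ _ hn'.ne'] at h3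
          exact h3
      _ = _ := by rw [h4, ENNReal.ofReal_add (by positivity) hκ.le]

end Upper

/-! ### Recovery of a measure of mass less than one -/

section Recovery

variable {α m : ℝ} {D : Set Plane} {g : Plane → ℝ}

lemma tendsto_lintegral_stepFun_density (hα : 0 < α) (hm : 0 < m) (hDo : IsOpen D)
    (hDb : Bornology.IsBounded D) {h : Plane → ℝ} (hc : Continuous h) (hs : HasCompactSupport h)
    {v : Plane → ℝ≥0∞} (hv : Measurable v) [IsFiniteMeasure (volume.withDensity v)]
    {ε : ℝ} (hε : 0 < ε) (κ : ℝ)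
    {ℓ : ℕ → ℝ} (hℓ : ∀ k, 0 < ℓ k) (h0 : Tendsto ℓ atTop (𝓝 0)) :
    Tendsto (fun k => ∫⁻ x in D, stepFun (ℓ k) D (fun z => ENNReal.ofReal (h (corner (ℓ k) z) ^ 2) *
        (density α m ((volume.withDensity v (closedCell (ℓ k) z)).toReal / ℓ k ^ 2 + ε) +
          ENNReal.ofReal κ)) x) atTop
      (𝓝 (∫⁻ x in D, ENNReal.ofReal (h x ^ 2) *
        (density α m ((v x).toReal + ε) + ENNReal.ofReal κ))) := by
  obtain ⟨R, hR⟩ := hs.exists_bound_of_continuous hc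
  set M := density α m ε with hM
  have hMt : M ≠ ⊤ := density_ne_top hα hm hε
  set F : ℕ → ℤ × ℤ → ℝ≥0∞ := fun k z => ENNReal.ofReal (h (corner (ℓ k) z) ^ 2) *
    (density α m ((volume.withDensity v (closedCell (ℓ k) z)).toReal / ℓ k ^ 2 + ε) +
      ENNReal.ofReal κ) with hF
  refine tendsto_lintegral_of_dominated_convergence
    (fun _ => ENNReal.ofReal (R ^ 2) * (M + ENNReal.ofReal κ))
    (fun k => measurable_stepFun _ _ _) (fun k => Eventually.of_forall fun x => ?_) ?_ ?_
  · have h1 : ∀ z, F k z ≤ ENNReal.ofReal (R ^ 2) * (M + ENNReal.ofReal κ) := fun z => by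
      have := hℓ k
      refine mul_le_mul' (ENNReal.ofReal_le_ofReal ?_) (add_le_add_left
        (density_anti hα hm hε (le_add_of_nonneg_left (by positivity))) _)
      rw [← sq_abs, ← Real.norm_eq_abs]
      gcongr
      exact hR _
    rw [stepFun]
    split_ifs
    · exact h1 _
    · exact zero_le
  · rw [lintegral_const, Measure.restrict_apply_univ]
    exact ENNReal.mul_ne_top (ENNReal.mul_ne_top ENNReal.ofReal_ne_top
      (ENNReal.add_ne_top.2 ⟨hMt, ENNReal.ofReal_ne_top⟩)) hDb.measure_lt_top.ne
  · filter_upwards [ae_restrict_of_ae (ae_tendsto_closedCell_div (volume.withDensity v) hℓ h0),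
      ae_restrict_of_ae (Measure.rnDeriv_lt_top (volume.withDensity v) volume),
      ae_restrict_of_ae (Measure.rnDeriv_withDensity volume hv),
      ae_restrict_mem hDo.measurableSet] with x h1 h2 h3 hx
    rw [h3] at h1 h2
    have k1 : Tendsto (fun k => F k (index (ℓ k) x)) atTop
        (𝓝 (ENNReal.ofReal (h x ^ 2) * (density α m ((v x).toReal + ε) + ENNReal.ofReal κ))) := by
      have k2 : Tendsto (fun k => ENNReal.ofReal (h (corner (ℓ k) (index (ℓ k) x)) ^ 2)) atTop
          (𝓝 (ENNReal.ofReal (h x ^ 2))) :=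
        ENNReal.tendsto_ofReal (((hc.tendsto x).comp (tendsto_corner_index hℓ h0 x)).pow 2)
      have k3 : Tendsto (fun k => (volume.withDensity v
          (closedCell (ℓ k) (index (ℓ k) x))).toReal / ℓ k ^ 2 + ε)
          atTop (𝓝 ((v x).toReal + ε)) := by
        refine Tendsto.add_const _ (((ENNReal.tendsto_toReal h2.ne).comp h1).congr fun k => ?_)
        have := hℓ k
        simp only [Function.comp, ENNReal.toReal_div]
        rw [ENNReal.toReal_ofReal (by positivity)]
      have hpos : 0 < (v x).toReal + ε := by positivity
      have k4 := ((continuousAt_density hα hm hpos).tendsto.comp k3).add_const (ENNReal.ofReal κ)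
      refine ENNReal.Tendsto.mul k2 (Or.inr ?_) k4 (Or.inr ENNReal.ofReal_ne_top)
      exact ENNReal.add_ne_top.2 ⟨density_ne_top hα hm hpos, ENNReal.ofReal_ne_top⟩
    exact k1.congr' ((eventually_stepFun_eq hℓ h0 hDo hx F).mono fun k hk => hk.symm)

lemma exists_pos_mul_lt {B : ℝ≥0∞} (hB : B ≠ ⊤) {η : ℝ} (hη : 0 < η) :
    ∃ δ : ℝ, 0 < δ ∧ ENNReal.ofReal ((1 + δ) ^ 2) * B < B + ENNReal.ofReal η := by
  have ht : Tendsto (fun δ : ℝ => δ) (𝓝[>] 0) (𝓝 0) := nhdsWithin_le_nhds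
  have h2 : Tendsto (fun δ : ℝ => ENNReal.ofReal ((1 + δ) ^ 2) * B) (𝓝[>] 0) (𝓝 B) := by
    have := ENNReal.Tendsto.mul_const (b := B) (ENNReal.tendsto_ofReal ((ht.const_add 1).pow 2))
      (Or.inl (by simp))
    simpa using this
  obtain ⟨δ, h3, h4⟩ := ((h2.eventually_lt_const (ENNReal.lt_add_right hB
    (by simpa using hη : ENNReal.ofReal η ≠ 0))).and self_mem_nhdsWithin).exists
  exact ⟨δ, h4, h3⟩

lemma exists_pos_add_mul_lt {A E B : ℝ≥0∞} (hE : E ≠ ⊤) (h : A < B) {b : ℝ} (hb : 0 < b) :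
    ∃ κ : ℝ, 0 < κ ∧ κ ≤ b ∧ A + E * ENNReal.ofReal κ < B := by
  have ht : Tendsto (fun η : ℝ => η) (𝓝[>] 0) (𝓝 0) := nhdsWithin_le_nhds
  have h2 : Tendsto (fun η : ℝ => A + E * ENNReal.ofReal η) (𝓝[>] 0) (𝓝 (A + E * 0)) := by
    refine tendsto_const_nhds.add (ENNReal.Tendsto.const_mul ?_ (Or.inr hE))
    simpa using ENNReal.tendsto_ofReal ht
  rw [mul_zero, add_zero] at h2
  obtain ⟨κ, h3, h4, h5⟩ := ((h2.eventually_lt_const h).and (Ioc_mem_nhdsGT hb)).exists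
  exact ⟨κ, h4, h5, h3⟩

lemma exists_recovery_of_mass_lt_one (hα : 0 < α) (hm : 0 < m) (hDo : IsOpen D)
    (hDb : Bornology.IsBounded D) (hDne : D.Nonempty) (hDf : volume (frontier D) = 0)
    (hg : MemLp g 2 (volume.restrict D)) {ρ : Measure Plane} [IsFiniteMeasure ρ]
    (hρ : ρ Set.univ < 1) {v : Plane → ℝ≥0∞} (hv : Measurable v)
    (hvρ : volume.withDensity v ≤ ρ) {B : ℝ≥0∞} (hBt : B ≠ ⊤)
    (hB : ∀ ε > 0, ∫⁻ x in D, ENNReal.ofReal (g x ^ 2) * density α m ((v x).toReal + ε) ≤ B)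
    {η : ℝ} (hη : 0 < η) :
    ∀ᶠ n : ℕ in atTop, ∃ x : Fin n → Plane, (∀ i, x i ∈ closure D) ∧
      n * cpl α 1 D (balls (Finset.univ.image x) (radius m n)) g ≤ B + ENNReal.ofReal η ∧
      ∀ G : Set Plane, IsOpen G → ρ {y ∈ closure D | Metric.closedBall y η ⊆ G} ≤
        empirical n x G + ENNReal.ofReal η := by
  have hfin : IsFiniteMeasure (volume.withDensity v) := isFiniteMeasure_of_le ρ hvρ
  set V := (volume D).toReal with hV
  have hγ : 0 < 1 - (ρ Set.univ).toReal := by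
    have := (ENNReal.toReal_lt_toReal (measure_ne_top ρ _) ENNReal.one_ne_top).2 hρ
    rw [ENNReal.toReal_one] at this
    linarith
  set γ := 1 - (ρ Set.univ).toReal with hγd
  obtain ⟨ε, hε, hεV⟩ : ∃ ε > 0, 2 * ε * V ≤ γ / 2 := by
    refine ⟨γ / (4 * (V + 1)), by positivity, ?_⟩
    have hV0 : 0 ≤ V := ENNReal.toReal_nonneg
    rw [mul_div_assoc', div_mul_eq_mul_div, div_le_iff₀ (by positivity)]
    nlinarith
  obtain ⟨C, hC0, hC⟩ := exists_upper_cell hα hm hε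
  set d : Plane → ℝ≥0∞ := fun x => density α m ((v x).toReal + ε) with hd
  set M := density α m ε with hM
  have hMt : M ≠ ⊤ := density_ne_top hα hm hε
  have hdM : ∀ x, d x ≤ M := fun x =>
    density_anti hα hm hε (by linarith [ENNReal.toReal_nonneg (a := v x)])
  set N := ∫⁻ x in D, ENNReal.ofReal (g x ^ 2) with hN
  have hNt : N ≠ ⊤ := by
    rw [hN, ← ofReal_integral_eq_lintegral_ofReal hg.integrable_sq
      (Eventually.of_forall fun x => sq_nonneg _)]
    exact ENNReal.ofReal_ne_top
  obtain ⟨δ, hδ, hδB⟩ := exists_pos_mul_lt hBt hη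
  set E : ℝ≥0∞ := ENNReal.ofReal ((1 + δ) ^ 2) * N +
    ENNReal.ofReal (1 + δ) * (ENNReal.ofReal (1 + δ⁻¹) * (M + 1)) + ENNReal.ofReal (1 + δ) +
    ENNReal.ofReal (1 + δ⁻¹) * ENNReal.ofReal (C * 4) with hE
  have hEt : E ≠ ⊤ := by
    simp only [hE, ne_eq, ENNReal.add_eq_top, not_or]
    exact ⟨⟨⟨ENNReal.mul_ne_top ENNReal.ofReal_ne_top hNt,
      ENNReal.mul_ne_top ENNReal.ofReal_ne_top (ENNReal.mul_ne_top ENNReal.ofReal_ne_top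
        (ENNReal.add_ne_top.2 ⟨hMt, ENNReal.one_ne_top⟩))⟩, ENNReal.ofReal_ne_top⟩,
      ENNReal.mul_ne_top ENNReal.ofReal_ne_top ENNReal.ofReal_ne_top⟩
  obtain ⟨κ, hκ, hκb, hκE⟩ := exists_pos_add_mul_lt hEt hδB (b := min 1 η) (by positivity)
  obtain ⟨h, hc, hs, hh, hgh⟩ := exists_continuous_approx hDo.measurableSet hg hκ
  set ℓ : ℕ → ℝ := fun k => 1 / ((k : ℝ) + 1) with hℓdef
  have hℓ : ∀ k, 0 < ℓ k := fun k => by positivity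
  have h0 : Tendsto ℓ atTop (𝓝 0) := tendsto_one_div_add_atTop_nhds_zero_nat
  have hlim := tendsto_lintegral_stepFun_density hα hm hDo hDb hc hs hv hε κ hℓ h0
  have hgd : ∫⁻ x in D, ENNReal.ofReal (g x ^ 2) * (d x + ENNReal.ofReal κ) ≤
      B + N * ENNReal.ofReal κ := by
    simp only [mul_add]
    rw [lintegral_add_right' _
      ((hg.integrable_sq.aestronglyMeasurable.aemeasurable.ennreal_ofReal).mul_const _),
      lintegral_mul_const' _ _ ENNReal.ofReal_ne_top]
    exact add_le_add_left (hB ε hε) _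
  have hgh' : ∫ x in D, (g x - h x) ^ 2 ≤ κ := by
    refine le_trans (le_of_eq ?_) hgh
    refine integral_congr_ae (Eventually.of_forall fun x => ?_)
    change (g x - h x) ^ 2 = (h x - g x) ^ 2
    ring
  have hhd := lintegral_sq_mul_le hδ hh hg hgh' (d := fun x => d x + ENNReal.ofReal κ)
    (M := M + 1) fun x => add_le_add (hdM x) (by
      rw [← ENNReal.ofReal_one]; exact ENNReal.ofReal_le_ofReal (hκb.trans (min_le_left _ _)))
  have hXt : ∫⁻ x in D, ENNReal.ofReal (h x ^ 2) * (d x + ENNReal.ofReal κ) ≠ ⊤ := by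
    refine ne_top_of_le_ne_top ?_ (hhd.trans (add_le_add_left (mul_le_mul_right hgd _) _))
    exact ENNReal.add_ne_top.2 ⟨ENNReal.mul_ne_top ENNReal.ofReal_ne_top (ENNReal.add_ne_top.2
      ⟨hBt, ENNReal.mul_ne_top hNt ENNReal.ofReal_ne_top⟩),
      ENNReal.mul_ne_top ENNReal.ofReal_ne_top (ENNReal.mul_ne_top
        (ENNReal.add_ne_top.2 ⟨hMt, ENNReal.one_ne_top⟩) ENNReal.ofReal_ne_top)⟩
  have hthick : Tendsto (fun k => volume (Metric.cthickening (3 * ℓ k) (frontier D))) atTop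
      (𝓝 0) := by
    have hcomp : IsCompact (frontier D) := Metric.isCompact_of_isClosed_isBounded isClosed_frontier
      (hDb.closure.subset frontier_subset_closure)
    have h1 := tendsto_measure_cthickening_of_isCompact (μ := (volume : Measure Plane)) hcomp
    rw [hDf] at h1
    exact h1.comp (by simpa using h0.const_mul 3)
  have hβ : (0 : ℝ≥0∞) < ENNReal.ofReal (γ / 2 * m ^ 2 / 4) := by
    rw [ENNReal.ofReal_pos]; positivity
  obtain ⟨k, hk1, hk2, hk3, hk4⟩ := ((hlim.eventually_lt_const (ENNReal.lt_add_right hXt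
    (by simpa using hκ : ENNReal.ofReal κ ≠ 0))).and
    ((eventually_sum_integral_le hDb hg hh hc hs hκ hgh hℓ h0).and
    ((hthick.eventually_lt_const hβ).and
    (h0.eventually_lt_const (show 0 < η / 2 by positivity))))).exists
  have hfinZ := finite_setOf_cell_subset (hℓ k) hDb
  have hZ : ∀ z, z ∈ hfinZ.toFinset ↔ cell (ℓ k) z ⊆ D := fun z => by simp
  rw [lintegral_stepFun (hℓ k) hDo.measurableSet hZ] at hk1
  filter_upwards [exists_recovery_on_grid hα hm hDo hDb hDne hg hvρ hε hC (hℓ k)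
    (half_pos hγ) hk3.le (by linarith) hZ (fun z => h (corner (ℓ k) z)) hδ hκ] with n hn
  obtain ⟨x, hx1, hx2, hx3⟩ := hn
  refine ⟨x, hx1, hx2.trans (le_trans ?_ hκE.le), fun G hG => ?_⟩
  · have k1 : ∑ z ∈ hfinZ.toFinset, ENNReal.ofReal (h (corner (ℓ k) z) ^ 2 * ℓ k ^ 2) *
        (density α m ((volume.withDensity v (closedCell (ℓ k) z)).toReal / ℓ k ^ 2 + ε) +
          ENNReal.ofReal κ) ≤
        ENNReal.ofReal (1 + δ) * (B + N * ENNReal.ofReal κ) +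
          ENNReal.ofReal (1 + δ⁻¹) * ((M + 1) * ENNReal.ofReal κ) + ENNReal.ofReal κ := by
      refine le_trans (le_of_eq (Finset.sum_congr rfl fun z _ => ?_))
        (hk1.le.trans (add_le_add_left (hhd.trans (add_le_add_left (mul_le_mul_right hgd _) _)) _))
      rw [ENNReal.ofReal_mul (sq_nonneg _)]
      ring
    have k2 : ∑ z ∈ hfinZ.toFinset,
        ENNReal.ofReal (C * ∫ x in cell (ℓ k) z, (h (corner (ℓ k) z) - g x) ^ 2) ≤
        ENNReal.ofReal (C * (4 * κ)) := by
      rw [← ENNReal.ofReal_sum_of_nonneg fun z _ => mul_nonneg hC0.le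
        (integral_nonneg fun x => sq_nonneg _), ← Finset.mul_sum]
      gcongr
      exact hk2 _ fun z hz => (hZ z).1 hz
    refine (add_le_add (mul_le_mul_right k1 _) (mul_le_mul_right k2 _)).trans (le_of_eq ?_)
    rw [hE, ENNReal.ofReal_pow (by positivity), ← mul_assoc C,
      ENNReal.ofReal_mul (p := C * 4) (by positivity)]
    ring
  · have hκη : κ ≤ η := hκb.trans (min_le_right _ _)
    calc ρ {y ∈ closure D | Metric.closedBall y η ⊆ G}
        ≤ ρ {y ∈ closure D | Metric.closedBall y (2 * ℓ k) ⊆ G} := by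
          refine measure_mono fun y hy => ⟨hy.1, ?_⟩
          exact (Metric.closedBall_subset_closedBall (by linarith)).trans hy.2
      _ ≤ empirical n x G + ENNReal.ofReal κ := hx3 G hG
      _ ≤ _ := by gcongr

end Recovery

/-! ### The upper bound -/

section LimSup

variable {α m : ℝ} {D : Set Plane} {g : Plane → ℝ}

lemma theta_zero (α : ℝ) : theta α 0 = ⊤ := by
  refine le_antisymm le_top (le_iInf₂ fun x hx => ?_)
  have := hx 1 0
  simp [radius, Metric.thickening_of_nonpos] at this

lemma measurable_density_max (hα : 0 < α) (hm : 0 < m) {t : ℝ} (ht : 0 < t) :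
    Measurable fun a : ℝ => density α m (max a t) :=
  Antitone.measurable fun _ _ hab => density_anti hα hm (lt_max_of_lt_right ht)
    (max_le_max_right t hab)

/-- The density obtained by decreasing `u` by the factor `1 - e` where `τ ≤ u`. -/
def shrink (τ : ℝ≥0∞) (e : ℝ) (u : Plane → ℝ≥0∞) (x : Plane) : ℝ≥0∞ :=
  ENNReal.ofReal (1 - e) * u x + ENNReal.ofReal e * {y | u y < τ}.indicator u x

lemma shrink_of_lt {τ : ℝ≥0∞} {e : ℝ} (he : 0 ≤ e) (he1 : e ≤ 1) {u : Plane → ℝ≥0∞} {x : Plane}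
    (h : u x < τ) : shrink τ e u x = u x := by
  rw [shrink, Set.indicator_of_mem (by exact h), ← add_mul,
    ← ENNReal.ofReal_add (by linarith) he]
  simp

lemma shrink_of_le {τ : ℝ≥0∞} {e : ℝ} {u : Plane → ℝ≥0∞} {x : Plane}
    (h : τ ≤ u x) : shrink τ e u x = ENNReal.ofReal (1 - e) * u x := by
  rw [shrink, Set.indicator_of_notMem (by simpa using h)]
  simp

lemma measurable_shrink (τ : ℝ≥0∞) (e : ℝ) {u : Plane → ℝ≥0∞} (hu : Measurable u) :
    Measurable (shrink τ e u) :=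
  (hu.const_mul _).add ((hu.indicator (measurableSet_lt hu measurable_const)).const_mul _)

lemma exists_shrink_bound (hα : 0 < α) (hm : 0 < m)
    (hg : MemLp g 2 (volume.restrict D)) {u : Plane → ℝ≥0∞} (hu : Measurable u)
    (hut : ∀ᵐ x, u x < ⊤) {t : ℝ} (ht : 0 < t)
    (hF : ∫⁻ x in D, ENNReal.ofReal (g x ^ 2) / u x * theta α (m * √(u x).toReal) ≠ ⊤)
    {η : ℝ} (hη : 0 < η) :
    ∃ e : ℝ, 0 < e ∧ e ≤ 1 ∧ e ≤ η ∧ ∃ B : ℝ≥0∞,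
      B < (∫⁻ x in D, ENNReal.ofReal (g x ^ 2) / u x * theta α (m * √(u x).toReal)) +
        ENNReal.ofReal η ∧
      ∀ ε > 0, ∫⁻ x in D, ENNReal.ofReal (g x ^ 2) *
        density α m ((shrink (ENNReal.ofReal t) e u x).toReal + ε) ≤ B := by
  set τ := ENNReal.ofReal t with hτ
  set A : Set Plane := {y | u y < τ} with hA
  have hAm : MeasurableSet A := measurableSet_lt hu measurable_const
  set f : Plane → ℝ≥0∞ := fun x => ENNReal.ofReal (g x ^ 2) / u x * theta α (m * √(u x).toReal)
    with hf
  set q : ℝ → Plane → ℝ≥0∞ := fun e x =>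
    ENNReal.ofReal (g x ^ 2) * density α m (max ((1 - e) * (u x).toReal) (t / 2)) with hq
  have hsplit : ∀ k : Plane → ℝ≥0∞, ∫⁻ x in D, k x =
      (∫⁻ x in A, k x ∂volume.restrict D) + ∫⁻ x in Aᶜ, k x ∂volume.restrict D := fun k =>
    (lintegral_add_compl k hAm).symm
  have huD : ∀ᵐ x ∂volume.restrict D, u x < ⊤ := ae_restrict_of_ae hut
  have hgm : AEMeasurable (fun x => ENNReal.ofReal (g x ^ 2)) (volume.restrict D) :=
    hg.integrable_sq.aestronglyMeasurable.aemeasurable.ennreal_ofReal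
  set M := density α m (t / 2) with hM
  have hMt : M ≠ ⊤ := density_ne_top hα hm (by positivity)
  have hreal : ∀ x, u x < ⊤ → τ ≤ u x → t ≤ (u x).toReal := fun x h1 h2 => by
    have := ENNReal.toReal_mono h1.ne h2
    rwa [hτ, ENNReal.toReal_ofReal ht.le] at this
  set e : ℕ → ℝ := fun k => 1 / ((k : ℝ) + 1) with he
  have he0 : ∀ k, 0 < e k := fun k => by positivity
  have het : Tendsto e atTop (𝓝 0) := tendsto_one_div_add_atTop_nhds_zero_nat
  have hlim : Tendsto (fun k => ∫⁻ x in Aᶜ, q (e k) x ∂volume.restrict D) atTop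
      (𝓝 (∫⁻ x in Aᶜ, f x ∂volume.restrict D)) := by
    refine tendsto_lintegral_of_dominated_convergence' (fun x => ENNReal.ofReal (g x ^ 2) * M)
      (fun k => ?_) (fun k => Eventually.of_forall fun x => ?_) ?_ ?_
    · refine (hgm.mul ?_).restrict
      exact ((measurable_density_max hα hm (half_pos ht)).comp
        (hu.ennreal_toReal.const_mul _)).aemeasurable
    · exact mul_le_mul_right (density_anti hα hm (half_pos ht) (le_max_right _ _)) _
    · refine ne_top_of_le_ne_top ?_ (setLIntegral_le_lintegral _ _)
      rw [lintegral_mul_const' _ _ hMt, ← ofReal_integral_eq_lintegral_ofReal hg.integrable_sq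
        (Eventually.of_forall fun x => sq_nonneg _)]
      exact ENNReal.mul_ne_top ENNReal.ofReal_ne_top hMt
    · filter_upwards [ae_restrict_of_ae huD, ae_restrict_mem hAm.compl] with x hx hxA
      have hτx : τ ≤ u x := by simpa [hA] using hxA
      have hux := hreal x hx hτx
      simp only [hf, integrand_eq hx.ne]
      refine ENNReal.Tendsto.const_mul ?_ (Or.inr ENNReal.ofReal_ne_top)
      have h1 : Tendsto (fun k => max ((1 - e k) * (u x).toReal) (t / 2)) atTop
          (𝓝 (max ((1 - 0) * (u x).toReal) (t / 2))) :=
        ((het.const_sub 1).mul_const _).max tendsto_const_nhds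
      rw [sub_zero, one_mul, max_eq_left (by linarith)] at h1
      exact (continuousAt_density hα hm (by linarith)).tendsto.comp h1
  have hlim2 := (tendsto_const_nhds (x := ∫⁻ x in A, f x ∂volume.restrict D)).add hlim
  rw [← hsplit f] at hlim2
  obtain ⟨k, hk1, hk2⟩ := ((hlim2.eventually_lt_const (ENNReal.lt_add_right hF
    (by simpa using hη : ENNReal.ofReal η ≠ 0))).and
    (het.eventually_lt_const (show 0 < min (1 / 2) η by positivity))).exists
  have hkh : e k < 1 / 2 := hk2.trans_le (min_le_left _ _)
  refine ⟨e k, he0 k, by linarith, (hk2.trans_le (min_le_right _ _)).le, _, hk1,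
    fun ε hε => ?_⟩
  rw [hsplit]
  refine add_le_add (lintegral_mono_ae ?_) (lintegral_mono_ae ?_)
  · filter_upwards [ae_restrict_of_ae huD, ae_restrict_mem hAm] with x hx hxA
    rw [shrink_of_lt (he0 k).le (by linarith) hxA]
    by_cases hgx : g x = 0
    · simp [hgx]
    have hg0 : ENNReal.ofReal (g x ^ 2) ≠ 0 := by simp; positivity
    by_cases hux : u x = 0
    · simp only [hf, hux, ENNReal.div_zero hg0, ENNReal.toReal_zero, Real.sqrt_zero, mul_zero,
        theta_zero]
      simp
    · simp only [hf, integrand_eq hx.ne]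
      refine mul_le_mul_right (density_anti hα hm (ENNReal.toReal_pos hux hx.ne) ?_) _
      linarith
  · filter_upwards [ae_restrict_of_ae huD, ae_restrict_mem hAm.compl] with x hx hxA
    have hτx : τ ≤ u x := by simpa [hA] using hxA
    have hux := hreal x hx hτx
    rw [shrink_of_le hτx, ENNReal.toReal_mul, ENNReal.toReal_ofReal (by linarith)]
    refine mul_le_mul_right (density_anti hα hm (lt_max_of_lt_right (half_pos ht)) ?_) _
    refine max_le (by linarith) ?_
    nlinarith

lemma exists_probabilityMeasure_map_eq {n : ℕ} (hn : 0 < n) {x : Fin n → Plane}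
    (hx : ∀ i, x i ∈ closure D) : ∃ w : ProbabilityMeasure (closure D),
      (w : Measure (closure D)).map Subtype.val = empirical n x := by
  set W : Measure (closure D) := (n : ℝ≥0∞)⁻¹ • ∑ i, Measure.dirac ⟨x i, hx i⟩ with hW
  have hmap : W.map Subtype.val = empirical n x := by
    ext s hs
    rw [Measure.map_apply measurable_subtype_coe hs, hW, empirical]
    simp only [Measure.smul_apply, Measure.finsetSum_apply,
      Measure.dirac_apply' _ hs, Measure.dirac_apply' _ (measurable_subtype_coe hs)]
    rfl
  have hp : IsProbabilityMeasure W := ⟨by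
    simp only [hW, Measure.smul_apply, Measure.finsetSum_apply, measure_univ, Finset.sum_const,
      Finset.card_univ, Fintype.card_fin, nsmul_eq_mul, mul_one, smul_eq_mul]
    exact ENNReal.inv_mul_cancel (by simpa using hn.ne') (by simp)⟩
  exact ⟨⟨W, hp⟩, hmap⟩

lemma eventually_exists_recovery (hα : 0 < α) (hm : 0 < m) (hDo : IsOpen D)
    (hDb : Bornology.IsBounded D) (hDf : volume (frontier D) = 0)
    (hg : MemLp g 2 (volume.restrict D)) (μ : ProbabilityMeasure (closure D))
    (hF : limitFunctional α D g m μ ≠ ⊤) {η : ℝ} (hη : 0 < η) :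
    ∀ᶠ n : ℕ in atTop, ∃ w : ProbabilityMeasure (closure D),
      pixelFunctional α D g m n w ≤ limitFunctional α D g m μ + ENNReal.ofReal η ∧
      ∀ G : Set Plane, IsOpen G →
        (μ : Measure (closure D)).map Subtype.val {y | Metric.closedBall y η ⊆ G} ≤
          (w : Measure (closure D)).map Subtype.val G + ENNReal.ofReal η := by
  set ρ := (μ : Measure (closure D)).map Subtype.val with hρ
  have hρp : IsProbabilityMeasure ρ :=
    Measure.isProbabilityMeasure_map measurable_subtype_coe.aemeasurable
  have hρc : ρ (closure D)ᶜ = 0 := by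
    rw [hρ, Measure.map_apply measurable_subtype_coe isClosed_closure.measurableSet.compl]
    simp
  have hDne : D.Nonempty := by
    obtain ⟨x⟩ : Nonempty (closure D) := (μ : Measure (closure D)).nonempty_of_neZero
    exact closure_nonempty_iff.1 ⟨x, x.2⟩
  set u := ρ.rnDeriv volume with hu
  have hum : Measurable u := Measure.measurable_rnDeriv _ _
  have huρ : volume.withDensity u ≤ ρ := Measure.withDensity_rnDeriv_le ρ volume
  set V := (volume (closure D)).toReal with hV
  have hVt : volume (closure D) ≠ ⊤ := hDb.closure.measure_lt_top.ne
  have hV0 : 0 ≤ V := ENNReal.toReal_nonneg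
  set t := 1 / (V + 1) with ht
  have ht0 : 0 < t := by positivity
  obtain ⟨e, he0, he1, heη, B, hB, hBε⟩ := exists_shrink_bound hα hm hg hum
    (ρ.rnDeriv_lt_top volume) ht0 hF (half_pos hη)
  set A : Set Plane := {y | u y < ENNReal.ofReal t} with hA
  have hAm : MeasurableSet A := measurableSet_lt hum measurable_const
  have hAu : ∫⁻ x, A.indicator u x < 1 := by
    have h1 : ∫⁻ x in (closure D)ᶜ, A.indicator u x = 0 := by
      refine le_antisymm ?_ zero_le
      refine (lintegral_mono fun x => Set.indicator_le_self A u x).trans ?_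
      rw [← withDensity_apply _ isClosed_closure.measurableSet.compl, ← hρc]
      exact huρ _
    have h2 : ∫⁻ x in closure D, A.indicator u x ≤ ENNReal.ofReal t * volume (closure D) := by
      rw [← setLIntegral_const]
      refine lintegral_mono fun x => ?_
      refine Set.indicator_le' (fun y hy => le_of_lt hy) (fun _ _ => zero_le) x
    rw [← lintegral_add_compl _ isClosed_closure.measurableSet, h1, add_zero]
    refine h2.trans_lt ?_
    rw [← ENNReal.ofReal_toReal hVt, ← ENNReal.ofReal_mul ht0.le, ← ENNReal.ofReal_one,
      ENNReal.ofReal_lt_ofReal_iff one_pos, ht, one_div_mul_eq_div, div_lt_one (by positivity)]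
    linarith
  set ρ' : Measure Plane := ENNReal.ofReal (1 - e) • ρ +
    ENNReal.ofReal e • volume.withDensity (A.indicator u) with hρ'
  have hAfin : IsFiniteMeasure (volume.withDensity (A.indicator u)) :=
    ⟨by rw [withDensity_apply _ MeasurableSet.univ, Measure.restrict_univ]
        exact hAu.trans ENNReal.one_lt_top⟩
  have hfin1 : IsFiniteMeasure (ENNReal.ofReal (1 - e) • ρ) :=
    ρ.smul_finite ENNReal.ofReal_ne_top
  have hfin2 : IsFiniteMeasure (ENNReal.ofReal e • volume.withDensity (A.indicator u)) :=
    Measure.smul_finite _ ENNReal.ofReal_ne_top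
  have hρ'1 : ρ' Set.univ < 1 := by
    simp only [hρ', Measure.add_apply, Measure.smul_apply, measure_univ, smul_eq_mul, mul_one,
      withDensity_apply _ MeasurableSet.univ, Measure.restrict_univ]
    have h1 : ENNReal.ofReal e * ∫⁻ x, A.indicator u x < ENNReal.ofReal e * 1 :=
      ENNReal.mul_lt_mul_right (by simpa using he0) ENNReal.ofReal_ne_top hAu
    calc _ < ENNReal.ofReal (1 - e) + ENNReal.ofReal e * 1 :=
          ENNReal.add_lt_add_left ENNReal.ofReal_ne_top h1
      _ = 1 := by
          rw [mul_one, ← ENNReal.ofReal_add (by linarith) he0.le]; simp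
  have hvρ' : volume.withDensity (shrink (ENNReal.ofReal t) e u) ≤ ρ' := by
    have e1 : shrink (ENNReal.ofReal t) e u =
        ENNReal.ofReal (1 - e) • u + ENNReal.ofReal e • A.indicator u := by
      ext x; simp [shrink, hA]
    rw [e1, withDensity_add_left (hum.const_smul _), withDensity_smul _ hum,
      withDensity_smul _ (hum.indicator hAm)]
    refine Measure.le_iff.2 fun s _ => ?_
    simp only [hρ', Measure.add_apply, Measure.smul_apply, smul_eq_mul]
    gcongr
  have hρρ' : ∀ s, ρ s ≤ ρ' s + ENNReal.ofReal e := by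
    intro s
    have h1 : ρ s = ENNReal.ofReal (1 - e) * ρ s + ENNReal.ofReal e * ρ s := by
      rw [← add_mul, ← ENNReal.ofReal_add (by linarith) he0.le]; simp
    rw [h1]
    refine add_le_add ?_ (mul_le_of_le_one_right zero_le prob_le_one)
    simp only [hρ', Measure.add_apply, Measure.smul_apply, smul_eq_mul]
    exact le_self_add
  have hη2 : ENNReal.ofReal (η / 2) + ENNReal.ofReal (η / 2) = ENNReal.ofReal η := by
    rw [← ENNReal.ofReal_add (by positivity) (by positivity)]; ring_nf
  filter_upwards [exists_recovery_of_mass_lt_one hα hm hDo hDb hDne hDf hg hρ'1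
    (measurable_shrink _ e hum) hvρ' hB.ne_top hBε (half_pos hη), eventually_gt_atTop 0]
    with n hn hn0
  obtain ⟨x, hx1, hx2, hx3⟩ := hn
  obtain ⟨w, hw⟩ := exists_probabilityMeasure_map_eq hn0 hx1
  have hn' : (0 : ℝ) < n := by exact_mod_cast hn0
  have hr0 : 0 < radius m n := by rw [radius]; positivity
  refine ⟨w, ?_, fun G hG => ?_⟩
  · have hadm : AdmissibleCentres D m n x := fun i =>
      Metric.closure_subset_thickening hr0 D (hx1 i)
    have h1 : pixelFunctional α D g m n w ≤ rescaledCompliance α D g n (pixelSet D m n x) :=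
      iInf_le_of_le x (iInf_le_of_le hadm (iInf_le _ hw))
    rw [rescaledCompliance_pixelSet hα hg] at h1
    refine (h1.trans hx2).trans ?_
    rw [← hη2, ← add_assoc]
    exact add_le_add_left hB.le _
  · rw [hw]
    calc ρ {y | Metric.closedBall y η ⊆ G}
        ≤ ρ ({y ∈ closure D | Metric.closedBall y (η / 2) ⊆ G} ∪ (closure D)ᶜ) := by
          refine measure_mono fun y hy => ?_
          by_cases hyD : y ∈ closure D
          · exact Or.inl ⟨hyD, (Metric.closedBall_subset_closedBall (by linarith)).trans hy⟩
          · exact Or.inr hyD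
      _ ≤ ρ {y ∈ closure D | Metric.closedBall y (η / 2) ⊆ G} + 0 := by
          rw [← hρc]; exact measure_union_le _ _
      _ ≤ ρ' {y ∈ closure D | Metric.closedBall y (η / 2) ⊆ G} + ENNReal.ofReal e := by
          rw [add_zero]; exact hρρ' _
      _ ≤ empirical n x G + ENNReal.ofReal (η / 2) + ENNReal.ofReal (η / 2) :=
          add_le_add (hx3 G hG) (ENNReal.ofReal_le_ofReal heη)
      _ = _ := by rw [add_assoc, hη2]

lemma exists_diagonal {P : ℕ → ℕ → Prop} (h : ∀ j, ∀ᶠ n in atTop, P j n) :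
    ∃ φ : ℕ → ℕ, Tendsto φ atTop atTop ∧ ∀ᶠ n in atTop, P (φ n) n := by
  classical
  choose N hN using fun j => eventually_atTop.1 (h j)
  refine ⟨fun n => Nat.findGreatest (fun j => N j ≤ n) n, tendsto_atTop.2 fun J => ?_, ?_⟩
  · filter_upwards [eventually_ge_atTop J, eventually_ge_atTop (N J)] with n h1 h2
    exact Nat.le_findGreatest h1 h2
  · filter_upwards [eventually_ge_atTop (N 0)] with n hn
    exact hN _ _ (Nat.findGreatest_spec (P := fun j => N j ≤ n) (Nat.zero_le n) hn)

lemma exists_recovery_sequence (hα : 0 < α) (hm : 0 < m) (hDo : IsOpen D)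
    (hDb : Bornology.IsBounded D) (hDf : volume (frontier D) = 0)
    (hg : MemLp g 2 (volume.restrict D)) (μ : ProbabilityMeasure (closure D)) :
    ∃ w : ℕ → ProbabilityMeasure (closure D), Tendsto w atTop (𝓝 μ) ∧
      limsup (fun n => pixelFunctional α D g m n (w n)) atTop ≤ limitFunctional α D g m μ := by
  classical
  by_cases hF : limitFunctional α D g m μ = ⊤
  · exact ⟨fun _ => μ, tendsto_const_nhds, hF ▸ le_top⟩
  set ρ := (μ : Measure (closure D)).map Subtype.val with hρ
  set η : ℕ → ℝ := fun j => 1 / ((j : ℝ) + 1) with hη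
  have hη0 : ∀ j, 0 < η j := fun j => by positivity
  have hηt : Tendsto η atTop (𝓝 0) := tendsto_one_div_add_atTop_nhds_zero_nat
  have hηa : Antitone η := fun i j hij => by
    simp only [hη]; gcongr
  obtain ⟨φ, hφ, hP⟩ := exists_diagonal fun j =>
    eventually_exists_recovery hα hm hDo hDb hDf hg μ hF (hη0 j)
  have hηφ : Tendsto (fun n => η (φ n)) atTop (𝓝 0) := hηt.comp hφ
  obtain ⟨w, hw⟩ : ∃ w : ℕ → ProbabilityMeasure (closure D), ∀ᶠ n in atTop,
      pixelFunctional α D g m n (w n) ≤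
        limitFunctional α D g m μ + ENNReal.ofReal (η (φ n)) ∧
      ∀ G : Set Plane, IsOpen G → ρ {y | Metric.closedBall y (η (φ n)) ⊆ G} ≤
          (w n : Measure (closure D)).map Subtype.val G + ENNReal.ofReal (η (φ n)) := by
    obtain ⟨N, hN⟩ := eventually_atTop.1 hP
    refine ⟨fun n => if h : N ≤ n then (hN n h).choose else μ, ?_⟩
    filter_upwards [eventually_ge_atTop N] with n hn
    rw [dif_pos hn]
    exact (hN n hn).choose_spec
  refine ⟨w, tendsto_of_forall_isOpen_le_liminf_nat' fun G hG => ?_, ?_⟩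
  · obtain ⟨G', hG', rfl⟩ := isOpen_induced_iff.1 hG
    have hmap : ∀ ν : ProbabilityMeasure (closure D), (ν : Measure (closure D))
        (Subtype.val ⁻¹' G') = (ν : Measure (closure D)).map Subtype.val G' := fun ν =>
      (Measure.map_apply measurable_subtype_coe hG'.measurableSet).symm
    simp only [hmap]
    change ρ G' ≤ _
    set A : ℕ → Set Plane := fun j => {y | Metric.closedBall y (η j) ⊆ G'} with hA
    have hAm : Monotone A := fun i j hij y hy =>
      (Metric.closedBall_subset_closedBall (hηa hij)).trans hy
    have hAU : ⋃ j, A j = G' := by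
      refine Set.Subset.antisymm (Set.iUnion_subset fun j y hy =>
        hy (Metric.mem_closedBall_self (hη0 j).le)) fun y hy => ?_
      obtain ⟨r, hr, hball⟩ := Metric.nhds_basis_closedBall.mem_iff.1 (hG'.mem_nhds hy)
      obtain ⟨j, hj⟩ := (hηt.eventually_lt_const hr).exists
      exact Set.mem_iUnion.2 ⟨j, (Metric.closedBall_subset_closedBall hj.le).trans hball⟩
    have hlim := tendsto_measure_iUnion_atTop (μ := ρ) hAm
    rw [hAU] at hlim
    refine le_of_tendsto' hlim fun j => le_of_forall_le_add_mul ENNReal.one_ne_top fun ε hε => ?_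
    rw [one_mul, ← tsub_le_iff_right]
    refine le_liminf_of_le (by isBoundedDefault) ?_
    filter_upwards [hw, hηφ.eventually_lt_const hε, hφ.eventually_ge_atTop j] with n h1 h2 h3
    rw [tsub_le_iff_right]
    calc ρ (A j) ≤ ρ (A (φ n)) := measure_mono (hAm h3)
      _ ≤ _ := h1.2 G' hG'
      _ ≤ _ := by gcongr
  · refine le_of_forall_le_add_mul ENNReal.one_ne_top fun ε hε => ?_
    rw [one_mul]
    refine limsup_le_of_le (by isBoundedDefault) ?_
    filter_upwards [hw, hηφ.eventually_lt_const hε] with n h1 h2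
    exact h1.1.trans (by gcongr)

end LimSup

end FatPixels

end

theorem mainTheorem2 (α m : ℝ) (hα : 0 < α) (hm : 0 < m)
    (D : Set FatPixels.Plane) (hD_open : IsOpen D) (hD_bdd : Bornology.IsBounded D)
    (hD_bdry : MeasureTheory.volume (frontier D) = 0)
    (g : FatPixels.Plane → ℝ)
    (hg : MeasureTheory.MemLp g 2 (MeasureTheory.volume.restrict D))
    (hg_nonneg : ∀ᵐ x ∂(MeasureTheory.volume.restrict D), 0 ≤ g x) :
    FatPixels.GammaConverges
      (fun n => FatPixels.pixelFunctional α D g m n)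
      (FatPixels.limitFunctional α D g m) := by
  exact ⟨FatPixels.exists_recovery_sequence hα hm hD_open hD_bdd hD_bdry hg,
    fun _ _ hw => FatPixels.limitFunctional_le_liminf hα hm hD_open hD_bdd hg hw⟩
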